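/- **Setting.** Let $n\ge 3$, $[n]=\{1,\dots,n\}$, $X=\{x_1,\dots,x_n\}$ (input nodes) and $Y=\{y_1,\dots,y_n\}$. In the finite directed graphs considered below, exactly the nodes from $X\cup Y$ are labelled; two graphs are the same if they agree after a renaming of their unlabelled nodes. For a directed graph $G$ and a node $a$, let $E(a,G)$ be the subgraph consisting of the nodes $b$ from which $a$ is reachable (by a path of length $\ge 0$) and of the edges $(b',b'')$ such that $a$ is reachable from $b''$; let $L(a,G)$ be the subgraph consisting of the nodes $b$ reachable from $a$ and of the edges $(b',b'')$ such that $b'$ is reachable from $a$. A directed binary tree is a rooted tree in which every node has zero or two (unordered) children, with all edges directed from child to parent. A *structure* is a finite directed acyclic graph $S$ such that (i) a node of $S$ lies in $X$ iff it has no incoming edge; (ii) for each node $a$ of $S$, $E(a,S)$ is a directed binary tree with root $a$; (iii) $E(a,S)\neq E(b,S)$ for different nodes $a,b$ of $S$. Nodes of $S$ not in $X$ are computation nodes, and computation nodes without outgoing edge are output nodes. Let $\mathcal S_n$ be the set of structures $S$ whose output nodes are exactly $y_1,\dots,y_n$ and such that, for each $j\in[n]$, the leaves of $E(y_j,S)$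 are exactly $X\setminus\{x_j\}$. Let $c(S)$ be the number of computation nodes of $S$, and let $\mathcal S_n^{\rm co}$ be the set of $S\in\mathcal S_n$ (complexity-optimal structures) for which $c(S)$ is the minimum of $c$ over $\mathcal S_n$. An unordered pair $\langle a,b\rangle$ of nodes of $S\in\mathcal S_n$ is a *complement pair* of $S$ if for all $j\in[n]$: $x_j\in E(a,S)\iff x_j\notin E(b,S)$. Let $P(S)$ be the set of complement pairs of $S$. For $n\ge 4$, $S\in\mathcal S_{n-1}^{\rm co}$ and $\langle a,b\rangle\in P(S)$, the graph $g(a,b,S)$ is obtained from $S$ as follows. Split $a$ into two nodes $a_1,a_2$ joined by a new edge $(a_1,a_2)$, where $a_1$ keeps the incoming edges of $a$ and $a_2$ keeps its outgoing edges, and split $b$ likewise into $b_1,b_2$ (if the split node is an input node $x_j$, its label passes to the first of the two new nodes; if it is an output node $y_j$, its label passes to the second; otherwise both new nodes are unlabelled). Then add nodes $x_n$, $y_n$ and the edges $(x_n,a_2)$, $(x_n,b_2)$, $(a_1,y_n)$, $(b_1,y_n)$. **Theorem.** For every $n\ge3$: * (C1) For every $S\in\mathcal S_n^{\rm co}$,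 each non-output node of $S$ has exactly two outgoing edges. * (C2) For every $S\in\mathcal S_n^{\rm co}$, every node $a$ of $S$ and every $j\in[n]$: $x_j\in E(a,S)\iff y_j\notin L(a,S)$. * (C3) For every $S\in\mathcal S_n^{\rm co}$ and every node $a$ of $S$ there is a unique node $b$ of $S$ with $\langle a,b\rangle\in P(S)$. * (C4) If $n\ge 4$, then $\mathcal S_n^{\rm co}=\{g(a,b,S): S\in\mathcal S_{n-1}^{\rm co},\ \langle a,b\rangle\in P(S)\}$. * (C5) $|\mathcal S_n^{\rm co}|=(2n-5)!!=(2n-5)\times(2n-7)\times\cdots\times 1$. In (C4) and (C5), graphs are counted and compared up to renaming of unlabelled nodes. -/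

import Mathlib

open scoped Nat

namespace NodeComputation

/-- Nodes of the graphs considered: the labelled nodes `x j` (`j`-th input) and `y j` (`j`-th
output), and an infinite supply `u k` of names for the nodes that carry no label. Graphs are
compared up to renaming of the nodes `u k`, see `LGraph.Same`. -/
inductive Node : Type
  | x (j : ℕ) : Node
  | y (j : ℕ) : Node
  | u (k : ℕ) : Node
  deriving DecidableEq

/-- Renaming of the unlabelled nodes. The labelled ones are fixed. -/
def Node.rename (σ : Equiv.Perm ℕ) : Node → Node
  | .x j => .x j
  | .y j => .y j
  | .u k => .u (σ k)

/-- The index of an unlabelled node (and `0` for the labelled ones). -/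
def Node.index : Node → ℕ
  | .u k => k
  | _ => 0

/-- `X n = {x_1, …, x_n}`. -/
def X (n : ℕ) : Finset Node := (Finset.Icc 1 n).image Node.x

/-- `Y n = {y_1, …, y_n}`. -/
def Y (n : ℕ) : Finset Node := (Finset.Icc 1 n).image Node.y

/-- A finite directed graph with nodes in `Node`; `(a, b) ∈ edges` is the directed edge from `a`
to `b`. (Self-loops are excluded where acyclicity is required.) -/
structure LGraph where
  nodes : Finset Node
  edges : Finset (Node × Node)
  edges_mem : ∀ e ∈ edges, e.1 ∈ nodes ∧ e.2 ∈ nodes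

namespace LGraph

/-- Two (partially unlabelled) graphs are the same iff they agree after a suitable naming of the
unlabelled nodes. -/
def Same (G H : LGraph) : Prop :=
  ∃ σ : Equiv.Perm ℕ, H.nodes = G.nodes.image (Node.rename σ) ∧
    H.edges = G.edges.image (Prod.map (Node.rename σ) (Node.rename σ))

theorem rename_refl : Node.rename (Equiv.refl ℕ) = id := by
  funext a; cases a <;> rfl

theorem rename_comp (σ τ : Equiv.Perm ℕ) :
    Node.rename τ ∘ Node.rename σ = Node.rename (σ.trans τ) := by
  funext a; cases a <;> rfl

theorem Same.refl (G : LGraph) : Same G G :=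
  ⟨Equiv.refl ℕ, by simp [rename_refl], by simp [rename_refl]⟩

theorem Same.trans {G H K : LGraph} : Same G H → Same H K → Same G K := by
  rintro ⟨σ, h1, h2⟩ ⟨τ, h3, h4⟩
  refine ⟨σ.trans τ, ?_, ?_⟩
  · rw [h3, h1, Finset.image_image, rename_comp]
  · rw [h4, h2, Finset.image_image, Prod.map_comp_map, rename_comp]

theorem Same.symm {G H : LGraph} : Same G H → Same H G := by
  rintro ⟨σ, h1, h2⟩
  refine ⟨σ.symm, ?_, ?_⟩
  · rw [h1, Finset.image_image, rename_comp, Equiv.self_trans_symm, rename_refl, Finset.image_id]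
  · rw [h2, Finset.image_image, Prod.map_comp_map, rename_comp, Equiv.self_trans_symm,
      rename_refl, Prod.map_id, Finset.image_id]

/-- Sameness of partially unlabelled graphs as an equivalence relation. -/
def sameSetoid : Setoid LGraph where
  r := Same
  iseqv := ⟨Same.refl, Same.symm, Same.trans⟩

/-- Partially unlabelled graphs: graphs in which the names of the unlabelled nodes are
forgotten. -/
abbrev UGraph : Type := Quotient sameSetoid

/-- The partially unlabelled graph given by `G`. -/
def toU (G : LGraph) : UGraph := Quotient.mk sameSetoid G

/-- The incoming edges of `a`. -/
def inEdges (G : LGraph) (a : Node) : Finset (Node × Node) := G.edges.filter (fun e => e.2 = a)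

/-- The outgoing edges of `a`. -/
def outEdges (G : LGraph) (a : Node) : Finset (Node × Node) := G.edges.filter (fun e => e.1 = a)

/-- `b` is reachable from `a`, by a path of length at least `0`. -/
def Reach (G : LGraph) (a b : Node) : Prop :=
  Relation.ReflTransGen (fun v w => (v, w) ∈ G.edges) a b

/-- No directed cycles (and no self-loops). -/
def IsAcyclic (G : LGraph) : Prop :=
  ∀ a, ¬ Relation.TransGen (fun v w => (v, w) ∈ G.edges) a a

open Classical in
/-- The subgraph `E(a, G)` entering `a`: all nodes from which `a` is reachable, and all edges
whose head is such a node. -/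
noncomputable def E (a : Node) (G : LGraph) : LGraph where
  nodes := G.nodes.filter (fun b => G.Reach b a)
  edges := G.edges.filter (fun e => G.Reach e.2 a)
  edges_mem := by
    intro e he
    rw [Finset.mem_filter] at he
    exact ⟨Finset.mem_filter.2 ⟨(G.edges_mem e he.1).1, Relation.ReflTransGen.head he.1 he.2⟩,
      Finset.mem_filter.2 ⟨(G.edges_mem e he.1).2, he.2⟩⟩

open Classical in
/-- The subgraph `L(a, G)` leaving `a`: all nodes reachable from `a`, and all edges whose tail is
such a node. -/
noncomputable def L (a : Node) (G : LGraph) : LGraph where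
  nodes := G.nodes.filter (fun b => G.Reach a b)
  edges := G.edges.filter (fun e => G.Reach a e.1)
  edges_mem := by
    intro e he
    rw [Finset.mem_filter] at he
    exact ⟨Finset.mem_filter.2 ⟨(G.edges_mem e he.1).1, he.2⟩,
      Finset.mem_filter.2 ⟨(G.edges_mem e he.1).2, Relation.ReflTransGen.tail he.2 he.1⟩⟩

/-- `G` is a directed binary tree with root `r`, all edges pointing from a child to its parent:
the root has no parent, every other node has exactly one, the root is reachable from every node,
and every node has either zero or two children. (Left and right are not distinguished.) -/
structure IsDBT (G : LGraph) (r : Node) : Prop where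
  root_mem : r ∈ G.nodes
  root_out : (G.outEdges r).card = 0
  parent : ∀ a ∈ G.nodes, a ≠ r → (G.outEdges a).card = 1
  reach : ∀ a ∈ G.nodes, G.Reach a r
  children : ∀ a ∈ G.nodes, (G.inEdges a).card = 0 ∨ (G.inEdges a).card = 2

/-- The leaves of a directed binary tree: the nodes without children. -/
def leaves (G : LGraph) : Finset Node := G.nodes.filter (fun a => (G.inEdges a).card = 0)

/-- `S` is a structure, with labels taken from `X n ∪ Y n`. -/
structure IsStructure (n : ℕ) (S : LGraph) : Prop where
  label_x : ∀ j, Node.x j ∈ S.nodes → Node.x j ∈ X n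
  label_y : ∀ j, Node.y j ∈ S.nodes → Node.y j ∈ Y n
  acyclic : S.IsAcyclic
  input_iff : ∀ a ∈ S.nodes, a ∈ X n ↔ (S.inEdges a).card = 0
  subtree : ∀ a ∈ S.nodes, (E a S).IsDBT a
  subtree_ne : ∀ a ∈ S.nodes, ∀ b ∈ S.nodes, a ≠ b → ¬ Same (E a S) (E b S)

/-- The computation nodes: all nodes that are not input nodes. -/
def compNodes (n : ℕ) (S : LGraph) : Finset Node := S.nodes.filter (fun a => a ∉ X n)

/-- The output nodes: the computation nodes without outgoing edge. -/
def outputNodes (n : ℕ) (S : LGraph) : Finset Node :=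
  (S.compNodes n).filter (fun a => (S.outEdges a).card = 0)

/-- `S ∈ 𝒮_n`: `S` is a structure whose output nodes are exactly `y_1, …, y_n`, the leaves of the
subtree rooted at `y_j` being all the input nodes except `x_j`. -/
structure IsStructureFor (n : ℕ) (S : LGraph) : Prop extends IsStructure n S where
  outputs : S.outputNodes n = Y n
  leaves_eq : ∀ j ∈ Finset.Icc 1 n, (E (Node.y j) S).leaves = (X n).erase (Node.x j)

/-- The complexity `c(S)`. -/
def complexity (n : ℕ) (S : LGraph) : ℕ := (S.compNodes n).card

/-- `S ∈ 𝒮_n^co`: `S` has the least complexity among all the structures in `𝒮_n`. -/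
def IsComplexityOptimal (n : ℕ) (S : LGraph) : Prop :=
  S.IsStructureFor n ∧ ∀ S' : LGraph, S'.IsStructureFor n → S.complexity n ≤ S'.complexity n

/-- `⟨a, b⟩ ∈ P(S)`, for `S ∈ 𝒮_n`. The relation is symmetric in `a` and `b`. -/
def IsComplementPair (n : ℕ) (S : LGraph) (a b : Node) : Prop :=
  a ∈ S.nodes ∧ b ∈ S.nodes ∧
    ∀ j ∈ Finset.Icc 1 n, Node.x j ∈ (E a S).nodes ↔ Node.x j ∉ (E b S).nodes

/-- `𝒮_n^co` as a set of partially unlabelled graphs. -/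
def optimalSet (n : ℕ) : Set UGraph := toU '' {S | S.IsComplexityOptimal n}

/-- Adding an edge, together with its end points. -/
def addEdge (G : LGraph) (a b : Node) : LGraph where
  nodes := insert a (insert b G.nodes)
  edges := insert (a, b) G.edges
  edges_mem := by
    intro e he
    rcases Finset.mem_insert.1 he with rfl | he
    · simp
    · have := G.edges_mem e he
      simp [this.1, this.2]

/-- Converting the node `a` into the directed edge `(a₁, a₂)`: the incoming edges of `a` now enter
`a₁`, its outgoing edges now leave `a₂`. -/
def convert (G : LGraph) (a a₁ a₂ : Node) : LGraph where
  nodes := insert a₁ (insert a₂ (G.nodes.erase a))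
  edges := insert (a₁, a₂)
    (G.edges.image (fun e => (if e.1 = a then a₂ else e.1, if e.2 = a then a₁ else e.2)))
  edges_mem := by
    intro e he
    rcases Finset.mem_insert.1 he with rfl | he
    · simp
    · obtain ⟨d, hd, rfl⟩ := Finset.mem_image.1 he
      have := G.edges_mem d hd
      constructor
      · by_cases h : d.1 = a <;> simp [h, this.1]
      · by_cases h : d.2 = a <;> simp [h, this.2]

/-- All names `u k` with `k ≥ G.fresh` are unused in `G`. -/
def fresh (G : LGraph) : ℕ := G.nodes.sup Node.index + 1

/-- When `a` is converted into `(a₁, a₂)`, this is `a₁`: an input node keeps its label here (it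
must still have no incoming edge); otherwise `a₁` is the new unlabelled node `u k`. -/
def splitIn (a : Node) (k : ℕ) : Node :=
  match a with
  | .x j => .x j
  | _ => .u k

/-- When `a` is converted into `(a₁, a₂)`, this is `a₂`: an output node keeps its label here (it
must still have no outgoing edge); otherwise `a₂` is the new unlabelled node `u k`. -/
def splitOut (a : Node) (k : ℕ) : Node :=
  match a with
  | .y j => .y j
  | _ => .u k

/-- The graph `g(a, b, S)`, for `S ∈ 𝒮_{n-1}^co` and `⟨a, b⟩ ∈ P(S)`: convert `a` into `(a₁, a₂)`
and `b` into `(b₁, b₂)`, then add the edges `(x_n, a₂)`, `(x_n, b₂)`, `(a₁, y_n)`, `(b₁, y_n)`. -/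
def g (n : ℕ) (a b : Node) (S : LGraph) : LGraph :=
  let k := S.fresh
  let a₁ := splitIn a k
  let a₂ := splitOut a (k + 1)
  let b₁ := splitIn b (k + 2)
  let b₂ := splitOut b (k + 3)
  let S' := (S.convert a a₁ a₂).convert b b₁ b₂
  let S'' := (S'.addEdge (.x n) a₂).addEdge (.x n) b₂
  (S''.addEdge a₁ (.y n)).addEdge b₁ (.y n)

end LGraph

end NodeComputation

namespace NodeComputation

/-! ### Binary hierarchies -/

/-- `IsHierarchy H A`: `H` is the family of the leaf sets of all subtrees of a rooted binary tree
whose leaves are labelled, without repetition, by the elements of `A`. -/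
inductive IsHierarchy : Finset (Finset ℕ) → Finset ℕ → Prop
  | leaf (j : ℕ) : IsHierarchy {{j}} {j}
  | node {H K : Finset (Finset ℕ)} {A B : Finset ℕ} (hH : IsHierarchy H A)
      (hK : IsHierarchy K B) (hAB : Disjoint A B) :
      IsHierarchy (insert (A ∪ B) (H ∪ K)) (A ∪ B)

namespace IsHierarchy

variable {H : Finset (Finset ℕ)} {A : Finset ℕ}

theorem top_mem (h : IsHierarchy H A) : A ∈ H := by
  cases h <;> simp

theorem subset_top (h : IsHierarchy H A) : ∀ C ∈ H, C ⊆ A := by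
  induction h with
  | leaf j => simp
  | node hH hK hAB ihH ihK =>
    intro C hC
    simp only [Finset.mem_insert, Finset.mem_union] at hC
    rcases hC with rfl | hC | hC
    · exact subset_rfl
    · exact (ihH C hC).trans Finset.subset_union_left
    · exact (ihK C hC).trans Finset.subset_union_right

theorem nonempty_of_mem (h : IsHierarchy H A) : ∀ C ∈ H, C.Nonempty := by
  induction h with
  | leaf j => simp
  | node hH hK hAB ihH ihK =>
    intro C hC
    simp only [Finset.mem_insert, Finset.mem_union] at hC
    rcases hC with rfl | hC | hC
    · exact (ihH _ hH.top_mem).mono Finset.subset_union_left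
    · exact ihH C hC
    · exact ihK C hC

theorem laminar (h : IsHierarchy H A) :
    ∀ C ∈ H, ∀ D ∈ H, C ⊆ D ∨ D ⊆ C ∨ Disjoint C D := by
  induction h with
  | leaf j => simp
  | @node H K A B hH hK hAB ihH ihK =>
    have key : ∀ C ∈ insert (A ∪ B) (H ∪ K), C ⊆ A ∪ B :=
      (IsHierarchy.node hH hK hAB).subset_top
    intro C hC D hD
    rcases Finset.mem_insert.1 hC with rfl | hC'
    · exact Or.inr (Or.inl (key D hD))
    rcases Finset.mem_insert.1 hD with rfl | hD'
    · exact Or.inl (key C hC)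
    rcases Finset.mem_union.1 hC' with hC' | hC' <;> rcases Finset.mem_union.1 hD' with hD' | hD'
    · exact ihH C hC' D hD'
    · exact Or.inr (Or.inr (hAB.mono (hH.subset_top C hC') (hK.subset_top D hD')))
    · exact Or.inr (Or.inr (hAB.symm.mono (hK.subset_top C hC') (hH.subset_top D hD')))
    · exact ihK C hC' D hD'

theorem singleton_mem (h : IsHierarchy H A) : ∀ x ∈ A, {x} ∈ H := by
  induction h with
  | leaf j => simp
  | node hH hK hAB ihH ihK =>
    intro x hx
    rcases Finset.mem_union.1 hx with hx | hx
    · simp [ihH x hx]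
    · simp [ihK x hx]

theorem exists_children (h : IsHierarchy H A) (hA : A.card ≠ 1) :
    ∃ P ∈ H, ∃ Q ∈ H, Disjoint P Q ∧ P ∪ Q = A := by
  cases h with
  | leaf j => simp at hA
  | node hH hK hAB => exact ⟨_, by simp [hH.top_mem], _, by simp [hK.top_mem], hAB, rfl⟩

/-- The sibling of a leaf. -/
theorem exists_sibling (h : IsHierarchy H A) {x : ℕ} (hx : x ∈ A) (hA : A ≠ {x}) :
    ∃ C ∈ H, x ∉ C ∧ insert x C ∈ H := by
  induction h with
  | leaf j => simp at hx; simp [hx] at hA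
  | @node H K A B hH hK hAB ihH ihK =>
    rcases Finset.mem_union.1 hx with hx | hx
    · by_cases hA : A = {x}
      · subst hA
        refine ⟨B, by simp [hK.top_mem], by simpa using hAB, ?_⟩
        simp
      · obtain ⟨C, hC, h1, h2⟩ := ihH hx hA
        exact ⟨C, by simp [hC], h1, by simp [h2]⟩
    · by_cases hB : B = {x}
      · subst hB
        refine ⟨A, by simp [hH.top_mem], by simpa using hAB, ?_⟩
        simp
      · obtain ⟨C, hC, h1, h2⟩ := ihK hx hB
        exact ⟨C, by simp [hC], h1, by simp [h2]⟩

/-- Removing a leaf. -/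
theorem exists_restrict (h : IsHierarchy H A) {x : ℕ} (hA : (A.erase x).Nonempty) :
    ∃ H' ⊆ H.image (fun C => C.erase x), IsHierarchy H' (A.erase x) := by
  induction h with
  | leaf j =>
    have hj : j ≠ x := by
      rintro rfl
      simp at hA
    refine ⟨{{j}}, ?_, ?_⟩
    · simp [Finset.erase_eq_of_notMem, hj.symm]
    · rw [Finset.erase_eq_of_notMem (by simpa using hj.symm)]
      exact leaf j
  | @node H K A B hH hK hAB ihH ihK =>
    rw [Finset.erase_union_distrib] at hA ⊢
    by_cases h1 : (A.erase x).Nonempty <;> by_cases h2 : (B.erase x).Nonempty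
    · obtain ⟨H', hH', h3⟩ := ihH h1
      obtain ⟨K', hK', h4⟩ := ihK h2
      refine ⟨_, ?_, node h3 h4 (hAB.mono (Finset.erase_subset _ _) (Finset.erase_subset _ _))⟩
      rw [Finset.image_insert, Finset.image_union, Finset.erase_union_distrib]
      exact Finset.insert_subset_insert _ (Finset.union_subset_union hH' hK')
    · obtain ⟨H', hH', h3⟩ := ihH h1
      rw [Finset.not_nonempty_iff_eq_empty.1 h2, Finset.union_empty]
      exact ⟨H', hH'.trans (Finset.image_subset_image (by grind)), h3⟩
    · obtain ⟨K', hK', h3⟩ := ihK h2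
      rw [Finset.not_nonempty_iff_eq_empty.1 h1, Finset.empty_union]
      exact ⟨K', hK'.trans (Finset.image_subset_image (by grind)), h3⟩
    · rw [Finset.not_nonempty_iff_eq_empty.1 h1, Finset.not_nonempty_iff_eq_empty.1 h2] at hA
      simp at hA

end IsHierarchy

/-! ### Split systems of trivalent trees -/

/-- Attaching a new leaf `n + 1` to the edge with sides `P` and `Q` of a trivalent tree with
leaves `1, …, n` and family of sides `F`. -/
def graft (n : ℕ) (F : Finset (Finset ℕ)) (P Q : Finset ℕ) : Finset (Finset ℕ) :=
  insert (Finset.Icc 1 n) (insert {n + 1} (F.filter (fun A => A ⊆ P ∨ A ⊆ Q) ∪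
    (F.filter (fun A => P ⊆ A ∨ Q ⊆ A)).image (insert (n + 1))))

/-- `F` consists of the sides of the edges of a trivalent tree with leaves `1, …, n`. -/
inductive IsSplitSystem : ℕ → Finset (Finset ℕ) → Prop
  | base : IsSplitSystem 2 {{1}, {2}}
  | step {n : ℕ} {F : Finset (Finset ℕ)} {P Q : Finset ℕ} (hF : IsSplitSystem n F) (hP : P ∈ F)
      (hQ : Q ∈ F) (hPQ : Disjoint P Q) (hU : P ∪ Q = Finset.Icc 1 n) :
      IsSplitSystem (n + 1) (graft n F P Q)

theorem mem_graft {n : ℕ} {F : Finset (Finset ℕ)} {P Q A : Finset ℕ} :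
    A ∈ graft n F P Q ↔ A = Finset.Icc 1 n ∨ A = {n + 1} ∨ (A ∈ F ∧ (A ⊆ P ∨ A ⊆ Q)) ∨
      ∃ B ∈ F, (P ⊆ B ∨ Q ⊆ B) ∧ insert (n + 1) B = A := by
  simp [graft, and_assoc]

theorem Icc_succ_eq (n : ℕ) : Finset.Icc 1 (n + 1) = insert (n + 1) (Finset.Icc 1 n) := by
  ext; simp; omega

/-- Two sides of edges of a tree. -/
def Compatible (n : ℕ) (A B : Finset ℕ) : Prop :=
  A ⊆ B ∨ B ⊆ A ∨ Disjoint A B ∨ Finset.Icc 1 n ⊆ A ∪ B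

theorem Compatible.symm {n : ℕ} {A B : Finset ℕ} (h : Compatible n A B) : Compatible n B A := by
  rcases h with h | h | h | h
  · exact Or.inr (Or.inl h)
  · exact Or.inl h
  · exact Or.inr (Or.inr (Or.inl h.symm))
  · exact Or.inr (Or.inr (Or.inr (by rwa [Finset.union_comm])))

/-- The properties of split systems that are used. -/
structure SplitProps (n : ℕ) (F : Finset (Finset ℕ)) : Prop where
  two_le : 2 ≤ n
  nonempty : ∀ A ∈ F, A.Nonempty
  subset : ∀ A ∈ F, A ⊆ Finset.Icc 1 n
  compl : ∀ A ∈ F, Finset.Icc 1 n \ A ∈ F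
  singleton : ∀ j ∈ Finset.Icc 1 n, {j} ∈ F
  compat : ∀ A ∈ F, ∀ B ∈ F, Compatible n A B
  children : ∀ A ∈ F, A.card ≠ 1 → ∃ B ∈ F, ∃ C ∈ F, Disjoint B C ∧ B ∪ C = A
  card : F.card + 6 = 4 * n

namespace SplitProps

variable {n : ℕ} {F : Finset (Finset ℕ)}

theorem not_Icc_subset (h : SplitProps n F) {A : Finset ℕ} (hA : A ∈ F) : ¬ Finset.Icc 1 n ⊆ A := by
  intro h1
  have := h.nonempty _ (h.compl A hA)
  rw [Finset.sdiff_eq_empty_iff_subset.2 h1] at this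
  simp at this

theorem subset_child (h : SplitProps n F) {A B C D : Finset ℕ} (hA : A ∈ F) (hB : B ∈ F)
    (hC : C ∈ F) (hD : D ∈ F) (hU : B ∪ C = A) (hDA : D ⊆ A) :
    D = A ∨ D ⊆ B ∨ D ⊆ C := by
  have h0 := h.not_Icc_subset hA
  have h4 := h.nonempty D hD
  have hB0 : ¬ Finset.Icc 1 n ⊆ D ∪ B := fun h5 => h0 (h5.trans (by grind))
  have hC0 : ¬ Finset.Icc 1 n ⊆ D ∪ C := fun h5 => h0 (h5.trans (by grind))
  rcases h.compat D hD B hB with h1 | h1 | h1 | h1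
  · exact Or.inr (Or.inl h1)
  · rcases h.compat D hD C hC with h2 | h2 | h2 | h2
    · exact Or.inr (Or.inr h2)
    · left; subst hU; exact hDA.antisymm (Finset.union_subset h1 h2)
    · right; left; intro x hx
      have := hDA hx
      rw [← hU, Finset.mem_union] at this
      exact this.resolve_right (Finset.disjoint_left.1 h2 hx)
    · exact absurd h2 hC0
  · right; right; intro x hx
    have := hDA hx
    rw [← hU, Finset.mem_union] at this
    exact this.resolve_left (Finset.disjoint_left.1 h1 hx)
  · exact absurd h1 hB0

/-- A hierarchy inside a split system contains all the sides below its top. -/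
theorem mem_hierarchy (h : SplitProps n F) {H : Finset (Finset ℕ)} {A : Finset ℕ}
    (hH : IsHierarchy H A) (hHF : H ⊆ F) : ∀ D ∈ F, D ⊆ A → D ∈ H := by
  induction hH with
  | leaf j =>
    intro D hD hDj
    rcases Finset.subset_singleton_iff.1 hDj with rfl | rfl
    · simpa using h.nonempty _ hD
    · simp
  | @node H K A B hH hK hAB ihH ihK =>
    intro D hD hDA
    have h1 : A ∪ B ∈ F := hHF (by simp)
    have h2 : H ⊆ F := fun C hC => hHF (by simp [hC])
    have h3 : K ⊆ F := fun C hC => hHF (by simp [hC])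
    rcases h.subset_child h1 (h2 hH.top_mem) (h3 hK.top_mem) hD rfl hDA with rfl | h4 | h4
    · simp
    · simp [ihH h2 D hD h4]
    · simp [ihK h3 D hD h4]

theorem sub_or (h : SplitProps n F) {P Q A : Finset ℕ} (hP : P ∈ F)
    (hPQ : Disjoint P Q) (hU : P ∪ Q = Finset.Icc 1 n) (hA : A ∈ F) :
    A ⊆ P ∨ A ⊆ Q ∨ P ⊆ A ∨ Q ⊆ A := by
  have h1 := h.subset A hA
  rw [← hU] at h1
  rcases h.compat A hA P hP with h2 | h2 | h2 | h2
  · exact Or.inl h2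
  · exact Or.inr (Or.inr (Or.inl h2))
  · right; left; intro x hx
    exact (Finset.mem_union.1 (h1 hx)).resolve_left (Finset.disjoint_left.1 h2 hx)
  · right; right; right; intro x hx
    rw [← hU] at h2
    exact (Finset.mem_union.1 (h2 (Finset.mem_union_right _ hx))).resolve_right
      (Finset.disjoint_right.1 hPQ hx)

end SplitProps

/-- The two sides of an edge of a tree. -/
structure IsEdge (n : ℕ) (F : Finset (Finset ℕ)) (P Q : Finset ℕ) : Prop where
  left : P ∈ F
  right : Q ∈ F
  disj : Disjoint P Q
  union : P ∪ Q = Finset.Icc 1 n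

theorem IsEdge.symm {n : ℕ} {F : Finset (Finset ℕ)} {P Q : Finset ℕ} (h : IsEdge n F P Q) :
    IsEdge n F Q P :=
  ⟨h.right, h.left, h.disj.symm, by rw [Finset.union_comm, h.union]⟩

theorem graft_comm (n : ℕ) (F : Finset (Finset ℕ)) (P Q : Finset ℕ) :
    graft n F P Q = graft n F Q P := by
  ext A
  simp [mem_graft, or_comm]

namespace SplitProps

variable {n : ℕ} {F : Finset (Finset ℕ)} {P Q : Finset ℕ}

theorem notMem_succ (h : SplitProps n F) {A : Finset ℕ} (hA : A ∈ F) : n + 1 ∉ A := by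
  intro h1
  have := h.subset A hA h1
  simp at this

theorem base : SplitProps 2 {{1}, {2}} where
  two_le := le_rfl
  nonempty := by simp
  subset := by decide
  compl := by decide
  singleton := by decide
  compat := by unfold Compatible; decide
  children := by simp
  card := by decide

theorem graft_card (h : SplitProps n F) (e : IsEdge n F P Q) :
    (graft n F P Q).card + 6 = 4 * (n + 1) := by
  have hP := h.nonempty P e.left
  have hQ := h.nonempty Q e.right
  have hN : ∀ A ∈ F, n + 1 ∉ A := fun A hA => h.notMem_succ hA
  have hn := h.two_le
  have hd := Finset.disjoint_left.1 e.disj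
  have hU := e.union
  set F₁ := F.filter (fun A => A ⊆ P ∨ A ⊆ Q) with hF₁
  set F₂ := F.filter (fun A => P ⊆ A ∨ Q ⊆ A) with hF₂
  have c2 : (F₂.image (insert (n + 1))).card = F₂.card := by
    apply Finset.card_image_of_injOn
    intro A hA B hB hAB
    have h1 := hN A (Finset.mem_filter.1 hA).1
    have h2 := hN B (Finset.mem_filter.1 hB).1
    have := congrArg (fun C => Finset.erase C (n + 1)) hAB
    simpa [h1, h2] using this
  have hPQ : P ≠ Q := by
    rintro rfl
    obtain ⟨x, hx⟩ := hP
    exact hd hx hx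
  have c3 : F₁ ∪ F₂ = F := by
    ext A
    simp only [hF₁, hF₂, Finset.mem_union, Finset.mem_filter]
    constructor
    · tauto
    · intro hA
      have := h.sub_or e.left e.disj e.union hA
      tauto
  have c4 : F₁ ∩ F₂ = {P, Q} := by
    ext A
    simp only [hF₁, hF₂, Finset.mem_inter, Finset.mem_filter, Finset.mem_insert,
      Finset.mem_singleton]
    constructor
    · rintro ⟨⟨hA, h1⟩, -, h2⟩
      obtain ⟨p, hp⟩ := hP
      obtain ⟨q, hq⟩ := hQ
      rcases h1 with h1 | h1 <;> rcases h2 with h2 | h2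
      · exact Or.inl (h1.antisymm h2)
      · exact absurd hq (hd (h1 (h2 hq)))
      · exact absurd (h1 (h2 hp)) (hd hp)
      · exact Or.inr (h1.antisymm h2)
    · rintro (rfl | rfl)
      · simp [e.left]
      · simp [e.right]
  have c5 := Finset.card_union_add_card_inter F₁ F₂
  rw [c3, c4, Finset.card_pair hPQ] at c5
  have c6 : Disjoint F₁ (F₂.image (insert (n + 1))) := by
    rw [Finset.disjoint_left]
    intro A hA hA'
    obtain ⟨B, hB, rfl⟩ := Finset.mem_image.1 hA'
    exact hN _ (Finset.mem_filter.1 hA).1 (by simp)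
  have c7 : ({n + 1} : Finset ℕ) ∉ F₁ ∪ F₂.image (insert (n + 1)) := by
    intro h1
    rcases Finset.mem_union.1 h1 with h1 | h1
    · exact hN _ (Finset.mem_filter.1 h1).1 (by simp)
    · obtain ⟨B, hB, hB'⟩ := Finset.mem_image.1 h1
      have hBF := (Finset.mem_filter.1 hB).1
      obtain ⟨x, hx⟩ := h.nonempty B hBF
      have : x ∈ ({n + 1} : Finset ℕ) := hB' ▸ Finset.mem_insert_of_mem hx
      rw [Finset.mem_singleton] at this
      exact hN B hBF (this ▸ hx)
  have c8 : Finset.Icc 1 n ∉ insert {n + 1} (F₁ ∪ F₂.image (insert (n + 1))) := by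
    intro h1
    rcases Finset.mem_insert.1 h1 with h1 | h1
    · have : 1 ∈ ({n + 1} : Finset ℕ) := h1 ▸ (by simp; omega)
      simp at this
      omega
    rcases Finset.mem_union.1 h1 with h1 | h1
    · exact h.not_Icc_subset (Finset.mem_filter.1 h1).1 subset_rfl
    · obtain ⟨B, hB, hB'⟩ := Finset.mem_image.1 h1
      have : n + 1 ∈ Finset.Icc 1 n := hB' ▸ Finset.mem_insert_self _ _
      simp at this
  rw [graft, Finset.card_insert_of_notMem c8, Finset.card_insert_of_notMem c7,
    Finset.card_union_of_disjoint c6, c2]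
  have := h.card
  omega

theorem graft_compl (h : SplitProps n F) (e : IsEdge n F P Q) :
    ∀ A ∈ graft n F P Q, Finset.Icc 1 (n + 1) \ A ∈ graft n F P Q := by
  have hd := Finset.disjoint_left.1 e.disj
  have hU := e.union
  have hPU : ∀ x, x ∈ Finset.Icc 1 n → x ∉ P → x ∈ Q := by grind
  have hQU : ∀ x, x ∈ Finset.Icc 1 n → x ∉ Q → x ∈ P := by grind
  have hPI := h.subset P e.left
  have hQI := h.subset Q e.right
  have hn : n + 1 ∉ Finset.Icc 1 n := by simp
  intro A hA
  rw [mem_graft] at hA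
  rw [Icc_succ_eq, mem_graft]
  rcases hA with rfl | rfl | ⟨hA, h1⟩ | ⟨B, hB, h1, rfl⟩
  · right; left; ext x; simp
  · left; ext x; simp; omega
  · right; right; right
    refine ⟨Finset.Icc 1 n \ A, h.compl A hA, ?_, ?_⟩
    · rcases h1 with h1 | h1
      · right; intro x hx
        exact Finset.mem_sdiff.2 ⟨hQI hx, fun h2 => hd (h1 h2) hx⟩
      · left; intro x hx
        exact Finset.mem_sdiff.2 ⟨hPI hx, fun h2 => hd hx (h1 h2)⟩
    · rw [Finset.insert_sdiff_of_notMem _ (h.notMem_succ hA)]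
  · right; right; left
    have : insert (n + 1) (Finset.Icc 1 n) \ insert (n + 1) B = Finset.Icc 1 n \ B := by
      ext x
      simp only [Finset.mem_sdiff, Finset.mem_insert]
      constructor
      · tauto
      · rintro ⟨h2, h3⟩
        refine ⟨Or.inr h2, ?_⟩
        rintro (rfl | h4)
        · exact hn h2
        · exact h3 h4
    rw [this]
    refine ⟨h.compl B hB, ?_⟩
    rcases h1 with h1 | h1
    · right; intro x hx
      rw [Finset.mem_sdiff] at hx
      exact hPU x hx.1 (fun h2 => hx.2 (h1 h2))
    · left; intro x hx
      rw [Finset.mem_sdiff] at hx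
      exact hQU x hx.1 (fun h2 => hx.2 (h1 h2))

theorem compatible_small_small (h : SplitProps n F) (e : IsEdge n F P Q) {A B : Finset ℕ}
    (hA : A ∈ F) (hB : B ∈ F) (h1 : A ⊆ P ∨ A ⊆ Q) (h2 : B ⊆ P ∨ B ⊆ Q) :
    Compatible (n + 1) A B := by
  have key : ∀ C ∈ F, A ⊆ C → B ⊆ C → Compatible (n + 1) A B := by
    intro C hC hAC hBC
    rcases h.compat A hA B hB with h3 | h3 | h3 | h3
    · exact Or.inl h3
    · exact Or.inr (Or.inl h3)
    · exact Or.inr (Or.inr (Or.inl h3))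
    · exact absurd (h3.trans (Finset.union_subset hAC hBC)) (h.not_Icc_subset hC)
  rcases h1 with h1 | h1 <;> rcases h2 with h2 | h2
  · exact key P e.left h1 h2
  · exact Or.inr (Or.inr (Or.inl (e.disj.mono h1 h2)))
  · exact Or.inr (Or.inr (Or.inl (e.disj.symm.mono h1 h2)))
  · exact key Q e.right h1 h2

theorem compatible_small_large (h : SplitProps n F) (e : IsEdge n F P Q) {A B : Finset ℕ}
    (hA : A ∈ F) (hB : B ∈ F) (h1 : A ⊆ P ∨ A ⊆ Q) (h2 : P ⊆ B ∨ Q ⊆ B) :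
    Compatible (n + 1) A (insert (n + 1) B) := by
  have h4 := h.notMem_succ hA
  have key : A ⊆ P → Q ⊆ B → Compatible (n + 1) A (insert (n + 1) B) := by
    intro h5 h6
    rcases h.compat A hA B hB with h3 | h3 | h3 | h3
    · exact Or.inl (h3.trans (Finset.subset_insert _ _))
    · obtain ⟨x, hx⟩ := h.nonempty Q e.right
      exact absurd hx (Finset.disjoint_left.1 e.disj (h5 (h3 (h6 hx))))
    · refine Or.inr (Or.inr (Or.inl ?_))
      rw [Finset.disjoint_insert_right]
      exact ⟨h4, h3⟩
    · refine Or.inr (Or.inr (Or.inr ?_))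
      rw [Icc_succ_eq, Finset.union_insert]
      exact Finset.insert_subset_insert _ h3
  have key' : A ⊆ Q → P ⊆ B → Compatible (n + 1) A (insert (n + 1) B) := by
    intro h5 h6
    rcases h.compat A hA B hB with h3 | h3 | h3 | h3
    · exact Or.inl (h3.trans (Finset.subset_insert _ _))
    · obtain ⟨x, hx⟩ := h.nonempty P e.left
      exact absurd (h5 (h3 (h6 hx))) (Finset.disjoint_left.1 e.disj hx)
    · refine Or.inr (Or.inr (Or.inl ?_))
      rw [Finset.disjoint_insert_right]
      exact ⟨h4, h3⟩
    · refine Or.inr (Or.inr (Or.inr ?_))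
      rw [Icc_succ_eq, Finset.union_insert]
      exact Finset.insert_subset_insert _ h3
  rcases h1 with h1 | h1 <;> rcases h2 with h2 | h2
  · exact Or.inl ((h1.trans h2).trans (Finset.subset_insert _ _))
  · exact key h1 h2
  · exact key' h1 h2
  · exact Or.inl ((h1.trans h2).trans (Finset.subset_insert _ _))

theorem compatible_large_large (h : SplitProps n F) (e : IsEdge n F P Q) {A B : Finset ℕ}
    (hA : A ∈ F) (hB : B ∈ F) (h1 : P ⊆ A ∨ Q ⊆ A) (h2 : P ⊆ B ∨ Q ⊆ B) :
    Compatible (n + 1) (insert (n + 1) A) (insert (n + 1) B) := by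
  have key : Finset.Icc 1 n ⊆ A ∪ B →
      Compatible (n + 1) (insert (n + 1) A) (insert (n + 1) B) := by
    intro h3
    refine Or.inr (Or.inr (Or.inr ?_))
    rw [Icc_succ_eq, Finset.insert_union, Finset.union_insert, Finset.insert_idem]
    exact Finset.insert_subset_insert _ h3
  have key' : ∀ C ∈ F, C ⊆ A → C ⊆ B → ¬ Disjoint A B := by
    intro C hC h3 h4 h5
    obtain ⟨x, hx⟩ := h.nonempty C hC
    exact Finset.disjoint_left.1 h5 (h3 hx) (h4 hx)
  rcases h.compat A hA B hB with h3 | h3 | h3 | h3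
  · exact Or.inl (Finset.insert_subset_insert _ h3)
  · exact Or.inr (Or.inl (Finset.insert_subset_insert _ h3))
  · rcases h1 with h1 | h1 <;> rcases h2 with h2 | h2
    · exact absurd h3 (key' P e.left h1 h2)
    · exact key (e.union ▸ Finset.union_subset_union h1 h2)
    · exact key (e.union ▸ Finset.union_comm P Q ▸ Finset.union_subset_union h1 h2)
    · exact absurd h3 (key' Q e.right h1 h2)
  · exact key h3

theorem graft_subset (h : SplitProps n F) :
    ∀ A ∈ graft n F P Q, A ⊆ Finset.Icc 1 (n + 1) := by
  intro A hA
  rw [mem_graft] at hA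
  rw [Icc_succ_eq]
  rcases hA with rfl | rfl | ⟨hA, h1⟩ | ⟨B, hB, h1, rfl⟩
  · exact Finset.subset_insert _ _
  · simp
  · exact (h.subset A hA).trans (Finset.subset_insert _ _)
  · exact Finset.insert_subset_insert _ (h.subset B hB)

theorem compatible_of_Icc (n : ℕ) {B : Finset ℕ} (hB : B ⊆ Finset.Icc 1 (n + 1)) :
    Compatible (n + 1) (Finset.Icc 1 n) B := by
  by_cases h : n + 1 ∈ B
  · refine Or.inr (Or.inr (Or.inr ?_))
    rw [Icc_succ_eq]
    exact Finset.insert_subset (Finset.mem_union_right _ h) Finset.subset_union_left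
  · refine Or.inr (Or.inl ?_)
    intro x hx
    have h1 := hB hx
    rw [Icc_succ_eq, Finset.mem_insert] at h1
    exact h1.resolve_left (fun h2 => h (h2 ▸ hx))

theorem compatible_of_singleton (n i : ℕ) (B : Finset ℕ) : Compatible n {i} B := by
  by_cases h : i ∈ B
  · exact Or.inl (by simpa using h)
  · exact Or.inr (Or.inr (Or.inl (by simpa using h)))

theorem graft_compat (h : SplitProps n F) (e : IsEdge n F P Q) :
    ∀ A ∈ graft n F P Q, ∀ B ∈ graft n F P Q, Compatible (n + 1) A B := by
  intro A hA B hB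
  have hA' := h.graft_subset A hA
  have hB' := h.graft_subset B hB
  rw [mem_graft] at hA hB
  rcases hA with rfl | rfl | ⟨hA, h1⟩ | ⟨A, hA, h1, rfl⟩
  · exact compatible_of_Icc n hB'
  · exact compatible_of_singleton _ _ _
  all_goals
    rcases hB with rfl | rfl | ⟨hB, h2⟩ | ⟨B, hB, h2, rfl⟩
    · exact (compatible_of_Icc n hA').symm
    · exact (compatible_of_singleton _ _ _).symm
  · exact h.compatible_small_small e hA hB h1 h2
  · exact h.compatible_small_large e hA hB h1 h2
  · exact (h.compatible_small_large e hB hA h2 h1).symm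
  · exact h.compatible_large_large e hA hB h1 h2

theorem sub_children_iff (h : SplitProps n F) (e : IsEdge n F P Q) {A B C : Finset ℕ}
    (hA : A ∈ F) (hB : B ∈ F) (hC : C ∈ F) (hU : B ∪ C = A) (h1 : P ⊆ A ∨ Q ⊆ A)
    (hPA : A ≠ P) (hQA : A ≠ Q) : (P ⊆ B ∨ Q ⊆ B) ∨ (P ⊆ C ∨ Q ⊆ C) := by
  rcases h1 with h1 | h1
  · rcases h.subset_child hA hB hC e.left hU h1 with h2 | h2 | h2
    · exact absurd h2.symm hPA
    · tauto
    · tauto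
  · rcases h.subset_child hA hB hC e.right hU h1 with h2 | h2 | h2
    · exact absurd h2.symm hQA
    · tauto
    · tauto

/-- If `B` contains one side of the edge and `C` is disjoint from it, `C` lies in a side. -/
theorem small_of_disjoint (h : SplitProps n F) (e : IsEdge n F P Q) {B C : Finset ℕ}
    (hC : C ∈ F) (hd : Disjoint B C) (h1 : P ⊆ B ∨ Q ⊆ B) : C ⊆ P ∨ C ⊆ Q := by
  have hCI := h.subset C hC
  rw [← e.union] at hCI
  rcases h1 with h1 | h1
  · right; intro x hx
    exact (Finset.mem_union.1 (hCI hx)).resolve_left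
      (fun h2 => Finset.disjoint_left.1 hd (h1 h2) hx)
  · left; intro x hx
    exact (Finset.mem_union.1 (hCI hx)).resolve_right
      (fun h2 => Finset.disjoint_left.1 hd (h1 h2) hx)

theorem graft_children (h : SplitProps n F) (e : IsEdge n F P Q) :
    ∀ A ∈ graft n F P Q, A.card ≠ 1 →
      ∃ B ∈ graft n F P Q, ∃ C ∈ graft n F P Q, Disjoint B C ∧ B ∪ C = A := by
  intro A hA hcard
  rw [mem_graft] at hA
  rcases hA with rfl | rfl | ⟨hA, h1⟩ | ⟨A, hA, h1, rfl⟩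
  · exact ⟨P, mem_graft.2 (Or.inr (Or.inr (Or.inl ⟨e.left, Or.inl subset_rfl⟩))),
      Q, mem_graft.2 (Or.inr (Or.inr (Or.inl ⟨e.right, Or.inr subset_rfl⟩))), e.disj, e.union⟩
  · simp at hcard
  · obtain ⟨B, hB, C, hC, hd, hU⟩ := h.children A hA hcard
    have hBA : B ⊆ A := hU ▸ Finset.subset_union_left
    have hCA : C ⊆ A := hU ▸ Finset.subset_union_right
    exact ⟨B, mem_graft.2 (Or.inr (Or.inr (Or.inl ⟨hB, h1.imp hBA.trans hBA.trans⟩))),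
      C, mem_graft.2 (Or.inr (Or.inr (Or.inl ⟨hC, h1.imp hCA.trans hCA.trans⟩))), hd, hU⟩
  · by_cases hPA : A ⊆ P ∨ A ⊆ Q
    · exact ⟨{n + 1}, mem_graft.2 (Or.inr (Or.inl rfl)), A,
        mem_graft.2 (Or.inr (Or.inr (Or.inl ⟨hA, hPA⟩))),
        by simpa using h.notMem_succ hA, by simp⟩
    · push Not at hPA
      have hPA1 : A ≠ P := fun h2 => hPA.1 h2.subset
      have hPA2 : A ≠ Q := fun h2 => hPA.2 h2.subset
      have hA1 : A.card ≠ 1 := by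
        intro h2
        obtain ⟨x, rfl⟩ := Finset.card_eq_one.1 h2
        rcases h1 with h1 | h1
        · rcases Finset.subset_singleton_iff.1 h1 with h3 | h3
          · simpa [h3] using h.nonempty P e.left
          · exact hPA1 h3.symm
        · rcases Finset.subset_singleton_iff.1 h1 with h3 | h3
          · simpa [h3] using h.nonempty Q e.right
          · exact hPA2 h3.symm
      obtain ⟨B, hB, C, hC, hd, hU⟩ := h.children A hA hA1
      rcases h.sub_children_iff e hA hB hC hU h1 hPA1 hPA2 with h2 | h2
      · refine ⟨insert (n + 1) B, mem_graft.2 (Or.inr (Or.inr (Or.inr ⟨B, hB, h2, rfl⟩))), C,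
          mem_graft.2 (Or.inr (Or.inr (Or.inl ⟨hC, h.small_of_disjoint e hC hd h2⟩))), ?_, ?_⟩
        · rw [Finset.disjoint_insert_left]
          exact ⟨h.notMem_succ hC, hd⟩
        · rw [Finset.insert_union, hU]
      · refine ⟨B, mem_graft.2 (Or.inr (Or.inr (Or.inl
          ⟨hB, h.small_of_disjoint e hB hd.symm h2⟩))), insert (n + 1) C,
          mem_graft.2 (Or.inr (Or.inr (Or.inr ⟨C, hC, h2, rfl⟩))), ?_, ?_⟩
        · rw [Finset.disjoint_insert_right]
          exact ⟨h.notMem_succ hB, hd⟩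
        · rw [Finset.union_insert, hU]

theorem graft (h : SplitProps n F) (e : IsEdge n F P Q) :
    SplitProps (n + 1) (graft n F P Q) where
  two_le := by have := h.two_le; omega
  nonempty := by
    intro A hA
    rw [mem_graft] at hA
    rcases hA with rfl | rfl | ⟨hA, h1⟩ | ⟨B, hB, h1, rfl⟩
    · have := h.two_le
      exact ⟨1, by simp; omega⟩
    · simp
    · exact h.nonempty A hA
    · simp
  subset := h.graft_subset
  compl := h.graft_compl e
  singleton := by
    intro j hj
    rw [Icc_succ_eq, Finset.mem_insert] at hj
    rw [mem_graft]
    rcases hj with rfl | hj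
    · simp
    · refine Or.inr (Or.inr (Or.inl ⟨h.singleton j hj, ?_⟩))
      rw [← e.union] at hj
      simpa using hj
  compat := h.graft_compat e
  children := h.graft_children e
  card := h.graft_card e

end SplitProps

theorem IsSplitSystem.props {n : ℕ} {F : Finset (Finset ℕ)} (h : IsSplitSystem n F) :
    SplitProps n F := by
  induction h with
  | base => exact SplitProps.base
  | step hF hP hQ hPQ hU ih => exact ih.graft ⟨hP, hQ, hPQ, hU⟩

/-! ### The least number of clusters -/

/-- A family of subsets of `{1, …, n}` which contains, for each `j ≤ n`, a binary hierarchy on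
`{1, …, n} \ {j}`. -/
structure IsClusterSystem (n : ℕ) (F : Finset (Finset ℕ)) : Prop where
  nonempty : ∀ A ∈ F, A.Nonempty
  subset : ∀ A ∈ F, A ⊆ Finset.Icc 1 n
  hierarchy : ∀ j ∈ Finset.Icc 1 n, ∃ H ⊆ F, IsHierarchy H ((Finset.Icc 1 n).erase j)

/-- The clusters that are not singletons. -/
def bigClusters (F : Finset (Finset ℕ)) : Finset (Finset ℕ) := F.filter (fun A => A.card ≠ 1)

theorem mem_bigClusters {F : Finset (Finset ℕ)} {A : Finset ℕ} :
    A ∈ bigClusters F ↔ A ∈ F ∧ A.card ≠ 1 := Finset.mem_filter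

/-- Clusters which are the union of a cluster and `{x}`. -/
def leafParents (F : Finset (Finset ℕ)) (x : ℕ) : Finset (Finset ℕ) :=
  F.filter (fun A => x ∈ A ∧ A.erase x ∈ F)

theorem mem_leafParents {F : Finset (Finset ℕ)} {x : ℕ} {A : Finset ℕ} :
    A ∈ leafParents F x ↔ A ∈ F ∧ x ∈ A ∧ A.erase x ∈ F := Finset.mem_filter

/-- The clusters from which the clusters of the restricted system arise. -/
def keptClusters (n : ℕ) (F : Finset (Finset ℕ)) : Finset (Finset ℕ) :=
  ((bigClusters F).erase (Finset.Icc 1 n)) \ leafParents F (n + 1)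

theorem mem_keptClusters {n : ℕ} {F : Finset (Finset ℕ)} {A : Finset ℕ} :
    A ∈ keptClusters n F ↔ A ∈ F ∧ A.card ≠ 1 ∧ A ≠ Finset.Icc 1 n ∧ A ∉ leafParents F (n + 1) := by
  simp [keptClusters, mem_bigClusters]
  tauto

namespace IsClusterSystem

variable {n : ℕ} {F : Finset (Finset ℕ)}

theorem Icc_mem (h : IsClusterSystem (n + 1) F) :
    ∃ H ⊆ F, IsHierarchy H (Finset.Icc 1 n) := by
  have := h.hierarchy (n + 1) (by simp)
  rwa [Icc_succ_eq, Finset.erase_insert (by simp)] at this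

/-- The system obtained by forgetting the last element. -/
theorem exists_restrict (h : IsClusterSystem (n + 1) F) (hn : 2 ≤ n) :
    ∃ F' : Finset (Finset ℕ), IsClusterSystem n F' ∧ ∃ H : ℕ → Finset (Finset ℕ),
      (∀ j ∈ Finset.Icc 1 n, H j ⊆ F ∧ IsHierarchy (H j) ((Finset.Icc 1 (n + 1)).erase j)) ∧
      (∀ B ∈ F', ∃ j ∈ Finset.Icc 1 n, ∃ A ∈ H j, A.erase (n + 1) = B) ∧
      ∀ j ∈ Finset.Icc 1 n, ∃ H' ⊆ (H j).image (fun A => A.erase (n + 1)), H' ⊆ F' ∧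
        IsHierarchy H' ((Finset.Icc 1 n).erase j) := by
  have h1 : ∀ j : ℕ, ∃ H : Finset (Finset ℕ), j ∈ Finset.Icc 1 n →
      (H ⊆ F ∧ IsHierarchy H ((Finset.Icc 1 (n + 1)).erase j)) := by
    intro j
    by_cases hj : j ∈ Finset.Icc 1 n
    · obtain ⟨H, h2, h3⟩ := h.hierarchy j (by rw [Icc_succ_eq]; simp [hj])
      exact ⟨H, fun _ => ⟨h2, h3⟩⟩
    · exact ⟨∅, fun h => absurd h hj⟩
  choose H hH using h1
  have h2 : ∀ j : ℕ, ∃ H' : Finset (Finset ℕ), j ∈ Finset.Icc 1 n →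
      (H' ⊆ (H j).image (fun A => A.erase (n + 1)) ∧
        IsHierarchy H' ((Finset.Icc 1 n).erase j)) := by
    intro j
    by_cases hj : j ∈ Finset.Icc 1 n
    · have h4 : ((Finset.Icc 1 (n + 1)).erase j).erase (n + 1) = (Finset.Icc 1 n).erase j := by
        rw [Finset.erase_right_comm, Icc_succ_eq, Finset.erase_insert (by simp)]
      have h5 : ((Finset.Icc 1 n).erase j).Nonempty := by
        rw [← Finset.card_pos, Finset.card_erase_of_mem hj]
        simp; omega
      obtain ⟨H', h2, h3⟩ := (hH j hj).2.exists_restrict (x := n + 1) (by rwa [h4])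
      exact ⟨H', fun _ => ⟨h2, h4 ▸ h3⟩⟩
    · exact ⟨∅, fun h => absurd h hj⟩
  choose H' hH' using h2
  refine ⟨(Finset.Icc 1 n).biUnion H', ⟨?_, ?_, ?_⟩, H, hH, ?_, ?_⟩
  · intro A hA
    obtain ⟨j, hj, hA⟩ := Finset.mem_biUnion.1 hA
    exact (hH' j hj).2.nonempty_of_mem A hA
  · intro A hA
    obtain ⟨j, hj, hA⟩ := Finset.mem_biUnion.1 hA
    exact ((hH' j hj).2.subset_top A hA).trans (Finset.erase_subset _ _)
  · intro j hj
    exact ⟨H' j, Finset.subset_biUnion_of_mem H' hj, (hH' j hj).2⟩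
  · intro B hB
    obtain ⟨j, hj, hB⟩ := Finset.mem_biUnion.1 hB
    obtain ⟨A, hA, rfl⟩ := Finset.mem_image.1 ((hH' j hj).1 hB)
    exact ⟨j, hj, A, hA, rfl⟩
  · intro j hj
    exact ⟨H' j, (hH' j hj).1, Finset.subset_biUnion_of_mem H' hj, (hH' j hj).2⟩

theorem exists_leafParent (hn : 2 ≤ n) {H : Finset (Finset ℕ)} {j : ℕ} (hj : j ∈ Finset.Icc 1 n)
    (hHF : H ⊆ F) (hH : IsHierarchy H ((Finset.Icc 1 (n + 1)).erase j)) :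
    ∃ C ∈ H, n + 1 ∉ C ∧ insert (n + 1) C ∈ H ∧ j ∉ C ∧
      insert (n + 1) C ∈ leafParents F (n + 1) := by
  have hj' := Finset.mem_Icc.1 hj
  have h1 : n + 1 ∈ (Finset.Icc 1 (n + 1)).erase j := by
    simp; omega
  have h2 : (Finset.Icc 1 (n + 1)).erase j ≠ {n + 1} := by
    intro h2
    have := congrArg Finset.card h2
    rw [Finset.card_erase_of_mem (by simp; omega)] at this
    simp at this
    omega
  obtain ⟨C, hC, h3, h4⟩ := hH.exists_sibling h1 h2
  refine ⟨C, hC, h3, h4, ?_, ?_⟩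
  · intro h5
    simpa using hH.subset_top C hC h5
  · rw [mem_leafParents, Finset.erase_insert h3]
    exact ⟨hHF h4, by simp, hHF hC⟩

theorem two_le_card_leafParents (h : IsClusterSystem (n + 1) F) (hn : 2 ≤ n) :
    2 ≤ (leafParents F (n + 1)).card := by
  have key : ∀ j ∈ Finset.Icc 1 n, ∃ D ∈ leafParents F (n + 1), j ∉ D := by
    intro j hj
    obtain ⟨H, h1, h2⟩ := h.hierarchy j (by rw [Icc_succ_eq]; simp [hj])
    obtain ⟨C, -, -, -, h3, h4⟩ := exists_leafParent hn hj h1 h2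
    refine ⟨_, h4, ?_⟩
    simp at hj ⊢
    exact ⟨by omega, h3⟩
  obtain ⟨D, hD, -⟩ := key 1 (by simp; omega)
  obtain ⟨h1, h2, h3⟩ := mem_leafParents.1 hD
  obtain ⟨j, hj⟩ := h.nonempty _ h3
  have hj' := h.subset _ h3 hj
  rw [Icc_succ_eq, Finset.mem_insert] at hj'
  obtain ⟨D', hD', h4⟩ := key j (hj'.resolve_left (Finset.mem_erase.1 hj).1)
  have : 1 < (leafParents F (n + 1)).card :=
    Finset.one_lt_card.2 ⟨D, hD, D', hD', fun h5 => h4 (h5 ▸ (Finset.mem_erase.1 hj).2)⟩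
  exact this

theorem leafParents_subset (h : IsClusterSystem (n + 1) F) :
    leafParents F (n + 1) ⊆ (bigClusters F).erase (Finset.Icc 1 n) := by
  intro A hA
  obtain ⟨h1, h2, h3⟩ := mem_leafParents.1 hA
  rw [Finset.mem_erase, mem_bigClusters]
  refine ⟨fun h4 => by simp [h4] at h2, h1, fun h4 => ?_⟩
  have := h.nonempty _ h3
  rw [← Finset.card_pos, Finset.card_erase_of_mem h2] at this
  omega

theorem card_keptClusters (h : IsClusterSystem (n + 1) F) (hn : 2 ≤ n) :
    (keptClusters n F).card + (leafParents F (n + 1)).card + 1 = (bigClusters F).card := by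
  obtain ⟨H, h1, h2⟩ := h.Icc_mem
  have h3 : Finset.Icc 1 n ∈ bigClusters F := by
    rw [mem_bigClusters]
    exact ⟨h1 h2.top_mem, by simp; omega⟩
  rw [keptClusters, Finset.card_sdiff_add_card_eq_card h.leafParents_subset,
    Finset.card_erase_add_one h3]

theorem bigClusters_restrict_subset {F' : Finset (Finset ℕ)}
    {H : ℕ → Finset (Finset ℕ)}
    (hF' : ∀ B ∈ F', B.Nonempty)
    (hH : ∀ j ∈ Finset.Icc 1 n, H j ⊆ F ∧ IsHierarchy (H j) ((Finset.Icc 1 (n + 1)).erase j))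
    (hsub : ∀ B ∈ F', ∃ j ∈ Finset.Icc 1 n, ∃ A ∈ H j, A.erase (n + 1) = B) :
    bigClusters F' ⊆ (keptClusters n F).image (fun A => A.erase (n + 1)) := by
  intro B hB
  obtain ⟨hBF, hB1⟩ := mem_bigClusters.1 hB
  obtain ⟨j, hj, A, hA, rfl⟩ := hsub B hBF
  have hAF := (hH j hj).1 hA
  have hjA : j ∉ A := fun h1 => by simpa using (hH j hj).2.subset_top A hA h1
  have hne := hF' _ hBF
  rw [Finset.mem_image]
  by_cases hD : A ∈ leafParents F (n + 1)
  · obtain ⟨-, h2, h3⟩ := mem_leafParents.1 hD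
    refine ⟨A.erase (n + 1), mem_keptClusters.2 ⟨h3, hB1, ?_, ?_⟩, by simp⟩
    · intro h4
      exact hjA (Finset.mem_of_mem_erase (h4 ▸ hj))
    · intro h4
      simpa using (mem_leafParents.1 h4).2.1
  · refine ⟨A, mem_keptClusters.2 ⟨hAF, ?_, ?_, hD⟩, rfl⟩
    · intro h4
      obtain ⟨x, rfl⟩ := Finset.card_eq_one.1 h4
      rcases eq_or_ne x (n + 1) with rfl | h5
      · simp at hne
      · rw [Finset.erase_eq_of_notMem (by simpa using h5.symm)] at hB1
        simp at hB1
    · rintro rfl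
      exact hjA hj

theorem eq_base (h : IsClusterSystem 2 F) (hF : (bigClusters F).card = 0) :
    F = {{1}, {2}} := by
  rw [Finset.card_eq_zero] at hF
  have h1 : ∀ A ∈ F, A.card = 1 := by
    intro A hA
    by_contra h1
    have := mem_bigClusters.2 ⟨hA, h1⟩
    simp [hF] at this
  have h2 : ∀ j ∈ Finset.Icc 1 2, (Finset.Icc 1 2).erase j ∈ F := by
    intro j hj
    obtain ⟨H, h3, h4⟩ := h.hierarchy j hj
    exact h3 h4.top_mem
  ext A
  constructor
  · intro hA
    obtain ⟨x, rfl⟩ := Finset.card_eq_one.1 (h1 A hA)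
    have := h.subset _ hA
    simp at this ⊢
    omega
  · intro hA
    rw [Finset.mem_insert, Finset.mem_singleton] at hA
    rcases hA with rfl | rfl
    · exact h2 2 (by decide)
    · exact h2 1 (by decide)

end IsClusterSystem

/-- The data of an optimal system together with its optimal restriction. -/
structure OptimalRestriction (n : ℕ) (F F' : Finset (Finset ℕ)) (H : ℕ → Finset (Finset ℕ))
    (D₁ D₂ : Finset ℕ) : Prop where
  props : SplitProps n F'
  system : IsClusterSystem (n + 1) F
  hier : ∀ j ∈ Finset.Icc 1 n, H j ⊆ F ∧ IsHierarchy (H j) ((Finset.Icc 1 (n + 1)).erase j)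
  sub : ∀ B ∈ F', ∃ j ∈ Finset.Icc 1 n, ∃ A ∈ H j, A.erase (n + 1) = B
  hier' : ∀ j ∈ Finset.Icc 1 n, ∃ H' ⊆ (H j).image (fun A => A.erase (n + 1)), H' ⊆ F' ∧
    IsHierarchy H' ((Finset.Icc 1 n).erase j)
  parents : leafParents F (n + 1) = {D₁, D₂}
  image : bigClusters F' = (keptClusters n F).image (fun A => A.erase (n + 1))
  inj : ∀ A ∈ keptClusters n F, ∀ B ∈ keptClusters n F, A.erase (n + 1) = B.erase (n + 1) → A = B

namespace OptimalRestriction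

variable {n : ℕ} {F F' : Finset (Finset ℕ)} {H : ℕ → Finset (Finset ℕ)} {D₁ D₂ P Q : Finset ℕ}

theorem swap (h : OptimalRestriction n F F' H D₁ D₂) : OptimalRestriction n F F' H D₂ D₁ :=
  { h with parents := by rw [h.parents, Finset.pair_comm] }

theorem mem_of_mem_kept (h : OptimalRestriction n F F' H D₁ D₂) {A : Finset ℕ}
    (hA : A ∈ keptClusters n F) : A.erase (n + 1) ∈ F' :=
  (mem_bigClusters.1 (h.image ▸ Finset.mem_image_of_mem _ hA)).1

/-- A side of the split of `{1, …, n}` lies in the restricted system. -/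
theorem mem_restrict (h : OptimalRestriction n F F' H D₁ D₂) (hP : P ∈ F)
    (hPI : P ⊂ Finset.Icc 1 n) : P ∈ F' := by
  by_cases h1 : P.card = 1
  · obtain ⟨x, rfl⟩ := Finset.card_eq_one.1 h1
    exact h.props.singleton x (by simpa using hPI.1)
  · have h2 : n + 1 ∉ P := fun h2 => by simpa using hPI.1 h2
    have h3 : P ∈ keptClusters n F :=
      mem_keptClusters.2 ⟨hP, h1, hPI.ne, fun h3 => h2 (mem_leafParents.1 h3).2.1⟩
    simpa [Finset.erase_eq_of_notMem h2] using h.mem_of_mem_kept h3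

/-- For each `j`, one of the two parents of the last leaf avoids `j`. -/
theorem exists_parent (h : OptimalRestriction n F F' H D₁ D₂) {j : ℕ} (hj : j ∈ Finset.Icc 1 n) :
    ∃ C ∈ H j, n + 1 ∉ C ∧ insert (n + 1) C ∈ H j ∧ j ∉ C ∧
      (insert (n + 1) C = D₁ ∨ insert (n + 1) C = D₂) := by
  obtain ⟨C, h1, h2, h3, h4, h5⟩ :=
    IsClusterSystem.exists_leafParent h.props.two_le hj (h.hier j hj).1 (h.hier j hj).2
  refine ⟨C, h1, h2, h3, h4, ?_⟩
  rw [h.parents] at h5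
  simpa using h5

/-- A side of the split of `{1, …, n}` occurs in the hierarchies belonging to the other side,
unless it is the sibling of the last leaf. -/
theorem mem_hier (h : OptimalRestriction n F F' H D₁ D₂) (hPF : P ∈ F) (hP : P ∈ F')
    (hPD : insert (n + 1) P ∉ leafParents F (n + 1)) {j : ℕ} (hj : j ∈ Finset.Icc 1 n)
    (hjP : j ∉ P) : P ∈ H j := by
  obtain ⟨H', h1, h2, h3⟩ := h.hier' j hj
  have h4 : P ∈ H' := h.props.mem_hierarchy h3 h2 P hP
    (Finset.subset_erase.2 ⟨h.props.subset P hP, hjP⟩)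
  obtain ⟨A, hA, hAP⟩ := Finset.mem_image.1 (h1 h4)
  by_cases h5 : n + 1 ∈ A
  · exfalso
    apply hPD
    rw [← hAP, Finset.insert_erase h5, mem_leafParents, hAP]
    exact ⟨(h.hier j hj).1 hA, h5, hPF⟩
  · rw [Finset.erase_eq_of_notMem h5] at hAP
    exact hAP ▸ hA

end OptimalRestriction

namespace OptimalRestriction

variable {n : ℕ} {F F' : Finset (Finset ℕ)} {H : ℕ → Finset (Finset ℕ)} {D₁ D₂ P Q : Finset ℕ}

theorem disjoint_parents (h : OptimalRestriction n F F' H D₁ D₂) {j : ℕ}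
    (hj : j ∈ Finset.Icc 1 n) (h1 : j ∈ D₁) : j ∉ D₂ := by
  intro h2
  obtain ⟨C, -, -, -, h3, h4⟩ := h.exists_parent hj
  have hjn : j ≠ n + 1 := by simp at hj; omega
  rcases h4 with rfl | rfl
  · exact h3 ((Finset.mem_insert.1 h1).resolve_left hjn)
  · exact h3 ((Finset.mem_insert.1 h2).resolve_left hjn)

theorem right_spec (h : OptimalRestriction n F F' H D₁ D₂) :
    n + 1 ∈ D₂ ∧ D₂ ⊆ insert (n + 1) (Finset.Icc 1 n) ∧ ∃ j ∈ Finset.Icc 1 n, j ∈ D₂ := by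
  have h1 : D₂ ∈ leafParents F (n + 1) := by rw [h.parents]; simp
  obtain ⟨h2, h3, h4⟩ := mem_leafParents.1 h1
  have h5 := h.system.subset _ h2
  rw [Icc_succ_eq] at h5
  obtain ⟨j, hj⟩ := h.system.nonempty _ h4
  rw [Finset.mem_erase] at hj
  exact ⟨h3, h5, j, (Finset.mem_insert.1 (h5 hj.2)).resolve_left hj.1, hj.2⟩

theorem parent_cases (h : OptimalRestriction n F F' H D₁ D₂) (hPF : P ∈ F)
    (e : IsEdge n F' P Q) (hPD : insert (n + 1) P ∉ leafParents F (n + 1)) :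
    ∀ j ∈ Q, (j ∉ D₁ ∧ (Disjoint P D₁ ∨ P ⊆ D₁)) ∨ (j ∉ D₂ ∧ (Disjoint P D₂ ∨ P ⊆ D₂)) := by
  intro j hjQ
  have hj := h.props.subset Q e.right hjQ
  have hP := h.mem_hier hPF e.left hPD hj (Finset.disjoint_right.1 e.disj hjQ)
  obtain ⟨C, -, -, h2, h3, h4⟩ := h.exists_parent hj
  have hjn : j ≠ n + 1 := by simp at hj; omega
  have h5 : j ∉ insert (n + 1) C := by simp [hjn, h3]
  have h6 : Disjoint P (insert (n + 1) C) ∨ P ⊆ insert (n + 1) C := by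
    rcases (h.hier j hj).2.laminar _ hP _ h2 with h7 | h7 | h7
    · exact Or.inr h7
    · exact absurd (h7 (Finset.mem_insert_self _ _)) (h.props.notMem_succ e.left)
    · exact Or.inl h7
  rcases h4 with rfl | rfl
  · exact Or.inl ⟨h5, h6⟩
  · exact Or.inr ⟨h5, h6⟩

theorem eq_insert_of_subset (h : OptimalRestriction n F F' H D₁ D₂) (e : IsEdge n F' P Q)
    (h1 : P ⊆ D₂) (h2 : ∀ j ∈ Q, j ∉ D₂) : insert (n + 1) P ∈ leafParents F (n + 1) := by
  obtain ⟨h3, h4, -⟩ := h.right_spec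
  have : insert (n + 1) P = D₂ := by
    apply Finset.Subset.antisymm
    · exact Finset.insert_subset h3 h1
    · intro x hx
      have h5 := h4 hx
      rw [← e.union, Finset.mem_insert, Finset.mem_union] at h5
      rcases h5 with h5 | h5 | h5
      · simp [h5]
      · simp [h5]
      · exact absurd hx (h2 x h5)
  rw [this, h.parents]
  simp

theorem insert_mem_of_right (h : OptimalRestriction n F F' H D₁ D₂) (hPF : P ∈ F)
    (e : IsEdge n F' P Q) (hQ : insert (n + 1) Q = D₁) :
    insert (n + 1) P ∈ leafParents F (n + 1) := by
  by_contra hPD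
  have h1 : ∀ j ∈ Q, j ∉ D₂ := fun j hj =>
    h.disjoint_parents (h.props.subset Q e.right hj) (hQ ▸ Finset.mem_insert_of_mem hj)
  obtain ⟨-, -, i, hi, hi2⟩ := h.right_spec
  rw [← e.union, Finset.mem_union] at hi
  have hiP : i ∈ P := hi.resolve_right (fun h3 => h1 i h3 hi2)
  obtain ⟨q, hq⟩ := h.props.nonempty Q e.right
  rcases h.parent_cases hPF e hPD q hq with h2 | ⟨-, h2 | h2⟩
  · exact h2.1 (hQ ▸ Finset.mem_insert_of_mem hq)
  · exact Finset.disjoint_left.1 h2 hiP hi2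
  · exact hPD (h.eq_insert_of_subset e h2 h1)

theorem insert_mem_of_left (h : OptimalRestriction n F F' H D₁ D₂) (hPF : P ∈ F) (hQF : Q ∈ F)
    (e : IsEdge n F' P Q) (hPD : insert (n + 1) P ∉ leafParents F (n + 1))
    (hQD : insert (n + 1) Q ∉ leafParents F (n + 1)) {q : ℕ} (hq : q ∈ Q) (hq1 : q ∉ D₁)
    (hq2 : Disjoint P D₁ ∨ P ⊆ D₁) : False := by
  have c1 := h.parent_cases hPF e hPD
  have c2 := h.parent_cases hQF e.symm hQD
  obtain ⟨-, -, i, hi, hi2⟩ := h.right_spec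
  obtain ⟨-, -, k, hk, hk1⟩ := h.swap.right_spec
  have hd := @disjoint_parents _ _ _ _ _ _ h
  rw [← e.union, Finset.mem_union] at hi hk
  obtain ⟨p, hp⟩ := h.props.nonempty P e.left
  rcases hq2 with hq2 | hq2
  · have hkQ : k ∈ Q := hk.resolve_left (fun h3 => Finset.disjoint_left.1 hq2 h3 hk1)
    have hk2 := hd (h.props.subset Q e.right hkQ) hk1
    rcases c2 p hp with ⟨-, h3 | h3⟩ | ⟨h4, h3⟩
    · exact Finset.disjoint_left.1 h3 hkQ hk1
    · exact hq1 (h3 hq)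
    · rcases c1 k hkQ with h5 | ⟨-, h5 | h5⟩
      · exact h5.1 hk1
      · have hiQ : i ∈ Q := hi.resolve_left (fun h6 => Finset.disjoint_left.1 h5 h6 hi2)
        rcases h3 with h3 | h3
        · exact Finset.disjoint_left.1 h3 hiQ hi2
        · exact hk2 (h3 hkQ)
      · exact h4 (h5 hp)
  · have h1 : ∀ j ∈ P, j ∉ D₂ := fun j hj => hd (h.props.subset P e.left hj) (hq2 hj)
    have hiQ : i ∈ Q := hi.resolve_left (fun h6 => h1 i h6 hi2)
    rcases c2 p hp with h3 | ⟨-, h3 | h3⟩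
    · exact h3.1 (hq2 hp)
    · exact Finset.disjoint_left.1 h3 hiQ hi2
    · exact hQD (h.eq_insert_of_subset e.symm h3 h1)

theorem insert_mem (h : OptimalRestriction n F F' H D₁ D₂) (hPF : P ∈ F) (hQF : Q ∈ F)
    (e : IsEdge n F' P Q) : insert (n + 1) P ∈ leafParents F (n + 1) := by
  by_contra hPD
  by_cases hQD : insert (n + 1) Q ∈ leafParents F (n + 1)
  · rw [h.parents, Finset.mem_insert, Finset.mem_singleton] at hQD
    rcases hQD with hQD | hQD
    · exact hPD (h.insert_mem_of_right hPF e hQD)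
    · exact hPD (h.swap.insert_mem_of_right hPF e hQD)
  · obtain ⟨q, hq⟩ := h.props.nonempty Q e.right
    rcases h.parent_cases hPF e hPD q hq with ⟨h1, h2⟩ | ⟨h1, h2⟩
    · exact h.insert_mem_of_left hPF hQF e hPD hQD hq h1 h2
    · exact h.swap.insert_mem_of_left hPF hQF e hPD hQD hq h1 h2

theorem leafParents_eq (h : OptimalRestriction n F F' H D₁ D₂) (hPF : P ∈ F) (hQF : Q ∈ F)
    (e : IsEdge n F' P Q) :
    leafParents F (n + 1) = {insert (n + 1) P, insert (n + 1) Q} := by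
  have h1 := h.insert_mem hPF hQF e
  have h2 := h.insert_mem hQF hPF e.symm
  have h3 : insert (n + 1) P ≠ insert (n + 1) Q := by
    intro h3
    obtain ⟨p, hp⟩ := h.props.nonempty P e.left
    have h4 : p ∈ insert (n + 1) Q := h3 ▸ Finset.mem_insert_of_mem hp
    rcases Finset.mem_insert.1 h4 with rfl | h4
    · exact h.props.notMem_succ e.left hp
    · exact Finset.disjoint_left.1 e.disj hp h4
  symm
  apply Finset.eq_of_subset_of_card_le
  · intro A hA
    rw [Finset.mem_insert, Finset.mem_singleton] at hA
    rcases hA with rfl | rfl <;> assumption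
  · rw [Finset.card_pair h3, h.parents]
    exact Finset.card_le_two

/-- The position of the last leaf in a kept cluster. -/
theorem kept_spec (h : OptimalRestriction n F F' H D₁ D₂) (hPF : P ∈ F) (hQF : Q ∈ F)
    (e : IsEdge n F' P Q) {A : Finset ℕ} (hA : A ∈ keptClusters n F) :
    (n + 1 ∉ A ∧ (A ⊆ P ∨ A ⊆ Q)) ∨ (n + 1 ∈ A ∧ (P ⊆ A ∨ Q ⊆ A)) := by
  have hLP := h.leafParents_eq hPF hQF e
  obtain ⟨hAF, hA1, hAI, hAD⟩ := mem_keptClusters.1 hA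
  obtain ⟨j, hj, A', hA', hAA'⟩ := h.sub _ (h.mem_of_mem_kept hA)
  have hA'F := (h.hier j hj).1 hA'
  have hjA' : j ∉ A' := fun h1 => by simpa using (h.hier j hj).2.subset_top _ hA' h1
  by_cases h1 : A = A'
  · subst h1
    obtain ⟨C, h2, h3, h4, h5, h6⟩ := h.exists_parent hj
    have h7 : C = P ∨ C = Q := by
      have h7 : insert (n + 1) C ∈ leafParents F (n + 1) := by rw [h.parents]; simpa using h6
      rw [hLP, Finset.mem_insert, Finset.mem_singleton] at h7
      refine h7.imp (fun h8 => ?_) (fun h8 => ?_)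
      · rw [← Finset.erase_insert h3, h8, Finset.erase_insert (h.props.notMem_succ e.left)]
      · rw [← Finset.erase_insert h3, h8, Finset.erase_insert (h.props.notMem_succ e.right)]
    have hnA := h.system.nonempty _ hAF
    have hCC : ∀ R S : Finset ℕ, IsEdge n F' R S → C = R →
        (n + 1 ∉ A ∧ (A ⊆ R ∨ A ⊆ S)) ∨ (n + 1 ∈ A ∧ (R ⊆ A ∨ S ⊆ A)) := by
      rintro R S e' rfl
      by_cases h8 : n + 1 ∈ A
      · refine Or.inr ⟨h8, Or.inl ?_⟩
        rcases (h.hier j hj).2.laminar _ hA' _ h2 with h9 | h9 | h9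
        · exact absurd (h9 h8) h3
        · exact h9
        · exfalso
          rcases (h.hier j hj).2.laminar _ hA' _ h4 with h10 | h10 | h10
          · apply hA1
            rw [Finset.card_eq_one]
            refine ⟨n + 1, Finset.eq_singleton_iff_unique_mem.2 ⟨h8, fun x hx => ?_⟩⟩
            exact (Finset.mem_insert.1 (h10 hx)).resolve_right (Finset.disjoint_left.1 h9 hx)
          · obtain ⟨x, hx⟩ := h.props.nonempty _ e'.left
            exact Finset.disjoint_left.1 h9 (h10 (Finset.mem_insert_of_mem hx)) hx
          · exact Finset.disjoint_left.1 h10 h8 (Finset.mem_insert_self _ _)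
      · refine Or.inl ⟨h8, ?_⟩
        rcases (h.hier j hj).2.laminar _ hA' _ h4 with h10 | h10 | h10
        · left; intro x hx
          exact (Finset.mem_insert.1 (h10 hx)).resolve_left (fun h11 => h8 (h11 ▸ hx))
        · exact absurd (h10 (Finset.mem_insert_self _ _)) h8
        · right; intro x hx
          have h11 := h.system.subset _ hAF hx
          rw [Icc_succ_eq, Finset.mem_insert, ← e'.union, Finset.mem_union] at h11
          rcases h11 with rfl | h11 | h11
          · exact absurd hx h8
          · exact absurd (Finset.mem_insert_of_mem h11) (Finset.disjoint_left.1 h10 hx)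
          · exact h11
    rcases h7 with h7 | h7
    · exact hCC P Q e h7
    · have := hCC Q P e.symm h7
      tauto
  · have h2 : A' ∈ leafParents F (n + 1) := by
      by_contra h2
      refine h1 (h.inj A hA A' (mem_keptClusters.2 ⟨hA'F, ?_, ?_, h2⟩) hAA'.symm)
      · intro h3
        obtain ⟨x, rfl⟩ := Finset.card_eq_one.1 h3
        have h5 : A.erase (n + 1) ∈ bigClusters F' := h.image ▸ Finset.mem_image_of_mem _ hA
        have h6 := (mem_bigClusters.1 h5).2
        rw [← hAA'] at h6
        rcases eq_or_ne x (n + 1) with rfl | h4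
        · have := h.props.nonempty _ (mem_bigClusters.1 h5).1
          rw [← hAA'] at this
          simp at this
        · rw [Finset.erase_eq_of_notMem (by simpa using h4.symm)] at h6
          simp at h6
      · rintro rfl
        exact hjA' hj
    have h7 : A.erase (n + 1) = P ∨ A.erase (n + 1) = Q := by
      rw [hLP, Finset.mem_insert, Finset.mem_singleton] at h2
      rcases h2 with rfl | rfl
      · exact Or.inl (by rw [← hAA', Finset.erase_insert (h.props.notMem_succ e.left)])
      · exact Or.inr (by rw [← hAA', Finset.erase_insert (h.props.notMem_succ e.right)])
    have h8 : n + 1 ∉ A := by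
      intro h8
      apply hAD
      rw [mem_leafParents]
      refine ⟨hAF, h8, ?_⟩
      rcases h7 with h7 | h7 <;> rwa [h7]
    rw [Finset.erase_eq_of_notMem h8] at h7
    exact Or.inl ⟨h8, h7.imp (fun h9 => h9.subset) (fun h9 => h9.subset)⟩

theorem eq_graft (h : OptimalRestriction n F F' H D₁ D₂) (hPF : P ∈ F) (hQF : Q ∈ F)
    (e : IsEdge n F' P Q) : F = graft n F' P Q := by
  have hLP := h.leafParents_eq hPF hQF e
  have hn := h.props.two_le
  have hsingle : ∀ x ∈ Finset.Icc 1 (n + 1), {x} ∈ F := by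
    intro x hx
    obtain ⟨j, hj, hjx⟩ : ∃ j ∈ Finset.Icc 1 (n + 1), j ≠ x := by
      rcases eq_or_ne x 1 with rfl | hx1
      · exact ⟨2, by simp; omega, by omega⟩
      · exact ⟨1, by simp, hx1.symm⟩
    obtain ⟨K, h1, h2⟩ := h.system.hierarchy j hj
    exact h1 (h2.singleton_mem x (Finset.mem_erase.2 ⟨hjx.symm, hx⟩))
  ext A
  rw [mem_graft]
  constructor
  · intro hA
    by_cases h1 : A.card = 1
    · obtain ⟨x, rfl⟩ := Finset.card_eq_one.1 h1
      rcases eq_or_ne x (n + 1) with rfl | hx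
      · exact Or.inr (Or.inl rfl)
      · have h2 := h.system.subset _ hA
        rw [Icc_succ_eq, Finset.singleton_subset_iff] at h2
        have h3 := (Finset.mem_insert.1 h2).resolve_left hx
        refine Or.inr (Or.inr (Or.inl ⟨h.props.singleton x h3, ?_⟩))
        rw [← e.union] at h3
        simpa using h3
    by_cases h2 : A = Finset.Icc 1 n
    · exact Or.inl h2
    by_cases h3 : A ∈ leafParents F (n + 1)
    · rw [hLP, Finset.mem_insert, Finset.mem_singleton] at h3
      rcases h3 with rfl | rfl
      · exact Or.inr (Or.inr (Or.inr ⟨P, e.left, Or.inl subset_rfl, rfl⟩))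
      · exact Or.inr (Or.inr (Or.inr ⟨Q, e.right, Or.inr subset_rfl, rfl⟩))
    · have hk := mem_keptClusters.2 ⟨hA, h1, h2, h3⟩
      have hk' := h.mem_of_mem_kept hk
      rcases h.kept_spec hPF hQF e hk with ⟨h4, h5⟩ | ⟨h4, h5⟩
      · rw [Finset.erase_eq_of_notMem h4] at hk'
        exact Or.inr (Or.inr (Or.inl ⟨hk', h5⟩))
      · refine Or.inr (Or.inr (Or.inr ⟨_, hk', ?_, Finset.insert_erase h4⟩))
        exact h5.imp
          (fun h6 => Finset.subset_erase.2 ⟨h6, h.props.notMem_succ e.left⟩)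
          (fun h6 => Finset.subset_erase.2 ⟨h6, h.props.notMem_succ e.right⟩)
  · have hmem : ∀ B ∈ F', B.card ≠ 1 → ∃ A ∈ keptClusters n F, A.erase (n + 1) = B := by
      intro B hB hB1
      have : B ∈ bigClusters F' := mem_bigClusters.2 ⟨hB, hB1⟩
      rw [h.image] at this
      exact Finset.mem_image.1 this
    rintro (rfl | rfl | ⟨hA, h1⟩ | ⟨B, hB, h1, rfl⟩)
    · obtain ⟨K, h1, h2⟩ := h.system.Icc_mem
      exact h1 h2.top_mem
    · exact hsingle _ (by simp)
    · by_cases hA1 : A.card = 1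
      · obtain ⟨x, rfl⟩ := Finset.card_eq_one.1 hA1
        have := h.props.subset _ hA
        apply hsingle
        rw [Icc_succ_eq]
        exact Finset.mem_insert_of_mem (by simpa using this)
      obtain ⟨A', hk, rfl⟩ := hmem A hA hA1
      obtain ⟨hAF, -, -, hAD⟩ := mem_keptClusters.1 hk
      rcases h.kept_spec hPF hQF e hk with ⟨h4, h5⟩ | ⟨h4, h5⟩
      · rwa [Finset.erase_eq_of_notMem h4]
      · exfalso
        apply hAD
        have h6 : A'.erase (n + 1) = P ∨ A'.erase (n + 1) = Q := by
          have h7 : P ⊆ A'.erase (n + 1) ∨ Q ⊆ A'.erase (n + 1) := h5.imp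
            (fun h6 => Finset.subset_erase.2 ⟨h6, h.props.notMem_succ e.left⟩)
            (fun h6 => Finset.subset_erase.2 ⟨h6, h.props.notMem_succ e.right⟩)
          obtain ⟨p, hp⟩ := h.props.nonempty P e.left
          obtain ⟨q, hq⟩ := h.props.nonempty Q e.right
          rcases h1 with h1 | h1 <;> rcases h7 with h7 | h7
          · exact Or.inl (h1.antisymm h7)
          · exact absurd hq (Finset.disjoint_left.1 e.disj (h1 (h7 hq)))
          · exact absurd (h1 (h7 hp)) (Finset.disjoint_left.1 e.disj hp)
          · exact Or.inr (h1.antisymm h7)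
        rw [mem_leafParents]
        refine ⟨hAF, h4, ?_⟩
        rcases h6 with h6 | h6 <;> rwa [h6]
    · by_cases hPB : insert (n + 1) B ∈ leafParents F (n + 1)
      · exact (mem_leafParents.1 hPB).1
      have hBP : B ≠ P ∧ B ≠ Q := by
        rw [hLP] at hPB
        constructor <;> rintro rfl <;> simp at hPB
      have hB1 : B.card ≠ 1 := by
        intro h2
        obtain ⟨x, rfl⟩ := Finset.card_eq_one.1 h2
        rcases h1 with h1 | h1
        · rcases Finset.subset_singleton_iff.1 h1 with h3 | h3
          · simpa [h3] using h.props.nonempty P e.left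
          · exact hBP.1 h3.symm
        · rcases Finset.subset_singleton_iff.1 h1 with h3 | h3
          · simpa [h3] using h.props.nonempty Q e.right
          · exact hBP.2 h3.symm
      obtain ⟨A', hk, rfl⟩ := hmem B hB hB1
      rcases h.kept_spec hPF hQF e hk with ⟨h4, h5⟩ | ⟨h4, h5⟩
      · exfalso
        rw [Finset.erase_eq_of_notMem h4] at h1 hBP
        obtain ⟨p, hp⟩ := h.props.nonempty P e.left
        obtain ⟨q, hq⟩ := h.props.nonempty Q e.right
        rcases h1 with h1 | h1 <;> rcases h5 with h5 | h5
        · exact hBP.1 (h5.antisymm h1)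
        · exact Finset.disjoint_left.1 e.disj hp (h5 (h1 hp))
        · exact Finset.disjoint_left.1 e.disj (h5 (h1 hq)) hq
        · exact hBP.2 (h5.antisymm h1)
      · rw [Finset.insert_erase h4]
        exact (mem_keptClusters.1 hk).1

end OptimalRestriction

/-- A cluster system on `{1, …, n}` has at least `3 n - 6` clusters which are not singletons, and
those with exactly this number are the split systems of trivalent trees. -/
theorem IsClusterSystem.three_mul_le {n : ℕ} (hn : 2 ≤ n) : ∀ F, IsClusterSystem n F →
    3 * n ≤ (bigClusters F).card + 6 ∧
      ((bigClusters F).card + 6 = 3 * n → IsSplitSystem n F) := by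
  induction n, hn using Nat.le_induction with
  | base =>
    intro F h
    refine ⟨by omega, fun h1 => ?_⟩
    rw [h.eq_base (by omega)]
    exact IsSplitSystem.base
  | succ n hn ih =>
    intro F h
    obtain ⟨F', hF', H, hH, hsub, hH'⟩ := h.exists_restrict hn
    have h1 := IsClusterSystem.bigClusters_restrict_subset hF'.nonempty hH hsub
    have h2 := Finset.card_le_card h1
    have h3 : ((keptClusters n F).image (fun A => A.erase (n + 1))).card ≤ (keptClusters n F).card :=
      Finset.card_image_le
    have h4 := h.two_le_card_leafParents hn
    have h5 := h.card_keptClusters hn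
    obtain ⟨h6, h7⟩ := ih F' hF'
    refine ⟨by omega, fun h8 => ?_⟩
    have hS := h7 (by omega)
    obtain ⟨D₁, D₂, -, hD⟩ := Finset.card_eq_two.1 (show (leafParents F (n + 1)).card = 2 by omega)
    have hopt : OptimalRestriction n F F' H D₁ D₂ := {
      props := hS.props
      system := h
      hier := hH
      sub := hsub
      hier' := hH'
      parents := hD
      image := Finset.eq_of_subset_of_card_le h1 (by omega)
      inj := by
        have : ((keptClusters n F).image (fun A => A.erase (n + 1))).card
          = (keptClusters n F).card := by omega
        have := Finset.card_image_iff.1 this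
        exact fun A hA B hB hAB => this hA hB hAB }
    obtain ⟨K, hK, hKI⟩ := h.Icc_mem
    obtain ⟨P, hP, Q, hQ, hd, hU⟩ := hKI.exists_children (by simp; omega)
    have hne : ∀ R S : Finset ℕ, S.Nonempty → Disjoint R S → R ∪ S = Finset.Icc 1 n →
        R ⊂ Finset.Icc 1 n := by
      intro R S hS hd hU
      refine ⟨hU ▸ Finset.subset_union_left, fun h9 => ?_⟩
      obtain ⟨x, hx⟩ := hS
      exact Finset.disjoint_right.1 hd hx (h9 (hU ▸ Finset.mem_union_right _ hx))
    have e : IsEdge n F' P Q := ⟨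
      hopt.mem_restrict (hK hP) (hne P Q (hKI.nonempty_of_mem Q hQ) hd hU),
      hopt.mem_restrict (hK hQ) (hne Q P (hKI.nonempty_of_mem P hP) hd.symm
        (by rw [Finset.union_comm, hU])), hd, hU⟩
    rw [hopt.eq_graft (hK hP) (hK hQ) e]
    exact IsSplitSystem.step hS e.left e.right hd hU

/-! ### Counting split systems -/

section

variable {n : ℕ} {F : Finset (Finset ℕ)} {P Q : Finset ℕ}

theorem SplitProps.mem_iff_graft (h : SplitProps n F) (e : IsEdge n F P Q) {A : Finset ℕ} :
    A ∈ F ↔ A.Nonempty ∧ A ≠ Finset.Icc 1 n ∧ n + 1 ∉ A ∧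
      (A ∈ NodeComputation.graft n F P Q ∨ insert (n + 1) A ∈ NodeComputation.graft n F P Q) := by
  constructor
  · intro hA
    refine ⟨h.nonempty A hA, fun h1 => h.not_Icc_subset hA h1.ge, h.notMem_succ hA, ?_⟩
    simp only [mem_graft]
    rcases h.sub_or e.left e.disj e.union hA with h1 | h1 | h1 | h1
    · exact Or.inl (Or.inr (Or.inr (Or.inl ⟨hA, Or.inl h1⟩)))
    · exact Or.inl (Or.inr (Or.inr (Or.inl ⟨hA, Or.inr h1⟩)))
    · exact Or.inr (Or.inr (Or.inr (Or.inr ⟨A, hA, Or.inl h1, rfl⟩)))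
    · exact Or.inr (Or.inr (Or.inr (Or.inr ⟨A, hA, Or.inr h1, rfl⟩)))
  · rintro ⟨h1, h2, h3, h4⟩
    simp only [mem_graft] at h4
    rcases h4 with (h4 | h4 | h4 | ⟨B, hB, -, h4⟩) | (h4 | h4 | h4 | ⟨B, hB, -, h4⟩)
    · exact absurd h4 h2
    · simp [h4] at h3
    · exact h4.1
    · exact absurd (h4 ▸ Finset.mem_insert_self _ _) h3
    · have : n + 1 ∈ Finset.Icc 1 n := h4 ▸ Finset.mem_insert_self _ _
      simp at this
    · obtain ⟨x, hx⟩ := h1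
      have : x ∈ ({n + 1} : Finset ℕ) := h4 ▸ Finset.mem_insert_of_mem hx
      rw [Finset.mem_singleton] at this
      exact absurd (this ▸ hx) h3
    · exact absurd (Finset.mem_insert_self _ _) (h.notMem_succ h4.1)
    · rw [← Finset.erase_insert h3, ← h4, Finset.erase_insert (h.notMem_succ hB)]
      exact hB

theorem SplitProps.eq_or_eq_of_small_of_large (h : SplitProps n F) (e : IsEdge n F P Q) {A : Finset ℕ}
    (h1 : A ⊆ P ∨ A ⊆ Q) (h2 : P ⊆ A ∨ Q ⊆ A) : A = P ∨ A = Q := by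
  obtain ⟨p, hp⟩ := h.nonempty P e.left
  obtain ⟨q, hq⟩ := h.nonempty Q e.right
  rcases h1 with h1 | h1 <;> rcases h2 with h2 | h2
  · exact Or.inl (h1.antisymm h2)
  · exact absurd hq (Finset.disjoint_left.1 e.disj (h1 (h2 hq)))
  · exact absurd (h1 (h2 hp)) (Finset.disjoint_left.1 e.disj hp)
  · exact Or.inr (h1.antisymm h2)

theorem SplitProps.edge_iff_graft (h : SplitProps n F) (e : IsEdge n F P Q) {A : Finset ℕ} :
    (A = P ∨ A = Q) ↔ n + 1 ∉ A ∧ A ∈ NodeComputation.graft n F P Q ∧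
      insert (n + 1) A ∈ NodeComputation.graft n F P Q := by
  constructor
  · rintro (rfl | rfl)
    · exact ⟨h.notMem_succ e.left, mem_graft.2 (Or.inr (Or.inr (Or.inl ⟨e.left, by simp⟩))),
        mem_graft.2 (Or.inr (Or.inr (Or.inr ⟨_, e.left, by simp, rfl⟩)))⟩
    · exact ⟨h.notMem_succ e.right, mem_graft.2 (Or.inr (Or.inr (Or.inl ⟨e.right, by simp⟩))),
        mem_graft.2 (Or.inr (Or.inr (Or.inr ⟨_, e.right, by simp, rfl⟩)))⟩
  · rintro ⟨h1, h2, h3⟩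
    have hG := h.graft e
    have h4 : A.Nonempty := hG.nonempty _ h2
    have h5 : A ≠ Finset.Icc 1 n := by
      rintro rfl
      exact hG.not_Icc_subset h3 (Icc_succ_eq n).subset
    have h6 : A ⊆ P ∨ A ⊆ Q := by
      rcases mem_graft.1 h2 with h4 | h4 | h4 | ⟨B, hB, -, h4⟩
      · exact absurd h4 h5
      · simp [h4] at h1
      · exact h4.2
      · exact absurd (h4 ▸ Finset.mem_insert_self _ _) h1
    have h7 : P ⊆ A ∨ Q ⊆ A := by
      rcases mem_graft.1 h3 with h7 | h7 | h7 | ⟨B, hB, h8, h7⟩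
      · have : n + 1 ∈ Finset.Icc 1 n := h7 ▸ Finset.mem_insert_self _ _
        simp at this
      · obtain ⟨x, hx⟩ := h4
        have : x ∈ ({n + 1} : Finset ℕ) := h7 ▸ Finset.mem_insert_of_mem hx
        rw [Finset.mem_singleton] at this
        exact absurd (this ▸ hx) h1
      · exact absurd (Finset.mem_insert_self _ _) (h.notMem_succ h7.1)
      · rwa [← Finset.erase_insert h1, ← h7, Finset.erase_insert (h.notMem_succ hB)]
    exact h.eq_or_eq_of_small_of_large e h6 h7

theorem SplitProps.isEdge_compl (h : SplitProps n F) (hP : P ∈ F) :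
    IsEdge n F P (Finset.Icc 1 n \ P) :=
  ⟨hP, h.compl P hP, Finset.disjoint_sdiff, Finset.union_sdiff_of_subset (h.subset P hP)⟩

theorem IsEdge.right_eq (e : IsEdge n F P Q) : Q = Finset.Icc 1 n \ P := by
  rw [← e.union, Finset.union_sdiff_cancel_left e.disj]

theorem IsSplitSystem.exists_graft {G : Finset (Finset ℕ)} (hn : 2 ≤ n)
    (h : IsSplitSystem (n + 1) G) :
    ∃ F P Q, IsSplitSystem n F ∧ IsEdge n F P Q ∧ G = graft n F P Q := by
  generalize hm : n + 1 = m at h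
  cases h with
  | base => omega
  | @step k F P Q hF hP hQ hPQ hU =>
    obtain rfl : n = k := by omega
    exact ⟨F, P, Q, hF, ⟨hP, hQ, hPQ, hU⟩, rfl⟩

end

open Classical in
/-- The split systems of the trivalent trees with leaves `1, …, n`. -/
noncomputable def splitSystems (n : ℕ) : Finset (Finset (Finset ℕ)) :=
  (Finset.Icc 1 n).powerset.powerset.filter (IsSplitSystem n)

theorem mem_splitSystems {n : ℕ} {F : Finset (Finset ℕ)} :
    F ∈ splitSystems n ↔ IsSplitSystem n F := by
  simp only [splitSystems, Finset.mem_filter, and_iff_right_iff_imp]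
  intro h
  simpa [Finset.subset_iff] using h.props.subset

theorem two_mul_card_splitSystems_succ {n : ℕ} (hn : 2 ≤ n) :
    2 * (splitSystems (n + 1)).card = (4 * n - 6) * (splitSystems n).card := by
  classical
  set s := (splitSystems n).sigma (fun F => F) with hs
  have h1 : s.card = (4 * n - 6) * (splitSystems n).card := by
    rw [hs, Finset.card_sigma, Finset.sum_congr rfl (g := fun _ => 4 * n - 6), Finset.sum_const,
      smul_eq_mul, mul_comm]
    intro F hF
    have := (mem_splitSystems.1 hF).props.card
    omega
  let f : (Σ _ : Finset (Finset ℕ), Finset ℕ) → Finset (Finset ℕ) :=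
    fun p => graft n p.1 p.2 (Finset.Icc 1 n \ p.2)
  have h2 : ∀ p ∈ s, f p ∈ splitSystems (n + 1) := by
    rintro ⟨F, P⟩ hp
    obtain ⟨hF, hP⟩ := Finset.mem_sigma.1 hp
    have hF' := mem_splitSystems.1 hF
    have e := hF'.props.isEdge_compl hP
    exact mem_splitSystems.2 (IsSplitSystem.step hF' e.left e.right e.disj e.union)
  have h3 : ∀ G ∈ splitSystems (n + 1), (s.filter (fun p => f p = G)).card = 2 := by
    intro G hG
    obtain ⟨F, P, Q, hF, e, rfl⟩ := (mem_splitSystems.1 hG).exists_graft hn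
    have hPQ : P ≠ Q := by
      rintro rfl
      obtain ⟨x, hx⟩ := hF.props.nonempty P e.left
      exact Finset.disjoint_left.1 e.disj hx hx
    have : s.filter (fun p => f p = graft n F P Q) = {⟨F, P⟩, ⟨F, Q⟩} := by
      ext ⟨F', P'⟩
      simp only [hs, Finset.mem_filter, Finset.mem_sigma, Finset.mem_insert, Finset.mem_singleton,
        mem_splitSystems, f, Sigma.mk.injEq, heq_eq_eq]
      constructor
      · rintro ⟨⟨hF', hP'⟩, h4⟩
        have e' := hF'.props.isEdge_compl hP'
        have h5 : F' = F := by
          ext A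
          rw [hF'.props.mem_iff_graft e', hF.props.mem_iff_graft e, h4]
        have h6 := (hF'.props.edge_iff_graft e').1 (Or.inl rfl)
        rw [h4, ← hF.props.edge_iff_graft e] at h6
        tauto
      · rintro (⟨rfl, rfl⟩ | ⟨rfl, rfl⟩)
        · exact ⟨⟨hF, e.left⟩, by rw [← e.right_eq]⟩
        · exact ⟨⟨hF, e.right⟩, by rw [← e.symm.right_eq, graft_comm]⟩
    rw [this, Finset.card_pair (by simp [hPQ])]
  rw [← h1, Finset.card_eq_sum_card_fiberwise (f := f) h2, Finset.sum_congr rfl h3,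
    Finset.sum_const, smul_eq_mul, mul_comm]

theorem splitSystems_two : splitSystems 2 = {{{1}, {2}}} := by
  ext F
  rw [mem_splitSystems, Finset.mem_singleton]
  constructor
  · intro h
    generalize hm : 2 = m at h
    cases h with
    | base => rfl
    | @step k F P Q hF hP hQ hPQ hU =>
      have := hF.props.two_le
      omega
  · rintro rfl
    exact IsSplitSystem.base

theorem card_splitSystems {n : ℕ} (hn : 2 ≤ n) : (splitSystems n).card = (2 * n - 5)‼ := by
  induction n, hn using Nat.le_induction with
  | base => simp [splitSystems_two]
  | succ n hn ih =>
    have h1 := two_mul_card_splitSystems_succ hn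
    rw [ih] at h1
    have h2 : (2 * (n + 1) - 5)‼ = (2 * n - 3) * (2 * n - 5)‼ := by
      rcases eq_or_lt_of_le hn with rfl | h3
      · simp [Nat.doubleFactorial]
      · obtain ⟨k, rfl⟩ : ∃ k, n = k + 3 := ⟨n - 3, by omega⟩
        have e1 : 2 * (k + 3 + 1) - 5 = (2 * k + 1) + 2 := by omega
        have e2 : 2 * (k + 3) - 5 = 2 * k + 1 := by omega
        have e3 : 2 * (k + 3) - 3 = 2 * k + 1 + 2 := by omega
        rw [e1, e2, e3, Nat.doubleFactorial_add_two]
    rw [h2]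
    have e4 : 4 * n - 6 = 2 * (2 * n - 3) := by omega
    rw [e4, mul_assoc] at h1
    omega

theorem exists_isSplitSystem {n : ℕ} (hn : 2 ≤ n) : ∃ F, IsSplitSystem n F := by
  have h : (splitSystems n).Nonempty := by
    rw [← Finset.card_pos, card_splitSystems hn]
    exact Nat.doubleFactorial_pos _
  obtain ⟨F, hF⟩ := h
  exact ⟨F, mem_splitSystems.1 hF⟩

/-! ### The child relation of a split system -/

/-- `A` is one of the two parts into which `B` is divided by `F`. -/
def IsChild (F : Finset (Finset ℕ)) (A B : Finset ℕ) : Prop :=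
  ∃ C ∈ F, Disjoint A C ∧ A ∪ C = B

theorem IsChild.subset {F : Finset (Finset ℕ)} {A B : Finset ℕ} (h : IsChild F A B) : A ⊆ B := by
  obtain ⟨C, -, -, rfl⟩ := h
  exact Finset.subset_union_left

theorem Icc_sdiff_card_eq_one {n : ℕ} {A : Finset ℕ} (hA : A ⊆ Finset.Icc 1 n) :
    (Finset.Icc 1 n \ A).card = 1 ↔ ∃ j ∈ Finset.Icc 1 n, A = (Finset.Icc 1 n).erase j := by
  rw [Finset.card_eq_one]
  constructor
  · rintro ⟨j, hj⟩
    refine ⟨j, ?_, ?_⟩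
    · have : j ∈ Finset.Icc 1 n \ A := by simp [hj]
      exact (Finset.mem_sdiff.1 this).1
    · rw [← Finset.sdiff_singleton_eq_erase, ← hj, Finset.sdiff_sdiff_eq_self hA]
  · rintro ⟨j, hj, rfl⟩
    refine ⟨j, ?_⟩
    rw [← Finset.sdiff_singleton_eq_erase, Finset.sdiff_sdiff_eq_self (by simpa using hj)]

namespace SplitProps

variable {n : ℕ} {F : Finset (Finset ℕ)}

theorem ssubset_of_isChild (h : SplitProps n F) {A B : Finset ℕ} (hAB : IsChild F A B) :
    A ⊂ B := by
  refine ⟨hAB.subset, fun h1 => ?_⟩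
  obtain ⟨C, hC, hd, rfl⟩ := hAB
  obtain ⟨x, hx⟩ := h.nonempty C hC
  exact Finset.disjoint_right.1 hd hx (h1 (Finset.mem_union_right _ hx))

theorem exists_isChild_of_ssubset (h : SplitProps n F) {A B : Finset ℕ} (hA : A ∈ F) (hB : B ∈ F)
    (hAB : A ⊂ B) : ∃ C ∈ F, IsChild F C B ∧ A ⊆ C := by
  have h1 : B.card ≠ 1 := by
    have := Finset.card_lt_card hAB
    have := Finset.card_pos.2 (h.nonempty A hA)
    omega
  obtain ⟨C, hC, D, hD, hd, hU⟩ := h.children B hB h1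
  rcases h.subset_child hB hC hD hA hU hAB.1 with h2 | h2 | h2
  · exact absurd h2 hAB.ne
  · exact ⟨C, hC, ⟨D, hD, hd, hU⟩, h2⟩
  · exact ⟨D, hD, ⟨C, hC, hd.symm, by rw [Finset.union_comm, hU]⟩, h2⟩

theorem eq_or_eq_of_isChild (h : SplitProps n F) {A B C D : Finset ℕ} (hA : A ∈ F) (hB : B ∈ F)
    (hC : C ∈ F) (hD : D ∈ F) (hd : Disjoint C D) (hU : C ∪ D = B) (hAB : IsChild F A B) :
    A = C ∨ A = D := by
  have key : ∀ E ∈ F, IsChild F E B → A ⊆ E → A = E := by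
    intro E hE hEB hAE
    have hss := h.ssubset_of_isChild hEB
    obtain ⟨A', hA', hd', hU'⟩ := hAB
    rcases h.subset_child hB hA hA' hE hU' hss.1 with h1 | h1 | h1
    · exact absurd h1 hss.ne
    · exact hAE.antisymm h1
    · obtain ⟨x, hx⟩ := h.nonempty A hA
      exact absurd (h1 (hAE hx)) (Finset.disjoint_left.1 hd' hx)
  have hss := h.ssubset_of_isChild hAB
  rcases h.subset_child hB hC hD hA hU hss.1 with h1 | h1 | h1
  · exact absurd h1 hss.ne
  · exact Or.inl (key C hC ⟨D, hD, hd, hU⟩ h1)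
  · exact Or.inr (key D hD ⟨C, hC, hd.symm, by rw [Finset.union_comm, hU]⟩ h1)

theorem isChild_parent_unique (h : SplitProps n F) {A B B' T : Finset ℕ} (hA : A ∈ F)
    (hB : B ∈ F) (hB' : B' ∈ F) (hT : T ∈ F) (hBT : B ⊆ T) (hBT' : B' ⊆ T) (h1 : IsChild F A B)
    (h2 : IsChild F A B') : B = B' := by
  have key : ∀ B ∈ F, ∀ B' ∈ F, IsChild F A B → IsChild F A B' → B ⊆ B' → B = B' := by
    intro B hB B' hB' h1 h2 h3
    have hss := h.ssubset_of_isChild h1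
    obtain ⟨C, hC, hd, hU⟩ := h2
    rcases h.subset_child hB' hA hC hB hU h3 with h4 | h4 | h4
    · exact h4
    · exact absurd h4 hss.2
    · obtain ⟨x, hx⟩ := h.nonempty A hA
      exact absurd (h4 (hss.1 hx)) (Finset.disjoint_left.1 hd hx)
  rcases h.compat B hB B' hB' with h3 | h3 | h3 | h3
  · exact key B hB B' hB' h1 h2 h3
  · exact (key B' hB' B hB h2 h1 h3).symm
  · obtain ⟨x, hx⟩ := h.nonempty A hA
    exact absurd (h2.subset hx) (Finset.disjoint_left.1 h3 (h1.subset hx))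
  · exact absurd (h3.trans (Finset.union_subset hBT hBT')) (h.not_Icc_subset hT)

theorem isChild_compl (h : SplitProps n F) {A B : Finset ℕ} (hB : B ∈ F) (h1 : IsChild F A B) :
    IsChild F (Finset.Icc 1 n \ B) (Finset.Icc 1 n \ A) := by
  have hBI := h.subset B hB
  obtain ⟨C, hC, hd, rfl⟩ := h1
  have hd' := Finset.disjoint_left.1 hd
  refine ⟨C, hC, ?_, ?_⟩
  · rw [Finset.disjoint_left]
    intro x hx hxC
    exact (Finset.mem_sdiff.1 hx).2 (Finset.mem_union_right _ hxC)
  · ext x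
    simp only [Finset.mem_union, Finset.mem_sdiff]
    constructor
    · rintro (⟨h2, h3⟩ | h2)
      · tauto
      · exact ⟨hBI (Finset.mem_union_right _ h2), fun h3 => hd' h3 h2⟩
    · tauto

theorem compl_compl (h : SplitProps n F) {A : Finset ℕ} (hA : A ∈ F) :
    Finset.Icc 1 n \ (Finset.Icc 1 n \ A) = A :=
  Finset.sdiff_sdiff_eq_self (h.subset A hA)

/-- Every side that is not of the form `{1, …, n} \ {j}` is a child of exactly two others. -/
theorem exists_parents (h : SplitProps n F) {A : Finset ℕ} (hA : A ∈ F)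
    (hA1 : (Finset.Icc 1 n \ A).card ≠ 1) : ∃ B ∈ F, ∃ C ∈ F, B ≠ C ∧
      ∀ D ∈ F, IsChild F A D ↔ D = B ∨ D = C := by
  obtain ⟨B, hB, C, hC, hd, hU⟩ := h.children _ (h.compl A hA) hA1
  refine ⟨_, h.compl B hB, _, h.compl C hC, ?_, ?_⟩
  · intro h1
    have h2 : B = C := by rw [← h.compl_compl hB, h1, h.compl_compl hC]
    subst h2
    obtain ⟨x, hx⟩ := h.nonempty B hB
    exact Finset.disjoint_left.1 hd hx hx
  · intro D hD
    constructor
    · intro h1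
      rcases h.eq_or_eq_of_isChild (h.compl D hD) (h.compl A hA) hB hC hd hU
        (h.isChild_compl hD h1) with h2 | h2
      · exact Or.inl (by rw [← h2, h.compl_compl hD])
      · exact Or.inr (by rw [← h2, h.compl_compl hD])
    · have key : ∀ E ∈ F, IsChild F E (Finset.Icc 1 n \ A) → IsChild F A (Finset.Icc 1 n \ E) := by
        intro E hE h1
        have := h.isChild_compl (h.compl A hA) h1
        rwa [h.compl_compl hA] at this
      rintro (rfl | rfl)
      · exact key B hB ⟨C, hC, hd, hU⟩
      · exact key C hC ⟨B, hB, hd.symm, by rw [Finset.union_comm, hU]⟩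

theorem not_isChild_of_compl (h : SplitProps n F) {A B : Finset ℕ} (hB : B ∈ F)
    (hA1 : (Finset.Icc 1 n \ A).card = 1) : ¬ IsChild F A B := by
  intro h1
  have h2 := Finset.card_lt_card (h.ssubset_of_isChild (h.isChild_compl hB h1))
  have h3 := Finset.card_pos.2 (h.nonempty _ (h.compl B hB))
  omega

theorem not_isChild_of_card (h : SplitProps n F) {A B : Finset ℕ} (hA : A ∈ F)
    (hB1 : B.card = 1) : ¬ IsChild F A B := by
  intro h1
  have h2 := Finset.card_lt_card (h.ssubset_of_isChild h1)
  have h3 := Finset.card_pos.2 (h.nonempty _ hA)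
  omega

end SplitProps

/-! ### General facts on graphs -/

namespace LGraph

theorem mem_nodes_E {G : LGraph} {a b : Node} :
    b ∈ (E a G).nodes ↔ b ∈ G.nodes ∧ G.Reach b a := by
  simp [E]

theorem mem_edges_E {G : LGraph} {a : Node} {e : Node × Node} :
    e ∈ (E a G).edges ↔ e ∈ G.edges ∧ G.Reach e.2 a := by
  simp [E]

theorem mem_nodes_L {G : LGraph} {a b : Node} :
    b ∈ (L a G).nodes ↔ b ∈ G.nodes ∧ G.Reach a b := by
  simp [L]

theorem mem_inEdges {G : LGraph} {a : Node} {e : Node × Node} :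
    e ∈ G.inEdges a ↔ e ∈ G.edges ∧ e.2 = a := Finset.mem_filter

theorem mem_outEdges {G : LGraph} {a : Node} {e : Node × Node} :
    e ∈ G.outEdges a ↔ e ∈ G.edges ∧ e.1 = a := Finset.mem_filter

theorem inEdges_E {G : LGraph} {a b : Node} (h : G.Reach b a) :
    (E a G).inEdges b = G.inEdges b := by
  ext e
  simp only [mem_inEdges, mem_edges_E]
  constructor
  · tauto
  · rintro ⟨h1, rfl⟩
    exact ⟨⟨h1, h⟩, rfl⟩

theorem reach_E_of_reach {G : LGraph} {a b c : Node} (hbc : G.Reach b c) (hca : G.Reach c a) :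
    (E a G).Reach b c := by
  refine Relation.ReflTransGen.head_induction_on hbc Relation.ReflTransGen.refl ?_
  intro d e h1 h2 h3
  exact Relation.ReflTransGen.head (mem_edges_E.2 ⟨h1, h2.trans hca⟩) h3

theorem Same.x_mem {G H : LGraph} (h : Same G H) (j : ℕ) :
    Node.x j ∈ G.nodes ↔ Node.x j ∈ H.nodes := by
  obtain ⟨σ, h1, -⟩ := h
  rw [h1, Finset.mem_image]
  constructor
  · exact fun h2 => ⟨_, h2, rfl⟩
  · rintro ⟨a, h2, h3⟩
    cases a <;> simp [Node.rename] at h3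
    exact h3 ▸ h2

theorem mem_X {n : ℕ} {a : Node} : a ∈ X n ↔ ∃ j ∈ Finset.Icc 1 n, Node.x j = a := by
  simp [X]

theorem mem_Y {n : ℕ} {a : Node} : a ∈ Y n ↔ ∃ j ∈ Finset.Icc 1 n, Node.y j = a := by
  simp [Y]

theorem x_mem_X {n j : ℕ} : Node.x j ∈ X n ↔ j ∈ Finset.Icc 1 n := by
  simp [X]

theorem y_mem_Y {n j : ℕ} : Node.y j ∈ Y n ↔ j ∈ Finset.Icc 1 n := by
  simp [Y]

theorem y_notMem_X {n j : ℕ} : Node.y j ∉ X n := by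
  simp [X]

/-! ### Graphs whose nodes are the members of a split system -/

/-- The nodes of `G` correspond, by means of `l`, to the members of `F`, and the edges of `G` to
the child relation. -/
structure Represents (n : ℕ) (F : Finset (Finset ℕ)) (l : Node → Finset ℕ) (G : LGraph) :
    Prop where
  maps : ∀ a ∈ G.nodes, l a ∈ F
  inj : ∀ a ∈ G.nodes, ∀ b ∈ G.nodes, l a = l b → a = b
  surj : ∀ A ∈ F, ∃ a ∈ G.nodes, l a = A
  x_iff : ∀ j, Node.x j ∈ G.nodes ↔ j ∈ Finset.Icc 1 n
  y_iff : ∀ j, Node.y j ∈ G.nodes ↔ j ∈ Finset.Icc 1 n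
  label_x : ∀ j ∈ Finset.Icc 1 n, l (Node.x j) = {j}
  label_y : ∀ j ∈ Finset.Icc 1 n, l (Node.y j) = (Finset.Icc 1 n).erase j
  edge : ∀ a ∈ G.nodes, ∀ b ∈ G.nodes, (a, b) ∈ G.edges ↔ IsChild F (l a) (l b)

namespace Represents

variable {n : ℕ} {F : Finset (Finset ℕ)} {l : Node → Finset ℕ} {G : LGraph}

theorem edge_spec (h : Represents n F l G) {a b : Node} (hab : (a, b) ∈ G.edges) :
    a ∈ G.nodes ∧ b ∈ G.nodes ∧ IsChild F (l a) (l b) := by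
  obtain ⟨h1, h2⟩ := G.edges_mem _ hab
  exact ⟨h1, h2, (h.edge a h1 b h2).1 hab⟩

theorem subset_of_reach (h : Represents n F l G) {a b : Node} (ha : a ∈ G.nodes)
    (hab : G.Reach a b) : b ∈ G.nodes ∧ l a ⊆ l b := by
  induction hab with
  | refl => exact ⟨ha, subset_rfl⟩
  | tail _ hbc ih =>
    obtain ⟨-, h2, h3⟩ := h.edge_spec hbc
    exact ⟨h2, ih.2.trans h3.subset⟩

theorem ssubset_of_transGen (h : Represents n F l G) (hF : SplitProps n F) {a b : Node}
    (hab : Relation.TransGen (fun v w => (v, w) ∈ G.edges) a b) : l a ⊂ l b := by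
  induction hab with
  | single hab => exact hF.ssubset_of_isChild (h.edge_spec hab).2.2
  | tail _ hbc ih => exact ih.trans (hF.ssubset_of_isChild (h.edge_spec hbc).2.2)

theorem reach_of_subset (h : Represents n F l G) (hF : SplitProps n F) {a : Node}
    (ha : a ∈ G.nodes) : ∀ k : ℕ, ∀ b ∈ G.nodes, (l b).card = k → l a ⊆ l b → G.Reach a b := by
  intro k
  induction k using Nat.strong_induction_on with
  | _ k ih =>
    intro b hb hk hab
    by_cases h1 : l a = l b
    · rw [h.inj a ha b hb h1]
      exact Relation.ReflTransGen.refl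
    · obtain ⟨C, hC, h2, h3⟩ := hF.exists_isChild_of_ssubset (h.maps a ha) (h.maps b hb)
        (Finset.ssubset_iff_subset_ne.2 ⟨hab, h1⟩)
      obtain ⟨c, hc, rfl⟩ := h.surj C hC
      have h4 := Finset.card_lt_card (hF.ssubset_of_isChild h2)
      exact Relation.ReflTransGen.tail (ih _ (hk ▸ h4) c hc rfl h3) ((h.edge c hc b hb).2 h2)

theorem reach_iff (h : Represents n F l G) (hF : SplitProps n F) {a b : Node}
    (ha : a ∈ G.nodes) (hb : b ∈ G.nodes) : G.Reach a b ↔ l a ⊆ l b :=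
  ⟨fun h1 => (h.subset_of_reach ha h1).2, h.reach_of_subset hF ha _ b hb rfl⟩

theorem x_mem_E (h : Represents n F l G) (hF : SplitProps n F) {a : Node} (ha : a ∈ G.nodes)
    {j : ℕ} (hj : j ∈ Finset.Icc 1 n) : Node.x j ∈ (E a G).nodes ↔ j ∈ l a := by
  have hx := (h.x_iff j).2 hj
  rw [mem_nodes_E, h.reach_iff hF hx ha, h.label_x j hj]
  simp [hx]

theorem y_mem_L (h : Represents n F l G) (hF : SplitProps n F) {a : Node} (ha : a ∈ G.nodes)
    {j : ℕ} (hj : j ∈ Finset.Icc 1 n) : Node.y j ∈ (L a G).nodes ↔ j ∉ l a := by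
  have hy := (h.y_iff j).2 hj
  rw [mem_nodes_L, h.reach_iff hF ha hy, h.label_y j hj, Finset.subset_erase]
  simp [hy, hF.subset _ (h.maps a ha)]

theorem card_nodes (h : Represents n F l G) : G.nodes.card = F.card := by
  have : F = G.nodes.image l := by
    ext A
    rw [Finset.mem_image]
    constructor
    · exact h.surj A
    · rintro ⟨a, ha, rfl⟩
      exact h.maps a ha
  rw [this, Finset.card_image_of_injOn (fun a ha b hb hab => h.inj a ha b hb hab)]

theorem mem_X_iff (h : Represents n F l G) (hF : SplitProps n F) {a : Node} (ha : a ∈ G.nodes) :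
    a ∈ X n ↔ (l a).card = 1 := by
  rw [mem_X]
  constructor
  · rintro ⟨j, hj, rfl⟩
    rw [h.label_x j hj, Finset.card_singleton]
  · intro h1
    obtain ⟨j, hj⟩ := Finset.card_eq_one.1 h1
    have h2 := hF.subset _ (h.maps a ha)
    rw [hj, Finset.singleton_subset_iff] at h2
    exact ⟨j, h2, h.inj _ ((h.x_iff j).2 h2) a ha (by rw [h.label_x j h2, hj])⟩

theorem inEdges_card_zero (h : Represents n F l G) (hF : SplitProps n F) {a : Node}
    (h1 : (l a).card = 1) : (G.inEdges a).card = 0 := by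
  rw [Finset.card_eq_zero, Finset.eq_empty_iff_forall_notMem]
  rintro ⟨b, c⟩ h2
  obtain ⟨h5, h3⟩ := mem_inEdges.1 h2
  simp only at h3
  subst h3
  obtain ⟨h3, -, h4⟩ := h.edge_spec h5
  exact hF.not_isChild_of_card (h.maps b h3) h1 h4

theorem inEdges_card_two (h : Represents n F l G) (hF : SplitProps n F) {a : Node}
    (ha : a ∈ G.nodes) (h1 : (l a).card ≠ 1) : (G.inEdges a).card = 2 := by
  obtain ⟨B, hB, C, hC, hd, hU⟩ := hF.children _ (h.maps a ha) h1
  obtain ⟨b, hb, rfl⟩ := h.surj B hB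
  obtain ⟨c, hc, rfl⟩ := h.surj C hC
  have hbc : b ≠ c := by
    rintro rfl
    obtain ⟨x, hx⟩ := hF.nonempty _ hB
    exact Finset.disjoint_left.1 hd hx hx
  have : G.inEdges a = {(b, a), (c, a)} := by
    ext ⟨d, e⟩
    simp only [mem_inEdges, Finset.mem_insert, Finset.mem_singleton, Prod.mk.injEq]
    constructor
    · rintro ⟨h2, rfl⟩
      obtain ⟨hd', -, h3⟩ := h.edge_spec h2
      rcases hF.eq_or_eq_of_isChild (h.maps d hd') (h.maps _ ha) hB hC hd hU h3 with h4 | h4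
      · exact Or.inl ⟨h.inj _ hd' _ hb h4, rfl⟩
      · exact Or.inr ⟨h.inj _ hd' _ hc h4, rfl⟩
    · rintro (⟨rfl, rfl⟩ | ⟨rfl, rfl⟩)
      · exact ⟨(h.edge _ hb _ ha).2 ⟨_, hC, hd, hU⟩, rfl⟩
      · exact ⟨(h.edge _ hc _ ha).2 ⟨_, hB, hd.symm, by rw [Finset.union_comm, hU]⟩, rfl⟩
  rw [this, Finset.card_pair (by simp [hbc])]

theorem outEdges_card_zero (h : Represents n F l G) (hF : SplitProps n F) {a : Node}
    (h1 : (Finset.Icc 1 n \ l a).card = 1) : (G.outEdges a).card = 0 := by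
  rw [Finset.card_eq_zero, Finset.eq_empty_iff_forall_notMem]
  rintro ⟨b, c⟩ h2
  obtain ⟨h5, h3⟩ := mem_outEdges.1 h2
  simp only at h3
  subst h3
  obtain ⟨-, h3, h4⟩ := h.edge_spec h5
  exact hF.not_isChild_of_compl (h.maps _ h3) h1 h4

theorem outEdges_card_two (h : Represents n F l G) (hF : SplitProps n F) {a : Node}
    (ha : a ∈ G.nodes) (h1 : (Finset.Icc 1 n \ l a).card ≠ 1) : (G.outEdges a).card = 2 := by
  obtain ⟨B, hB, C, hC, hne, hD⟩ := hF.exists_parents (h.maps a ha) h1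
  obtain ⟨b, hb, rfl⟩ := h.surj B hB
  obtain ⟨c, hc, rfl⟩ := h.surj C hC
  have hbc : b ≠ c := fun h2 => hne (by rw [h2])
  have : G.outEdges a = {(a, b), (a, c)} := by
    ext ⟨d, e⟩
    simp only [mem_outEdges, Finset.mem_insert, Finset.mem_singleton, Prod.mk.injEq]
    constructor
    · rintro ⟨h2, rfl⟩
      obtain ⟨-, he, h3⟩ := h.edge_spec h2
      rcases (hD _ (h.maps e he)).1 h3 with h4 | h4
      · exact Or.inl ⟨rfl, h.inj _ he _ hb h4⟩
      · exact Or.inr ⟨rfl, h.inj _ he _ hc h4⟩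
    · rintro (⟨rfl, rfl⟩ | ⟨rfl, rfl⟩)
      · exact ⟨(h.edge _ ha _ hb).2 ((hD _ hB).2 (Or.inl rfl)), rfl⟩
      · exact ⟨(h.edge _ ha _ hc).2 ((hD _ hC).2 (Or.inr rfl)), rfl⟩
  rw [this, Finset.card_pair (by simp [hbc])]

theorem isDBT (h : Represents n F l G) (hF : SplitProps n F) {a : Node} (ha : a ∈ G.nodes) :
    (E a G).IsDBT a where
  root_mem := mem_nodes_E.2 ⟨ha, Relation.ReflTransGen.refl⟩
  root_out := by
    rw [Finset.card_eq_zero, Finset.eq_empty_iff_forall_notMem]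
    rintro ⟨b, c⟩ h1
    obtain ⟨h4, h2⟩ := mem_outEdges.1 h1
    obtain ⟨h6, h3⟩ := mem_edges_E.1 h4
    simp only at h2 h3
    subst h2
    obtain ⟨-, hc, h5⟩ := h.edge_spec h6
    exact (hF.ssubset_of_isChild h5).2 (h.subset_of_reach hc h3).2
  parent := by
    intro b hb hba
    obtain ⟨hb, h1⟩ := mem_nodes_E.1 hb
    rcases Relation.ReflTransGen.cases_head h1 with h2 | ⟨c, h2, h3⟩
    · exact absurd h2 hba
    rw [Finset.card_eq_one]
    refine ⟨(b, c), ?_⟩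
    ext ⟨d, e⟩
    simp only [mem_outEdges, mem_edges_E, Finset.mem_singleton, Prod.mk.injEq]
    constructor
    · rintro ⟨⟨h4, h5⟩, rfl⟩
      obtain ⟨-, he, h6⟩ := h.edge_spec h4
      obtain ⟨-, hc, h7⟩ := h.edge_spec h2
      exact ⟨rfl, h.inj _ he _ hc (hF.isChild_parent_unique (h.maps _ hb) (h.maps _ he)
        (h.maps _ hc) (h.maps _ ha) (h.subset_of_reach he h5).2 (h.subset_of_reach hc h3).2 h6 h7)⟩
    · rintro ⟨rfl, rfl⟩
      exact ⟨⟨h2, h3⟩, rfl⟩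
  reach := fun b hb => reach_E_of_reach (mem_nodes_E.1 hb).2 Relation.ReflTransGen.refl
  children := by
    intro b hb
    obtain ⟨hb, h1⟩ := mem_nodes_E.1 hb
    rw [inEdges_E h1]
    by_cases h2 : (l b).card = 1
    · exact Or.inl (h.inEdges_card_zero hF h2)
    · exact Or.inr (h.inEdges_card_two hF hb h2)

theorem input_iff (h : Represents n F l G) (hF : SplitProps n F) {a : Node} (ha : a ∈ G.nodes) :
    a ∈ X n ↔ (G.inEdges a).card = 0 := by
  rw [h.mem_X_iff hF ha]
  constructor
  · exact h.inEdges_card_zero hF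
  · intro h1
    by_contra h2
    rw [h.inEdges_card_two hF ha h2] at h1
    omega

theorem isStructure (h : Represents n F l G) (hF : SplitProps n F) : G.IsStructure n where
  label_x := fun j hj => x_mem_X.2 ((h.x_iff j).1 hj)
  label_y := fun j hj => y_mem_Y.2 ((h.y_iff j).1 hj)
  acyclic := fun a ha => (h.ssubset_of_transGen hF ha).ne rfl
  input_iff := fun a ha => h.input_iff hF ha
  subtree := fun a ha => h.isDBT hF ha
  subtree_ne := by
    intro a ha b hb hab h1
    apply hab
    apply h.inj a ha b hb
    ext j
    by_cases hj : j ∈ Finset.Icc 1 n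
    · rw [← h.x_mem_E hF ha hj, ← h.x_mem_E hF hb hj, h1.x_mem j]
    · exact ⟨fun h2 => absurd (hF.subset _ (h.maps a ha) h2) hj,
        fun h2 => absurd (hF.subset _ (h.maps b hb) h2) hj⟩

theorem outEdges_card_eq_zero_iff (h : Represents n F l G) (hF : SplitProps n F) {a : Node}
    (ha : a ∈ G.nodes) : (G.outEdges a).card = 0 ↔ a ∈ Y n := by
  have h1 : (G.outEdges a).card = 0 ↔ (Finset.Icc 1 n \ l a).card = 1 := by
    constructor
    · intro h1
      by_contra h2
      rw [h.outEdges_card_two hF ha h2] at h1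
      omega
    · exact h.outEdges_card_zero hF
  rw [h1, Icc_sdiff_card_eq_one (hF.subset _ (h.maps a ha)), mem_Y]
  constructor
  · rintro ⟨j, hj, h2⟩
    exact ⟨j, hj, h.inj _ ((h.y_iff j).2 hj) _ ha (by rw [h2, h.label_y j hj])⟩
  · rintro ⟨j, hj, rfl⟩
    exact ⟨j, hj, h.label_y j hj⟩

theorem outputNodes_eq (h : Represents n F l G) (hF : SplitProps n F) :
    G.outputNodes n = Y n := by
  ext a
  simp only [outputNodes, compNodes, Finset.mem_filter]
  constructor
  · rintro ⟨⟨h1, -⟩, h2⟩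
    exact (h.outEdges_card_eq_zero_iff hF h1).1 h2
  · intro h1
    obtain ⟨j, hj, rfl⟩ := mem_Y.1 h1
    have h2 := (h.y_iff j).2 hj
    exact ⟨⟨h2, y_notMem_X⟩, (h.outEdges_card_eq_zero_iff hF h2).2 h1⟩

theorem isStructureFor (h : Represents n F l G) (hF : SplitProps n F) : G.IsStructureFor n where
  toIsStructure := h.isStructure hF
  outputs := h.outputNodes_eq hF
  leaves_eq := by
    intro j hj
    have hy := (h.y_iff j).2 hj
    ext a
    simp only [leaves, Finset.mem_filter, Finset.mem_erase, mem_nodes_E]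
    constructor
    · rintro ⟨⟨h1, h2⟩, h3⟩
      rw [inEdges_E h2, ← h.input_iff hF h1] at h3
      refine ⟨?_, h3⟩
      rintro rfl
      have h4 := (h.subset_of_reach h1 h2).2
      rw [h.label_x j hj, h.label_y j hj] at h4
      simp at h4
    · rintro ⟨h1, h2⟩
      obtain ⟨i, hi, rfl⟩ := mem_X.1 h2
      have hx := (h.x_iff i).2 hi
      have h3 : G.Reach (Node.x i) (Node.y j) := by
        rw [h.reach_iff hF hx hy, h.label_x i hi, h.label_y j hj, Finset.singleton_subset_iff,
          Finset.mem_erase]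
        exact ⟨fun h4 => h1 (by rw [h4]), hi⟩
      refine ⟨⟨hx, h3⟩, ?_⟩
      rw [inEdges_E h3, ← h.input_iff hF hx]
      exact h2

theorem complexity_eq (h : Represents n F l G) (hF : SplitProps n F) :
    G.complexity n + 6 = 3 * n := by
  have h1 : G.compNodes n = G.nodes \ X n := by
    ext a
    simp [compNodes]
  have h2 : X n ⊆ G.nodes := by
    intro a ha
    obtain ⟨j, hj, rfl⟩ := mem_X.1 ha
    exact (h.x_iff j).2 hj
  have h3 : (X n).card = n := by
    rw [X, Finset.card_image_of_injective _ (fun i j hij => by simpa using hij)]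
    simp
  have h4 := Finset.card_sdiff_add_card_eq_card h2
  have h5 := hF.card
  rw [h.card_nodes, h3] at h4
  rw [complexity, h1]
  omega

end Represents

/-- The inputs on which the node `a` depends. -/
noncomputable def inputSet (n : ℕ) (G : LGraph) (a : Node) : Finset ℕ :=
  (Finset.Icc 1 n).filter (fun j => Node.x j ∈ (E a G).nodes)

theorem mem_inputSet {n : ℕ} {G : LGraph} {a : Node} {j : ℕ} :
    j ∈ inputSet n G a ↔ j ∈ Finset.Icc 1 n ∧ Node.x j ∈ (E a G).nodes := Finset.mem_filter

namespace Represents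

variable {n : ℕ} {F : Finset (Finset ℕ)} {l : Node → Finset ℕ} {G : LGraph}

theorem inputSet_eq (h : Represents n F l G) (hF : SplitProps n F) {a : Node}
    (ha : a ∈ G.nodes) : inputSet n G a = l a := by
  ext j
  rw [mem_inputSet]
  constructor
  · rintro ⟨h1, h2⟩
    exact (h.x_mem_E hF ha h1).1 h2
  · intro h1
    have h2 := hF.subset _ (h.maps a ha) h1
    exact ⟨h2, (h.x_mem_E hF ha h2).2 h1⟩

theorem isComplementPair_iff (h : Represents n F l G) (hF : SplitProps n F) {a b : Node} :
    G.IsComplementPair n a b ↔ a ∈ G.nodes ∧ b ∈ G.nodes ∧ IsEdge n F (l a) (l b) := by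
  unfold IsComplementPair
  refine and_congr_right fun ha => and_congr_right fun hb => ?_
  have key : (∀ j ∈ Finset.Icc 1 n, Node.x j ∈ (E a G).nodes ↔ Node.x j ∉ (E b G).nodes) ↔
      ∀ j ∈ Finset.Icc 1 n, (j ∈ l a ↔ j ∉ l b) :=
    forall₂_congr fun j hj => by rw [h.x_mem_E hF ha hj, h.x_mem_E hF hb hj]
  rw [key]
  have ha' := hF.subset _ (h.maps a ha)
  have hb' := hF.subset _ (h.maps b hb)
  constructor
  · intro h1
    refine ⟨h.maps a ha, h.maps b hb, ?_, ?_⟩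
    · rw [Finset.disjoint_left]
      exact fun j hj => (h1 j (ha' hj)).1 hj
    · apply (Finset.union_subset ha' hb').antisymm
      intro j hj
      rw [Finset.mem_union]
      have := h1 j hj
      tauto
  · intro e j hj
    have h1 : j ∈ l a → j ∉ l b := fun h2 => Finset.disjoint_left.1 e.disj h2
    rw [← e.union, Finset.mem_union] at hj
    tauto

theorem existsUnique_complement (h : Represents n F l G) (hF : SplitProps n F) {a : Node}
    (ha : a ∈ G.nodes) : ∃! b, b ∈ G.nodes ∧ G.IsComplementPair n a b := by
  have e := hF.isEdge_compl (h.maps a ha)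
  obtain ⟨b, hb, hb'⟩ := h.surj _ e.right
  refine ⟨b, ⟨hb, (h.isComplementPair_iff hF).2 ⟨ha, hb, by rwa [hb']⟩⟩, ?_⟩
  rintro c ⟨hc, hac⟩
  have h1 := ((h.isComplementPair_iff hF).1 hac).2.2.right_eq
  exact h.inj c hc b hb (by rw [h1, hb'])

theorem exists_perm_extension (K : Finset ℕ) (f : ℕ → ℕ) (hf : Set.InjOn f K) :
    ∃ σ : Equiv.Perm ℕ, ∀ k ∈ K, σ k = f k := by
  have := Equiv.Perm.isMultiplyPretransitive ℕ K.card
  let e : Fin K.card ↪ ℕ := ⟨fun i => K.equivFin.symm i, fun i j hij => by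
    simpa [Subtype.ext_iff] using hij⟩
  let e' : Fin K.card ↪ ℕ := ⟨fun i => f (K.equivFin.symm i), fun i j hij => by
    have := hf (K.equivFin.symm i).2 (K.equivFin.symm j).2 hij
    simpa [Subtype.ext_iff] using this⟩
  obtain ⟨σ, hσ⟩ := MulAction.exists_smul_eq (Equiv.Perm ℕ) e e'
  refine ⟨σ, fun k hk => ?_⟩
  have := DFunLike.congr_fun hσ (K.equivFin ⟨k, hk⟩)
  change σ (K.equivFin.symm (K.equivFin ⟨k, hk⟩)) = f (K.equivFin.symm (K.equivFin ⟨k, hk⟩)) at this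
  rwa [Equiv.symm_apply_apply] at this

theorem same {l' : Node → Finset ℕ} {G' : LGraph} (h : Represents n F l G)
    (h' : Represents n F l' G') : Same G G' := by
  have h1 : ∀ a ∈ G.nodes, ∃ b ∈ G'.nodes, l' b = l a := fun a ha => h'.surj _ (h.maps a ha)
  have hu : ∀ k, ∃ i, Node.u k ∈ G.nodes → Node.u i ∈ G'.nodes ∧ l' (Node.u i) = l (Node.u k) := by
    intro k
    by_cases hk : Node.u k ∈ G.nodes
    · obtain ⟨b, hb, hbk⟩ := h1 _ hk
      cases b with
      | x j =>
        have hj := (h'.x_iff j).1 hb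
        have := h.inj _ hk _ ((h.x_iff j).2 hj) (by rw [← hbk, h.label_x j hj, h'.label_x j hj])
        simp at this
      | y j =>
        have hj := (h'.y_iff j).1 hb
        have := h.inj _ hk _ ((h.y_iff j).2 hj) (by rw [← hbk, h.label_y j hj, h'.label_y j hj])
        simp at this
      | u i => exact ⟨i, fun _ => ⟨hb, hbk⟩⟩
    · exact ⟨0, fun h => absurd h hk⟩
  choose f hf using hu
  obtain ⟨σ, hσ⟩ := exists_perm_extension
    ((G.nodes.image Node.index).filter (fun k => Node.u k ∈ G.nodes)) f (by
      intro i hi j hj hij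
      have hi' := (Finset.mem_filter.1 hi).2
      have hj' := (Finset.mem_filter.1 hj).2
      have := h.inj _ hi' _ hj' (by rw [← (hf i hi').2, ← (hf j hj').2, hij])
      simpa using this)
  have hr : ∀ a ∈ G.nodes, Node.rename σ a ∈ G'.nodes ∧ l' (Node.rename σ a) = l a := by
    intro a ha
    cases a with
    | x j =>
      have hj := (h.x_iff j).1 ha
      exact ⟨(h'.x_iff j).2 hj, by
        simp only [Node.rename]; rw [h.label_x j hj, h'.label_x j hj]⟩
    | y j =>
      have hj := (h.y_iff j).1 ha
      exact ⟨(h'.y_iff j).2 hj, by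
        simp only [Node.rename]; rw [h.label_y j hj, h'.label_y j hj]⟩
    | u k =>
      have hk := hσ k (Finset.mem_filter.2 ⟨Finset.mem_image.2 ⟨_, ha, rfl⟩, ha⟩)
      simp only [Node.rename]
      rw [hk]
      exact hf k ha
  have hs : ∀ b ∈ G'.nodes, ∃ a ∈ G.nodes, Node.rename σ a = b := by
    intro b hb
    obtain ⟨a, ha, hab⟩ := h.surj _ (h'.maps b hb)
    exact ⟨a, ha, h'.inj _ (hr a ha).1 _ hb (by rw [(hr a ha).2, hab])⟩
  refine ⟨σ, ?_, ?_⟩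
  · ext b
    rw [Finset.mem_image]
    constructor
    · exact hs b
    · rintro ⟨a, ha, rfl⟩
      exact (hr a ha).1
  · ext ⟨b, c⟩
    simp only [Finset.mem_image, Prod.map, Prod.mk.injEq, Prod.exists]
    constructor
    · intro hbc
      obtain ⟨hb, hc, h2⟩ := h'.edge_spec hbc
      obtain ⟨b', hb', rfl⟩ := hs b hb
      obtain ⟨c', hc', rfl⟩ := hs c hc
      rw [(hr _ hb').2, (hr _ hc').2] at h2
      exact ⟨b', c', (h.edge _ hb' _ hc').2 h2, rfl, rfl⟩
    · rintro ⟨b', c', h2, rfl, rfl⟩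
      obtain ⟨hb', hc', h3⟩ := h.edge_spec h2
      rw [h'.edge _ (hr _ hb').1 _ (hr _ hc').1, (hr _ hb').2, (hr _ hc').2]
      exact h3

end Represents

/-! ### A graph for each split system -/

/-- A name for the node that represents the side `A`. -/
noncomputable def nodeOf (n : ℕ) (A : Finset ℕ) : Node :=
  if A.card = 1 then Node.x (∑ i ∈ A, i)
  else if (Finset.Icc 1 n \ A).card = 1 then Node.y (∑ i ∈ Finset.Icc 1 n \ A, i)
  else Node.u (Encodable.encode A)

/-- The side represented by a node. -/
noncomputable def sideOf (n : ℕ) : Node → Finset ℕ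
  | .x j => {j}
  | .y j => (Finset.Icc 1 n).erase j
  | .u k => (Encodable.decode k).getD ∅

theorem sideOf_nodeOf {n : ℕ} {A : Finset ℕ} (hA : A ⊆ Finset.Icc 1 n) :
    sideOf n (nodeOf n A) = A := by
  unfold nodeOf
  split_ifs with h1 h2
  · obtain ⟨j, rfl⟩ := Finset.card_eq_one.1 h1
    simp [sideOf]
  · obtain ⟨j, hj⟩ := Finset.card_eq_one.1 h2
    rw [hj, Finset.sum_singleton, sideOf, ← Finset.sdiff_singleton_eq_erase, ← hj,
      Finset.sdiff_sdiff_eq_self hA]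
  · simp [sideOf]

open Classical in
/-- The graph with one node for each member of `F`, the edges being given by the child relation. -/
noncomputable def realize (n : ℕ) (F : Finset (Finset ℕ)) : LGraph where
  nodes := F.image (nodeOf n)
  edges := ((F ×ˢ F).filter (fun p => IsChild F p.1 p.2)).image (Prod.map (nodeOf n) (nodeOf n))
  edges_mem := by
    intro e he
    obtain ⟨p, hp, rfl⟩ := Finset.mem_image.1 he
    have h := Finset.mem_product.1 (Finset.mem_filter.1 hp).1
    exact ⟨Finset.mem_image_of_mem _ h.1, Finset.mem_image_of_mem _ h.2⟩

theorem realize_represents {n : ℕ} {F : Finset (Finset ℕ)} (hn : 3 ≤ n) (hF : SplitProps n F) :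
    Represents n F (sideOf n) (realize n F) := by
  have key : ∀ A ∈ F, sideOf n (nodeOf n A) = A := fun A hA => sideOf_nodeOf (hF.subset A hA)
  have hnodes : ∀ a, a ∈ (realize n F).nodes ↔ ∃ A ∈ F, nodeOf n A = a := fun a => by
    simp [realize]
  have hx : ∀ j, nodeOf n {j} = Node.x j := fun j => by simp [nodeOf]
  have hy : ∀ j ∈ Finset.Icc 1 n, nodeOf n ((Finset.Icc 1 n).erase j) = Node.y j := by
    intro j hj
    have h1 : ((Finset.Icc 1 n).erase j).card ≠ 1 := by
      rw [Finset.card_erase_of_mem hj]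
      simp
      omega
    have h2 : Finset.Icc 1 n \ (Finset.Icc 1 n).erase j = {j} := by
      rw [← Finset.sdiff_singleton_eq_erase, Finset.sdiff_sdiff_eq_self (by simpa using hj)]
    rw [nodeOf, if_neg h1, h2, if_pos (by simp), Finset.sum_singleton]
  refine ⟨?_, ?_, ?_, ?_, ?_, fun _ _ => rfl, fun _ _ => rfl, ?_⟩
  · intro a ha
    obtain ⟨A, hA, rfl⟩ := (hnodes a).1 ha
    rwa [key A hA]
  · intro a ha b hb hab
    obtain ⟨A, hA, rfl⟩ := (hnodes a).1 ha
    obtain ⟨B, hB, rfl⟩ := (hnodes b).1 hb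
    rw [key A hA, key B hB] at hab
    rw [hab]
  · intro A hA
    exact ⟨_, (hnodes _).2 ⟨A, hA, rfl⟩, key A hA⟩
  · intro j
    rw [hnodes]
    constructor
    · rintro ⟨A, hA, h1⟩
      have h2 := key A hA
      rw [h1] at h2
      have h3 := hF.subset A hA
      rw [← h2] at h3
      simpa [sideOf] using h3
    · intro hj
      exact ⟨_, hF.singleton j hj, hx j⟩
  · intro j
    rw [hnodes]
    constructor
    · rintro ⟨A, hA, h1⟩
      have h2 := key A hA
      rw [h1] at h2
      by_contra h3
      apply hF.not_Icc_subset hA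
      rw [← h2, sideOf, Finset.erase_eq_of_notMem h3]
    · intro hj
      refine ⟨_, ?_, hy j hj⟩
      rw [← Finset.sdiff_singleton_eq_erase]
      exact hF.compl _ (hF.singleton j hj)
  · intro a ha b hb
    obtain ⟨A, hA, rfl⟩ := (hnodes a).1 ha
    obtain ⟨B, hB, rfl⟩ := (hnodes b).1 hb
    rw [key A hA, key B hB]
    simp only [realize, Finset.mem_image, Finset.mem_filter, Finset.mem_product, Prod.map,
      Prod.mk.injEq, Prod.exists]
    constructor
    · rintro ⟨A', B', ⟨⟨hA', hB'⟩, h1⟩, h2, h3⟩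
      have h4 := key A' hA'
      have h5 := key B' hB'
      rw [h2, key A hA] at h4
      rw [h3, key B hB] at h5
      rwa [h4, h5]
    · intro h1
      exact ⟨A, B, ⟨⟨hA, hB⟩, h1⟩, rfl, rfl⟩

/-! ### The cluster system of a structure -/

theorem reach_of_reach_E {G : LGraph} {a b c : Node} (h : (E a G).Reach b c) : G.Reach b c :=
  Relation.ReflTransGen.mono (fun v w (h1 : (v, w) ∈ (E a G).edges) => (mem_edges_E.1 h1).1) _ _ h

theorem reach_iff_of_no_inEdges {G : LGraph} {a b : Node} (h : (G.inEdges a).card = 0) :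
    G.Reach b a ↔ b = a := by
  constructor
  · intro h1
    rcases Relation.ReflTransGen.cases_tail h1 with h2 | ⟨c, -, h2⟩
    · exact h2.symm
    · have : (c, a) ∈ G.inEdges a := mem_inEdges.2 ⟨h2, rfl⟩
      rw [Finset.card_eq_zero.1 h] at this
      simp at this
  · rintro rfl
    exact Relation.ReflTransGen.refl

namespace IsDBT

theorem rightUnique {T : LGraph} {r : Node} (h : T.IsDBT r) :
    Relator.RightUnique (fun v w => (v, w) ∈ T.edges) := by
  intro a b c hab hac
  have hb : (a, b) ∈ T.outEdges a := mem_outEdges.2 ⟨hab, rfl⟩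
  have hc : (a, c) ∈ T.outEdges a := mem_outEdges.2 ⟨hac, rfl⟩
  have har : a ≠ r := by
    rintro rfl
    rw [Finset.card_eq_zero.1 h.root_out] at hb
    simp at hb
  obtain ⟨e, he⟩ := Finset.card_eq_one.1 (h.parent a (T.edges_mem _ hab).1 har)
  rw [he, Finset.mem_singleton] at hb hc
  have := hb.trans hc.symm
  simpa using this

end IsDBT

namespace IsStructure

variable {n : ℕ} {S : LGraph}

theorem inputSet_x (h : S.IsStructure n) {j : ℕ} (hj : Node.x j ∈ S.nodes) :
    inputSet n S (Node.x j) = {j} := by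
  have hX := h.label_x j hj
  have h0 := (h.input_iff _ hj).1 hX
  ext i
  rw [mem_inputSet, mem_nodes_E, reach_iff_of_no_inEdges h0, Finset.mem_singleton]
  constructor
  · rintro ⟨-, -, h1⟩
    simpa using h1
  · rintro rfl
    exact ⟨x_mem_X.1 hX, hj, rfl⟩

theorem reach_cases {a c d : Node} (hcd : ∀ e, (e, a) ∈ S.edges ↔ e = c ∨ e = d) {b : Node} :
    S.Reach b a ↔ b = a ∨ S.Reach b c ∨ S.Reach b d := by
  constructor
  · intro h1
    rcases Relation.ReflTransGen.cases_tail h1 with h2 | ⟨e, h2, h3⟩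
    · exact Or.inl h2.symm
    · rcases (hcd e).1 h3 with rfl | rfl
      · exact Or.inr (Or.inl h2)
      · exact Or.inr (Or.inr h2)
  · rintro (rfl | h1 | h1)
    · exact Relation.ReflTransGen.refl
    · exact h1.tail ((hcd c).2 (Or.inl rfl))
    · exact h1.tail ((hcd d).2 (Or.inr rfl))

theorem not_reach_sibling (h : S.IsStructure n) {a c d : Node} (hca : (c, a) ∈ S.edges)
    (hda : (d, a) ∈ S.edges) (hcd : c ≠ d) : ¬ (E a S).Reach c d := by
  intro h1
  rcases Relation.ReflTransGen.cases_head h1 with h2 | ⟨e, h2, h3⟩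
  · exact hcd h2
  · have ha := (S.edges_mem _ hca).2
    have h4 : (c, a) ∈ (E a S).edges := mem_edges_E.2 ⟨hca, Relation.ReflTransGen.refl⟩
    obtain rfl : e = a := (h.subtree a ha).rightUnique h2 h4
    exact h.acyclic _ (Relation.TransGen.tail' (reach_of_reach_E h3) hda)

theorem exists_children (h : S.IsStructure n) {a : Node} (ha : a ∈ S.nodes) (haX : a ∉ X n) :
    ∃ c d, (∀ e, (e, a) ∈ S.edges ↔ e = c ∨ e = d) ∧
      Disjoint (inputSet n S c) (inputSet n S d) ∧
      inputSet n S c ∪ inputSet n S d = inputSet n S a := by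
  have h0 : (S.inEdges a).card ≠ 0 := fun h1 => haX ((h.input_iff a ha).2 h1)
  have h2 := (h.subtree a ha).children a (h.subtree a ha).root_mem
  rw [inEdges_E Relation.ReflTransGen.refl] at h2
  obtain ⟨⟨c, a1⟩, ⟨d, a2⟩, hne, h3⟩ := Finset.card_eq_two.1 (h2.resolve_left h0)
  have hc' : (c, a1) ∈ S.inEdges a := by rw [h3]; simp
  have hd' : (d, a2) ∈ S.inEdges a := by rw [h3]; simp
  obtain ⟨hc, rfl⟩ := mem_inEdges.1 hc'
  obtain ⟨hd, h4⟩ := mem_inEdges.1 hd'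
  simp only at ha h4 hd hc h3 haX
  subst h4
  have hcd : c ≠ d := fun h4 => hne (by rw [h4])
  have hiff : ∀ e, (e, a2) ∈ S.edges ↔ e = c ∨ e = d := by
    intro e
    have : (e, a2) ∈ S.edges ↔ (e, a2) ∈ S.inEdges a2 := by simp [mem_inEdges]
    rw [this, h3]
    simp
  refine ⟨c, d, hiff, ?_, ?_⟩
  · rw [Finset.disjoint_left]
    intro j hj1 hj2
    have h5 := (mem_nodes_E.1 (mem_inputSet.1 hj1).2).2
    have h6 := (mem_nodes_E.1 (mem_inputSet.1 hj2).2).2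
    rcases Relation.ReflTransGen.total_of_right_unique (h.subtree a2 ha).rightUnique
      (reach_E_of_reach h5 (Relation.ReflTransGen.single hc))
      (reach_E_of_reach h6 (Relation.ReflTransGen.single hd)) with h7 | h7
    · exact h.not_reach_sibling hc hd hcd h7
    · exact h.not_reach_sibling hd hc hcd.symm h7
  · ext j
    simp only [Finset.mem_union, mem_inputSet, mem_nodes_E]
    rw [reach_cases hiff]
    have : Node.x j ∈ S.nodes → Node.x j ≠ a2 := by
      rintro h5 rfl
      exact haX (h.label_x j h5)
    tauto

theorem isHierarchy (h : S.IsStructure n) (k : ℕ) : ∀ a ∈ S.nodes, (E a S).nodes.card = k →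
    IsHierarchy ((E a S).nodes.image (inputSet n S)) (inputSet n S a) := by
  induction k using Nat.strong_induction_on with
  | _ k ih =>
    intro a ha hk
    by_cases haX : a ∈ X n
    · obtain ⟨j, hj, rfl⟩ := mem_X.1 haX
      have h0 := (h.input_iff _ ha).1 haX
      have h1 : (E (Node.x j) S).nodes = {Node.x j} := by
        ext b
        rw [mem_nodes_E, reach_iff_of_no_inEdges h0, Finset.mem_singleton]
        constructor
        · exact fun h2 => h2.2
        · rintro rfl
          exact ⟨ha, rfl⟩
      rw [h1, Finset.image_singleton, h.inputSet_x ha]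
      exact IsHierarchy.leaf j
    · obtain ⟨c, d, hiff, hd, hU⟩ := h.exists_children ha haX
      have key : ∀ e, (e, a) ∈ S.edges →
          IsHierarchy ((E e S).nodes.image (inputSet n S)) (inputSet n S e) := by
        intro e he
        have hen := (S.edges_mem _ he).1
        refine ih _ ?_ e hen rfl
        rw [← hk]
        apply Finset.card_lt_card
        refine ⟨fun b hb => ?_, fun h1 => ?_⟩
        · rw [mem_nodes_E] at hb ⊢
          exact ⟨hb.1, hb.2.tail he⟩
        · have h2 := h1 (mem_nodes_E.2 ⟨ha, Relation.ReflTransGen.refl⟩)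
          exact h.acyclic a (Relation.TransGen.tail' (mem_nodes_E.1 h2).2 he)
      have h1 : (E a S).nodes = insert a ((E c S).nodes ∪ (E d S).nodes) := by
        ext b
        simp only [mem_nodes_E, Finset.mem_insert, Finset.mem_union]
        rw [reach_cases hiff]
        constructor
        · tauto
        · rintro (rfl | h2)
          · exact ⟨ha, Or.inl rfl⟩
          · tauto
      have h2 := IsHierarchy.node (key c ((hiff c).2 (Or.inl rfl)))
        (key d ((hiff d).2 (Or.inr rfl))) hd
      rwa [hU, ← Finset.image_union, ← Finset.image_insert, ← h1] at h2

end IsStructure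

namespace IsStructureFor

variable {n : ℕ} {S : LGraph}

theorem y_mem (h : S.IsStructureFor n) {j : ℕ} (hj : j ∈ Finset.Icc 1 n) :
    Node.y j ∈ S.nodes := by
  have h1 : Node.y j ∈ S.outputNodes n := by
    rw [h.outputs]
    exact y_mem_Y.2 hj
  exact (Finset.mem_filter.1 (Finset.mem_filter.1 h1).1).1

theorem inputSet_y (h : S.IsStructureFor n) {j : ℕ} (hj : j ∈ Finset.Icc 1 n) :
    inputSet n S (Node.y j) = (Finset.Icc 1 n).erase j := by
  ext i
  rw [mem_inputSet, Finset.mem_erase, and_comm (a := i ≠ j)]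
  refine and_congr_right fun hi => ?_
  have h1 : Node.x i ∈ (E (Node.y j) S).leaves ↔ i ≠ j := by
    rw [h.leaves_eq j hj, Finset.mem_erase, x_mem_X]
    simp only [ne_eq, Node.x.injEq]
    tauto
  rw [← h1, leaves, Finset.mem_filter]
  refine ⟨fun h2 => ⟨h2, ?_⟩, fun h2 => h2.1⟩
  obtain ⟨h3, h4⟩ := mem_nodes_E.1 h2
  rw [inEdges_E h4]
  exact (h.input_iff _ h3).1 (h.label_x i h3)

theorem x_mem (h : S.IsStructureFor n) (hn : 2 ≤ n) {j : ℕ} (hj : j ∈ Finset.Icc 1 n) :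
    Node.x j ∈ S.nodes := by
  obtain ⟨i, hi, hij⟩ : ∃ i ∈ Finset.Icc 1 n, j ≠ i := by
    rcases eq_or_ne j 1 with rfl | hj1
    · exact ⟨2, by simp; omega, by omega⟩
    · exact ⟨1, by simp; omega, hj1⟩
  have h1 : j ∈ inputSet n S (Node.y i) := by
    rw [h.inputSet_y hi]
    exact Finset.mem_erase.2 ⟨hij, hj⟩
  exact (mem_nodes_E.1 (mem_inputSet.1 h1).2).1

theorem isClusterSystem (h : S.IsStructureFor n) :
    IsClusterSystem n (S.nodes.image (inputSet n S)) where
  nonempty := by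
    intro A hA
    obtain ⟨a, ha, rfl⟩ := Finset.mem_image.1 hA
    have := h.isHierarchy _ a ha rfl
    exact this.nonempty_of_mem _ this.top_mem
  subset := by
    intro A hA
    obtain ⟨a, ha, rfl⟩ := Finset.mem_image.1 hA
    exact Finset.filter_subset _ _
  hierarchy := by
    intro j hj
    have := h.isHierarchy _ _ (h.y_mem hj) rfl
    rw [h.inputSet_y hj] at this
    exact ⟨_, Finset.image_subset_image (fun a ha => (mem_nodes_E.1 ha).1), this⟩

theorem bigClusters_subset (h : S.IsStructureFor n) :
    bigClusters (S.nodes.image (inputSet n S)) ⊆ (S.compNodes n).image (inputSet n S) := by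
  intro A hA
  obtain ⟨hA, hA1⟩ := mem_bigClusters.1 hA
  obtain ⟨a, ha, rfl⟩ := Finset.mem_image.1 hA
  refine Finset.mem_image_of_mem _ (Finset.mem_filter.2 ⟨ha, fun haX => hA1 ?_⟩)
  obtain ⟨j, hj, rfl⟩ := mem_X.1 haX
  rw [h.inputSet_x ha, Finset.card_singleton]

theorem three_mul_le (h : S.IsStructureFor n) (hn : 2 ≤ n) : 3 * n ≤ S.complexity n + 6 := by
  have h1 := (h.isClusterSystem.three_mul_le hn _).1
  have h2 := Finset.card_le_card h.bigClusters_subset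
  have h3 : ((S.compNodes n).image (inputSet n S)).card ≤ (S.compNodes n).card :=
    Finset.card_image_le
  rw [complexity]
  omega

theorem represents (h : S.IsStructureFor n) (hn : 2 ≤ n) (hc : S.complexity n + 6 = 3 * n) :
    IsSplitSystem n (S.nodes.image (inputSet n S)) ∧
      Represents n (S.nodes.image (inputSet n S)) (inputSet n S) S := by
  obtain ⟨h1, h1'⟩ := h.isClusterSystem.three_mul_le hn
  have h2 := Finset.card_le_card h.bigClusters_subset
  have h3 : ((S.compNodes n).image (inputSet n S)).card ≤ (S.compNodes n).card :=
    Finset.card_image_le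
  rw [complexity] at hc
  have hF := h1' (by omega)
  have h4 := Finset.eq_of_subset_of_card_le h.bigClusters_subset (by omega)
  have h5 : Set.InjOn (inputSet n S) (S.compNodes n) := Finset.card_image_iff.1 (by omega)
  have hcomp : ∀ a ∈ S.nodes, (a ∈ X n ↔ (inputSet n S a).card = 1) := by
    intro a ha
    constructor
    · intro haX
      obtain ⟨j, hj, rfl⟩ := mem_X.1 haX
      rw [h.inputSet_x ha, Finset.card_singleton]
    · intro h6
      by_contra haX
      have h7 := Finset.mem_image_of_mem (inputSet n S)
        (show a ∈ S.compNodes n from Finset.mem_filter.2 ⟨ha, haX⟩)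
      rw [← h4] at h7
      exact (mem_bigClusters.1 h7).2 h6
  have hinj : ∀ a ∈ S.nodes, ∀ b ∈ S.nodes, inputSet n S a = inputSet n S b → a = b := by
    intro a ha b hb hab
    by_cases haX : a ∈ X n
    · have hbX : b ∈ X n := by
        rw [hcomp b hb, ← hab]
        exact (hcomp a ha).1 haX
      obtain ⟨i, hi, rfl⟩ := mem_X.1 haX
      obtain ⟨j, hj, rfl⟩ := mem_X.1 hbX
      rw [h.inputSet_x ha, h.inputSet_x hb] at hab
      simpa using hab
    · have hbX : b ∉ X n := by
        rw [hcomp b hb, ← hab]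
        exact fun h6 => haX ((hcomp a ha).2 h6)
      exact h5 (Finset.mem_coe.2 (Finset.mem_filter.2 ⟨ha, haX⟩))
        (Finset.mem_coe.2 (Finset.mem_filter.2 ⟨hb, hbX⟩)) hab
  have hmem : ∀ a ∈ S.nodes, inputSet n S a ∈ S.nodes.image (inputSet n S) :=
    fun a ha => Finset.mem_image_of_mem _ ha
  refine ⟨hF, hmem, hinj, fun A hA => Finset.mem_image.1 hA,
    fun j => ⟨fun hj => x_mem_X.1 (h.label_x j hj), h.x_mem hn⟩,
    fun j => ⟨fun hj => y_mem_Y.1 (h.label_y j hj), h.y_mem⟩,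
    fun j hj => h.inputSet_x (h.x_mem hn hj), fun j hj => h.inputSet_y hj, ?_⟩
  intro a ha b hb
  constructor
  · intro hab
    have hbX : b ∉ X n := by
      intro hbX
      have h6 := (reach_iff_of_no_inEdges ((h.input_iff b hb).1 hbX)).1
        (Relation.ReflTransGen.single hab)
      subst h6
      exact h.acyclic a (Relation.TransGen.single hab)
    obtain ⟨c, d, hiff, hd, hU⟩ := h.exists_children hb hbX
    rcases (hiff a).1 hab with rfl | rfl
    · exact ⟨_, hmem d (S.edges_mem _ ((hiff d).2 (Or.inr rfl))).1, hd, hU⟩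
    · exact ⟨_, hmem c (S.edges_mem _ ((hiff c).2 (Or.inl rfl))).1, hd.symm,
        by rw [Finset.union_comm, hU]⟩
  · intro hab
    have hbX : b ∉ X n := by
      intro hbX
      exact hF.props.not_isChild_of_card (hmem a ha) ((hcomp b hb).1 hbX) hab
    obtain ⟨c, d, hiff, hd, hU⟩ := h.exists_children hb hbX
    have hc := (S.edges_mem _ ((hiff c).2 (Or.inl rfl))).1
    have hd' := (S.edges_mem _ ((hiff d).2 (Or.inr rfl))).1
    rw [hiff]
    rcases hF.props.eq_or_eq_of_isChild (hmem a ha) (hmem b hb) (hmem c hc) (hmem d hd') hd hU hab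
      with h6 | h6
    · exact Or.inl (hinj a ha c hc h6)
    · exact Or.inr (hinj a ha d hd' h6)

end IsStructureFor

theorem Represents.isComplexityOptimal {n : ℕ} {F : Finset (Finset ℕ)} {l : Node → Finset ℕ}
    {G : LGraph} (h : Represents n F l G) (hF : SplitProps n F) : G.IsComplexityOptimal n := by
  refine ⟨h.isStructureFor hF, fun S hS => ?_⟩
  have h1 := h.complexity_eq hF
  have h2 := hS.three_mul_le hF.two_le
  omega

theorem IsComplexityOptimal.represents {n : ℕ} {S : LGraph} (h : S.IsComplexityOptimal n)
    (hn : 3 ≤ n) : IsSplitSystem n (S.nodes.image (inputSet n S)) ∧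
      Represents n (S.nodes.image (inputSet n S)) (inputSet n S) S := by
  obtain ⟨F, hF⟩ := exists_isSplitSystem (show 2 ≤ n by omega)
  have h1 := realize_represents hn hF.props
  have h2 := h1.complexity_eq hF.props
  have h3 := h.2 _ (h1.isStructureFor hF.props)
  have h4 := h.1.three_mul_le (by omega)
  exact h.1.represents (by omega) (by omega)

end LGraph

/-! ### The sides of a tree after attaching a leaf -/

/-- The side containing `A` which belongs to the tail of the edges leaving `A`, after a leaf is
attached to the edge with sides `P` and `Q`. -/
def tailSide (n : ℕ) (P Q A : Finset ℕ) : Finset ℕ :=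
  if P ⊆ A ∨ Q ⊆ A then insert (n + 1) A else A

/-- The side containing `A` which belongs to the head of the edges entering `A`, after a leaf is
attached to the edge with sides `P` and `Q`. -/
def headSide (n : ℕ) (P Q A : Finset ℕ) : Finset ℕ :=
  if A ⊆ P ∨ A ⊆ Q then A else insert (n + 1) A

theorem IsEdge.left_mem_graft {n : ℕ} {F : Finset (Finset ℕ)} {P Q : Finset ℕ}
    (e : IsEdge n F P Q) : P ∈ graft n F P Q :=
  mem_graft.2 (Or.inr (Or.inr (Or.inl ⟨e.left, Or.inl subset_rfl⟩)))

theorem IsEdge.insert_mem_graft {n : ℕ} {F : Finset (Finset ℕ)} {P Q : Finset ℕ}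
    (e : IsEdge n F P Q) : insert (n + 1) P ∈ graft n F P Q :=
  mem_graft.2 (Or.inr (Or.inr (Or.inr ⟨P, e.left, Or.inl subset_rfl, rfl⟩)))

namespace SplitProps

variable {n : ℕ} {F : Finset (Finset ℕ)} {P Q : Finset ℕ}

theorem tailSide_mem (h : SplitProps n F) (e : IsEdge n F P Q) {A : Finset ℕ} (hA : A ∈ F) :
    tailSide n P Q A ∈ NodeComputation.graft n F P Q := by
  rw [tailSide, mem_graft]
  have := h.sub_or e.left e.disj e.union hA
  split_ifs with h1
  · exact Or.inr (Or.inr (Or.inr ⟨A, hA, h1, rfl⟩))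
  · exact Or.inr (Or.inr (Or.inl ⟨hA, by tauto⟩))

theorem tailSide_eq_headSide (h : SplitProps n F) (e : IsEdge n F P Q) {A : Finset ℕ}
    (hA : A ∈ F) (hAP : A ≠ P) (hAQ : A ≠ Q) : tailSide n P Q A = headSide n P Q A := by
  rw [tailSide, headSide]
  have h1 := h.sub_or e.left e.disj e.union hA
  have h2 := h.eq_or_eq_of_small_of_large e (A := A)
  split_ifs <;> tauto

theorem tailSide_union (h : SplitProps n F) (e : IsEdge n F P Q) {A B C : Finset ℕ} (hA : A ∈ F)
    (hB : B ∈ F) (hC : C ∈ F) (hd : Disjoint A C) (hU : A ∪ C = B) :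
    Disjoint (tailSide n P Q A) (tailSide n P Q C) ∧
      tailSide n P Q A ∪ tailSide n P Q C = headSide n P Q B := by
  by_cases hs : B ⊆ P ∨ B ⊆ Q
  · have key : ∀ D : Finset ℕ, IsChild F D B → tailSide n P Q D = D := by
      intro D hDB
      have h1 := h.ssubset_of_isChild hDB
      rw [tailSide, if_neg]
      intro h2
      rcases h.eq_or_eq_of_small_of_large e hs (h2.imp h1.1.trans' h1.1.trans') with rfl | rfl
      · rcases h.eq_or_eq_of_small_of_large e (Or.inl h1.1) h2 with h3 | h3
        · exact h1.ne h3
        · obtain ⟨q, hq⟩ := h.nonempty Q e.right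
          exact Finset.disjoint_right.1 e.disj hq (h1.1 (h3 ▸ hq))
      · rcases h.eq_or_eq_of_small_of_large e (Or.inr h1.1) h2 with h3 | h3
        · obtain ⟨p, hp⟩ := h.nonempty P e.left
          exact Finset.disjoint_left.1 e.disj hp (h1.1 (h3 ▸ hp))
        · exact h1.ne h3
    rw [key A ⟨C, hC, hd, hU⟩, key C ⟨A, hA, hd.symm, by rw [Finset.union_comm, hU]⟩, headSide,
      if_pos hs]
    exact ⟨hd, hU⟩
  · have key : ∀ A ∈ F, ∀ C ∈ F, Disjoint A C → A ∪ C = B → (P ⊆ A ∨ Q ⊆ A) →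
        Disjoint (tailSide n P Q A) (tailSide n P Q C) ∧
          tailSide n P Q A ∪ tailSide n P Q C = headSide n P Q B := by
      intro A hA C hC hd hU h1
      have h2 := h.small_of_disjoint e hC hd h1
      have h3 : ¬ (P ⊆ C ∨ Q ⊆ C) := by
        intro h3
        have h4 := h.small_of_disjoint e hA hd.symm h3
        have h5 := h.eq_or_eq_of_small_of_large e h2 h3
        have h6 := h.eq_or_eq_of_small_of_large e h4 h1
        have h7 : A ≠ C := by
          rintro rfl
          obtain ⟨x, hx⟩ := h.nonempty A hA
          exact Finset.disjoint_left.1 hd hx hx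
        have h8 : B = Finset.Icc 1 n := by
          rw [← hU, ← e.union]
          rcases h5 with rfl | rfl <;> rcases h6 with rfl | rfl
          · exact absurd rfl h7
          · exact Finset.union_comm _ _
          · rfl
          · exact absurd rfl h7
        exact h.not_Icc_subset hB h8.ge
      rw [tailSide, if_pos h1, tailSide, if_neg h3, headSide, if_neg hs]
      refine ⟨?_, by rw [Finset.insert_union, hU]⟩
      rw [Finset.disjoint_insert_left]
      exact ⟨h.notMem_succ hC, hd⟩
    have hl : P ⊆ B ∨ Q ⊆ B := by
      have := h.sub_or e.left e.disj e.union hB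
      tauto
    have hPB : B ≠ P := fun h1 => hs (Or.inl h1.subset)
    have hQB : B ≠ Q := fun h1 => hs (Or.inr h1.subset)
    rcases h.sub_children_iff e hB hA hC hU hl hPB hQB with h1 | h1
    · exact key A hA C hC hd hU h1
    · have := key C hC A hA hd.symm (by rw [Finset.union_comm, hU]) h1
      exact ⟨this.1.symm, by rw [Finset.union_comm]; exact this.2⟩

theorem isChild_graft (h : SplitProps n F) (e : IsEdge n F P Q) {A B : Finset ℕ} (hA : A ∈ F)
    (hB : B ∈ F) (hAB : IsChild F A B) :
    IsChild (NodeComputation.graft n F P Q) (tailSide n P Q A) (headSide n P Q B) := by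
  obtain ⟨C, hC, hd, hU⟩ := hAB
  obtain ⟨h1, h2⟩ := h.tailSide_union e hA hB hC hd hU
  exact ⟨_, h.tailSide_mem e hC, h1, h2⟩

/-- The child relation after attaching a leaf. -/
theorem isChild_graft_cases (h : SplitProps n F) (e : IsEdge n F P Q) {U V : Finset ℕ}
    (hU : U ∈ NodeComputation.graft n F P Q) (hV : V ∈ NodeComputation.graft n F P Q)
    (hUV : IsChild (NodeComputation.graft n F P Q) U V) :
    ((U = P ∨ U = {n + 1}) ∧ V = insert (n + 1) P) ∨
    ((U = Q ∨ U = {n + 1}) ∧ V = insert (n + 1) Q) ∨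
    ((U = P ∨ U = Q) ∧ V = Finset.Icc 1 n) ∨
    ∃ A ∈ F, ∃ B ∈ F, IsChild F A B ∧ U = tailSide n P Q A ∧ V = headSide n P Q B := by
  have hG := h.graft e
  have hP := e.left_mem_graft
  have hQ : Q ∈ NodeComputation.graft n F P Q := by
    rw [graft_comm]
    exact e.symm.left_mem_graft
  have hN : {n + 1} ∈ NodeComputation.graft n F P Q := mem_graft.2 (Or.inr (Or.inl rfl))
  have key : ∀ B ∈ F, V = headSide n P Q B →
      ∃ A ∈ F, ∃ B ∈ F, IsChild F A B ∧ U = tailSide n P Q A ∧ V = headSide n P Q B := by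
    intro B hB hVB
    have hB1 : B.card ≠ 1 := by
      intro h1
      have h2 : B ⊆ P ∨ B ⊆ Q := by
        obtain ⟨x, rfl⟩ := Finset.card_eq_one.1 h1
        have := h.subset _ hB
        rw [Finset.singleton_subset_iff, ← e.union, Finset.mem_union] at this
        simpa using this
      rw [headSide, if_pos h2] at hVB
      exact hG.not_isChild_of_card hU (hVB ▸ h1) hUV
    obtain ⟨C, hC, D, hD, hd, hCD⟩ := h.children B hB hB1
    obtain ⟨h1, h2⟩ := h.tailSide_union e hC hB hD hd hCD
    rw [← hVB] at h2
    rcases hG.eq_or_eq_of_isChild hU hV (h.tailSide_mem e hC) (h.tailSide_mem e hD) h1 h2 hUV with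
      h3 | h3
    · exact ⟨C, hC, B, hB, ⟨D, hD, hd, hCD⟩, h3, hVB⟩
    · exact ⟨D, hD, B, hB, ⟨C, hC, hd.symm, by rw [Finset.union_comm, hCD]⟩, h3, hVB⟩
  rcases mem_graft.1 hV with rfl | rfl | ⟨hB, h1⟩ | ⟨B, hB, h1, rfl⟩
  · exact Or.inr (Or.inr (Or.inl ⟨hG.eq_or_eq_of_isChild hU hV hP hQ e.disj e.union hUV, rfl⟩))
  · exact absurd hUV (hG.not_isChild_of_card hU (by simp))
  · exact Or.inr (Or.inr (Or.inr (key V hB (by rw [headSide, if_pos h1]))))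
  · by_cases h2 : B ⊆ P ∨ B ⊆ Q
    · rcases h.eq_or_eq_of_small_of_large e h2 h1 with rfl | rfl
      · exact Or.inl ⟨hG.eq_or_eq_of_isChild hU hV hP hN
          (by simpa using h.notMem_succ e.left) (by rw [Finset.union_comm]; rfl) hUV, rfl⟩
      · exact Or.inr (Or.inl ⟨hG.eq_or_eq_of_isChild hU hV hQ hN
          (by simpa using h.notMem_succ e.right) (by rw [Finset.union_comm]; rfl) hUV, rfl⟩)
    · exact Or.inr (Or.inr (Or.inr (key B hB (by rw [headSide, if_neg h2]))))

end SplitProps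

namespace LGraph

/-! ### The graph `g (n + 1) a b S` -/

theorem lt_fresh {S : LGraph} {k : ℕ} (h : Node.u k ∈ S.nodes) : k < S.fresh :=
  Nat.lt_succ_of_le (Finset.le_sup (f := Node.index) h)

/-- The new ends of the edges leaving `c` in `g n a b S`. -/
def tailNode (a b a₂ b₂ c : Node) : Node := if c = a then a₂ else if c = b then b₂ else c

theorem mem_nodes_g {n : ℕ} {a b v : Node} {S : LGraph}
    (h1 : splitIn a S.fresh ≠ b) (h2 : splitOut a (S.fresh + 1) ≠ b) :
    v ∈ (g n a b S).nodes ↔ v = splitIn a S.fresh ∨ v = splitOut a (S.fresh + 1) ∨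
      v = splitIn b (S.fresh + 2) ∨ v = splitOut b (S.fresh + 3) ∨ v = Node.x n ∨ v = Node.y n ∨
      (v ∈ S.nodes ∧ v ≠ a ∧ v ≠ b) := by
  simp only [g, addEdge, convert, Finset.mem_insert, Finset.mem_erase]
  constructor
  · tauto
  · rintro (rfl | rfl | h | h | h | h | h) <;> tauto

theorem card_nodes_g_le {n : ℕ} {a b : Node} {S : LGraph} (ha : a ∈ S.nodes) (hb : b ∈ S.nodes)
    (hab : a ≠ b) (h1 : splitIn a S.fresh ≠ b) (h2 : splitOut a (S.fresh + 1) ≠ b) :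
    (g n a b S).nodes.card ≤ S.nodes.card + 4 := by
  have h3 : (g n a b S).nodes ⊆ insert (splitIn a S.fresh) (insert (splitOut a (S.fresh + 1))
      (insert (splitIn b (S.fresh + 2)) (insert (splitOut b (S.fresh + 3))
      (insert (Node.x n) (insert (Node.y n) ((S.nodes.erase a).erase b)))))) := by
    intro v hv
    rw [mem_nodes_g h1 h2] at hv
    simp only [Finset.mem_insert, Finset.mem_erase]
    tauto
  have h4 := Finset.card_erase_add_one (Finset.mem_erase.2 ⟨hab.symm, hb⟩)
  have h5 := Finset.card_erase_add_one ha
  refine (Finset.card_le_card h3).trans ?_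
  refine (Finset.card_insert_le _ _).trans ?_
  have e1 := Finset.card_insert_le (splitOut a (S.fresh + 1))
    (insert (splitIn b (S.fresh + 2)) (insert (splitOut b (S.fresh + 3))
      (insert (Node.x n) (insert (Node.y n) ((S.nodes.erase a).erase b)))))
  have e2 := Finset.card_insert_le (splitIn b (S.fresh + 2)) (insert (splitOut b (S.fresh + 3))
      (insert (Node.x n) (insert (Node.y n) ((S.nodes.erase a).erase b))))
  have e3 := Finset.card_insert_le (splitOut b (S.fresh + 3))
      (insert (Node.x n) (insert (Node.y n) ((S.nodes.erase a).erase b)))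
  have e4 := Finset.card_insert_le (Node.x n) (insert (Node.y n) ((S.nodes.erase a).erase b))
  have e5 := Finset.card_insert_le (Node.y n) ((S.nodes.erase a).erase b)
  omega

theorem mem_edges_g {n : ℕ} {a b v w : Node} {S : LGraph}
    (h1 : splitIn a S.fresh ≠ b) (h2 : splitOut a (S.fresh + 1) ≠ b) :
    (v, w) ∈ (g n a b S).edges ↔
      (v = splitIn a S.fresh ∧ w = splitOut a (S.fresh + 1)) ∨
      (v = splitIn b (S.fresh + 2) ∧ w = splitOut b (S.fresh + 3)) ∨
      (v = Node.x n ∧ (w = splitOut a (S.fresh + 1) ∨ w = splitOut b (S.fresh + 3))) ∨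
      ((v = splitIn a S.fresh ∨ v = splitIn b (S.fresh + 2)) ∧ w = Node.y n) ∨
      ∃ c d, (c, d) ∈ S.edges ∧
        v = tailNode a b (splitOut a (S.fresh + 1)) (splitOut b (S.fresh + 3)) c ∧
        w = tailNode a b (splitIn a S.fresh) (splitIn b (S.fresh + 2)) d := by
  simp only [g, addEdge, convert, Finset.mem_insert, Finset.image_insert, Finset.image_image,
    Prod.mk.injEq, Finset.mem_image, Prod.exists, Function.comp, if_neg h1, if_neg h2]
  have key : ∀ (a₁ b₁ c : Node), a₁ ≠ b →
      (if (if c = a then a₁ else c) = b then b₁ else (if c = a then a₁ else c)) =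
        tailNode a b a₁ b₁ c := by
    intro a₁ b₁ c h3
    by_cases hc : c = a
    · simp [tailNode, hc, h3]
    · simp [tailNode, hc]
  simp only [key _ _ _ h1, key _ _ _ h2]
  constructor
  · rintro (h | h | h | h | h | h | ⟨c, d, h3, rfl, rfl⟩)
    · tauto
    · tauto
    · tauto
    · tauto
    · tauto
    · tauto
    · exact Or.inr (Or.inr (Or.inr (Or.inr ⟨c, d, h3, rfl, rfl⟩)))
  · rintro (h | h | h | h | ⟨c, d, h3, rfl, rfl⟩)
    · tauto
    · tauto
    · tauto
    · tauto
    · exact Or.inr (Or.inr (Or.inr (Or.inr (Or.inr (Or.inr ⟨c, d, h3, rfl, rfl⟩)))))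

theorem splitIn_eq_x {a : Node} {k j : ℕ} : splitIn a k = Node.x j ↔ a = Node.x j := by
  cases a <;> simp [splitIn]

theorem splitIn_ne_y {a : Node} {k j : ℕ} : splitIn a k ≠ Node.y j := by
  cases a <;> simp [splitIn]

theorem splitOut_eq_y {a : Node} {k j : ℕ} : splitOut a k = Node.y j ↔ a = Node.y j := by
  cases a <;> simp [splitOut]

theorem splitOut_ne_x {a : Node} {k j : ℕ} : splitOut a k ≠ Node.x j := by
  cases a <;> simp [splitOut]

theorem splitIn_ne_splitOut {a b : Node} {i j : ℕ} (hij : i ≠ j) :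
    splitIn a i ≠ splitOut b j := by
  cases a <;> cases b <;> simp [splitIn, splitOut, hij]

theorem splitIn_ne_splitIn {a b : Node} {i j : ℕ} (hij : i ≠ j) (hab : a ≠ b) :
    splitIn a i ≠ splitIn b j := by
  cases a <;> cases b <;> simp_all [splitIn]

theorem splitOut_ne_splitOut {a b : Node} {i j : ℕ} (hij : i ≠ j) (hab : a ≠ b) :
    splitOut a i ≠ splitOut b j := by
  cases a <;> cases b <;> simp_all [splitOut]

theorem splitIn_ne_of_mem {S : LGraph} {a v : Node} {k : ℕ} (hv : v ∈ S.nodes) (hva : v ≠ a)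
    (hk : S.fresh ≤ k) : splitIn a k ≠ v := by
  rintro rfl
  cases a with
  | x j => exact hva rfl
  | y j =>
    have := lt_fresh hv
    omega
  | u j =>
    have := lt_fresh hv
    omega

theorem splitOut_ne_of_mem {S : LGraph} {a v : Node} {k : ℕ} (hv : v ∈ S.nodes) (hva : v ≠ a)
    (hk : S.fresh ≤ k) : splitOut a k ≠ v := by
  rintro rfl
  cases a with
  | x j =>
    have := lt_fresh hv
    omega
  | y j => exact hva rfl
  | u j =>
    have := lt_fresh hv
    omega

/-- The sides represented by the nodes of `g (n + 1) a b S`, if `l` gives the sides represented by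
the nodes of `S`. -/
noncomputable def graftLabel (n : ℕ) (a b : Node) (S : LGraph) (l : Node → Finset ℕ) (v : Node) :
    Finset ℕ :=
  if v = splitIn a S.fresh then l a
  else if v = splitOut a (S.fresh + 1) then insert (n + 1) (l a)
  else if v = splitIn b (S.fresh + 2) then l b
  else if v = splitOut b (S.fresh + 3) then insert (n + 1) (l b)
  else if v = Node.x (n + 1) then {n + 1}
  else if v = Node.y (n + 1) then Finset.Icc 1 n
  else tailSide n (l a) (l b) (l v)

namespace Represents

variable {n : ℕ} {F : Finset (Finset ℕ)} {l : Node → Finset ℕ} {S : LGraph} {a b : Node}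

theorem graftLabel_spec (h : Represents n F l S) (ha : a ∈ S.nodes)
    (hb : b ∈ S.nodes) (hab : a ≠ b) :
    graftLabel n a b S l (splitIn a S.fresh) = l a ∧
    graftLabel n a b S l (splitOut a (S.fresh + 1)) = insert (n + 1) (l a) ∧
    graftLabel n a b S l (splitIn b (S.fresh + 2)) = l b ∧
    graftLabel n a b S l (splitOut b (S.fresh + 3)) = insert (n + 1) (l b) ∧
    graftLabel n a b S l (Node.x (n + 1)) = {n + 1} ∧
    graftLabel n a b S l (Node.y (n + 1)) = Finset.Icc 1 n ∧
    ∀ v ∈ S.nodes, v ≠ a → v ≠ b →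
      graftLabel n a b S l v = tailSide n (l a) (l b) (l v) := by
  have hx : ∀ v ∈ S.nodes, v ≠ Node.x (n + 1) := by
    rintro v hv rfl
    simpa using (h.x_iff _).1 hv
  have hy : ∀ v ∈ S.nodes, v ≠ Node.y (n + 1) := by
    rintro v hv rfl
    simpa using (h.y_iff _).1 hv
  have x1 : ∀ c ∈ S.nodes, ∀ k, splitIn c k ≠ Node.x (n + 1) :=
    fun c hc k => mt splitIn_eq_x.1 (hx c hc)
  have y1 : ∀ c ∈ S.nodes, ∀ k, splitOut c k ≠ Node.y (n + 1) :=
    fun c hc k => mt splitOut_eq_y.1 (hy c hc)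
  refine ⟨?_, ?_, ?_, ?_, ?_, ?_, ?_⟩
  · rw [graftLabel, if_pos rfl]
  · rw [graftLabel, if_neg (splitIn_ne_splitOut (by omega)).symm, if_pos rfl]
  · rw [graftLabel, if_neg (splitIn_ne_splitIn (by omega) hab.symm),
      if_neg (splitIn_ne_splitOut (by omega)), if_pos rfl]
  · rw [graftLabel, if_neg (splitIn_ne_splitOut (by omega)).symm,
      if_neg (splitOut_ne_splitOut (by omega) hab.symm),
      if_neg (splitIn_ne_splitOut (by omega)).symm, if_pos rfl]
  · rw [graftLabel, if_neg (x1 a ha _).symm, if_neg splitOut_ne_x.symm, if_neg (x1 b hb _).symm,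
      if_neg splitOut_ne_x.symm, if_pos rfl]
  · rw [graftLabel, if_neg splitIn_ne_y.symm, if_neg (y1 a ha _).symm, if_neg splitIn_ne_y.symm,
      if_neg (y1 b hb _).symm, if_neg (by simp), if_pos rfl]
  · intro v hv hva hvb
    rw [graftLabel, if_neg (splitIn_ne_of_mem hv hva le_rfl).symm,
      if_neg (splitOut_ne_of_mem hv hva (by omega)).symm,
      if_neg (splitIn_ne_of_mem hv hvb (by omega)).symm,
      if_neg (splitOut_ne_of_mem hv hvb (by omega)).symm, if_neg (hx v hv), if_neg (hy v hv)]

theorem graft (h : Represents n F l S) (hF : SplitProps n F) (ha : a ∈ S.nodes)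
    (hb : b ∈ S.nodes) (e : IsEdge n F (l a) (l b)) :
    Represents (n + 1) (NodeComputation.graft n F (l a) (l b)) (graftLabel n a b S l)
      (g (n + 1) a b S) := by
  have hab : a ≠ b := by
    rintro rfl
    obtain ⟨x, hx⟩ := hF.nonempty _ e.left
    exact Finset.disjoint_left.1 e.disj hx hx
  have n1 : splitIn a S.fresh ≠ b := splitIn_ne_of_mem hb hab.symm le_rfl
  have n2 : splitOut a (S.fresh + 1) ≠ b := splitOut_ne_of_mem hb hab.symm (by omega)
  have hG := hF.graft e
  obtain ⟨m1, m2, m3, m4, m5, m6, m7⟩ := h.graftLabel_spec ha hb hab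
  have hmem := fun v => mem_nodes_g (n := n + 1) (v := v) n1 n2
  have hedge := fun v w => mem_edges_g (n := n + 1) (v := v) (w := w) n1 n2
  have hcard := card_nodes_g_le (n := n + 1) ha hb hab n1 n2
  set a₁ := splitIn a S.fresh with ha₁
  set a₂ := splitOut a (S.fresh + 1) with ha₂
  set b₁ := splitIn b (S.fresh + 2) with hb₁
  set b₂ := splitOut b (S.fresh + 3) with hb₂
  set m := graftLabel n a b S l with hm
  set P := l a with hP
  set Q := l b with hQ
  have gP := e.left_mem_graft
  have gP' := e.insert_mem_graft
  have gQ : Q ∈ NodeComputation.graft n F P Q := by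
    rw [graft_comm]
    exact e.symm.left_mem_graft
  have gQ' : insert (n + 1) Q ∈ NodeComputation.graft n F P Q := by
    rw [graft_comm]
    exact e.symm.insert_mem_graft
  have k1 : a₁ ∈ (g (n + 1) a b S).nodes := (hmem _).2 (Or.inl rfl)
  have k2 : a₂ ∈ (g (n + 1) a b S).nodes := (hmem _).2 (Or.inr (Or.inl rfl))
  have k3 : b₁ ∈ (g (n + 1) a b S).nodes := (hmem _).2 (Or.inr (Or.inr (Or.inl rfl)))
  have k4 : b₂ ∈ (g (n + 1) a b S).nodes := (hmem _).2 (Or.inr (Or.inr (Or.inr (Or.inl rfl))))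
  have k5 : Node.x (n + 1) ∈ (g (n + 1) a b S).nodes :=
    (hmem _).2 (Or.inr (Or.inr (Or.inr (Or.inr (Or.inl rfl)))))
  have k6 : Node.y (n + 1) ∈ (g (n + 1) a b S).nodes :=
    (hmem _).2 (Or.inr (Or.inr (Or.inr (Or.inr (Or.inr (Or.inl rfl))))))
  have k7 : ∀ v ∈ S.nodes, v ≠ a → v ≠ b → v ∈ (g (n + 1) a b S).nodes := fun v h1 h2 h3 =>
    (hmem _).2 (Or.inr (Or.inr (Or.inr (Or.inr (Or.inr (Or.inr ⟨h1, h2, h3⟩))))))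
  have maps : ∀ v ∈ (g (n + 1) a b S).nodes, m v ∈ NodeComputation.graft n F P Q := by
    intro v hv
    rcases (hmem v).1 hv with rfl | rfl | rfl | rfl | rfl | rfl | ⟨hv, hva, hvb⟩
    · rwa [m1]
    · rwa [m2]
    · rwa [m3]
    · rwa [m4]
    · rw [m5]
      exact mem_graft.2 (Or.inr (Or.inl rfl))
    · rw [m6]
      exact mem_graft.2 (Or.inl rfl)
    · rw [m7 v hv hva hvb]
      exact hF.tailSide_mem e (h.maps v hv)
  have surj : ∀ A ∈ NodeComputation.graft n F P Q, ∃ v ∈ (g (n + 1) a b S).nodes, m v = A := by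
    intro A hA
    rcases mem_graft.1 hA with rfl | rfl | ⟨hA, h1⟩ | ⟨B, hB, h1, rfl⟩
    · exact ⟨_, k6, m6⟩
    · exact ⟨_, k5, m5⟩
    · obtain ⟨v, hv, rfl⟩ := h.surj A hA
      by_cases hva : v = a
      · subst hva
        exact ⟨_, k1, m1⟩
      by_cases hvb : v = b
      · subst hvb
        exact ⟨_, k3, m3⟩
      refine ⟨v, k7 v hv hva hvb, ?_⟩
      rw [m7 v hv hva hvb, tailSide, if_neg]
      intro h2
      rcases hF.eq_or_eq_of_small_of_large e h1 h2 with h3 | h3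
      · exact hva (h.inj v hv a ha h3)
      · exact hvb (h.inj v hv b hb h3)
    · obtain ⟨v, hv, rfl⟩ := h.surj B hB
      by_cases hva : v = a
      · subst hva
        exact ⟨_, k2, m2⟩
      by_cases hvb : v = b
      · subst hvb
        exact ⟨_, k4, m4⟩
      exact ⟨v, k7 v hv hva hvb, by rw [m7 v hv hva hvb, tailSide, if_pos h1]⟩
  have inj : ∀ v ∈ (g (n + 1) a b S).nodes, ∀ w ∈ (g (n + 1) a b S).nodes, m v = m w → v = w := by
    have h1 : (g (n + 1) a b S).nodes.image m = NodeComputation.graft n F P Q := by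
      ext A
      rw [Finset.mem_image]
      constructor
      · rintro ⟨v, hv, rfl⟩
        exact maps v hv
      · exact surj A
    have h2 := hG.card
    have h3 := hF.card
    have h4 := h.card_nodes
    have h5 : ((g (n + 1) a b S).nodes.image m).card ≤ (g (n + 1) a b S).nodes.card :=
      Finset.card_image_le
    rw [h1] at h5
    have h6 : Set.InjOn m (g (n + 1) a b S).nodes := Finset.card_image_iff.1 (by rw [h1]; omega)
    exact fun v hv w hw hvw => h6 hv hw hvw
  have mtail : ∀ c ∈ S.nodes, tailNode a b a₂ b₂ c ∈ (g (n + 1) a b S).nodes ∧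
      m (tailNode a b a₂ b₂ c) = tailSide n P Q (l c) := by
    intro c hc
    rw [tailNode]
    split_ifs with h1 h2
    · rw [h1, m2, tailSide, if_pos (Or.inl subset_rfl)]
      exact ⟨k2, rfl⟩
    · rw [h2, m4, tailSide, if_pos (Or.inr subset_rfl)]
      exact ⟨k4, rfl⟩
    · exact ⟨k7 c hc h1 h2, m7 c hc h1 h2⟩
  have mhead : ∀ d ∈ S.nodes, tailNode a b a₁ b₁ d ∈ (g (n + 1) a b S).nodes ∧
      m (tailNode a b a₁ b₁ d) = headSide n P Q (l d) := by
    intro d hd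
    rw [tailNode]
    split_ifs with h1 h2
    · rw [h1, m1, headSide, if_pos (Or.inl subset_rfl)]
      exact ⟨k1, rfl⟩
    · rw [h2, m3, headSide, if_pos (Or.inr subset_rfl)]
      exact ⟨k3, rfl⟩
    · refine ⟨k7 d hd h1 h2, ?_⟩
      rw [m7 d hd h1 h2, hF.tailSide_eq_headSide e (h.maps d hd) (fun h3 => h1 (h.inj d hd a ha h3))
        (fun h3 => h2 (h.inj d hd b hb h3))]
  have cP := hF.notMem_succ e.left
  have cQ := hF.notMem_succ e.right
  have gN : {n + 1} ∈ NodeComputation.graft n F P Q := mem_graft.2 (Or.inr (Or.inl rfl))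
  refine ⟨maps, inj, surj, ?_, ?_, ?_, ?_, ?_⟩
  · intro j
    rw [hmem, Icc_succ_eq, Finset.mem_insert, ← h.x_iff j, eq_comm (a := Node.x j) (b := a₁),
      eq_comm (a := Node.x j) (b := b₁), ha₁, hb₁, splitIn_eq_x, splitIn_eq_x]
    have x1 : Node.x j ≠ a₂ := splitOut_ne_x.symm
    have x2 : Node.x j ≠ b₂ := splitOut_ne_x.symm
    have x3 : a = Node.x j → Node.x j ∈ S.nodes := fun h1 => h1 ▸ ha
    have x4 : b = Node.x j → Node.x j ∈ S.nodes := fun h1 => h1 ▸ hb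
    simp only [x1, x2, Node.x.injEq, false_or, reduceCtorEq, eq_comm (a := Node.x j) (b := a),
      eq_comm (a := Node.x j) (b := b), ne_eq]
    clear * - x3 x4
    tauto
  · intro j
    rw [hmem, Icc_succ_eq, Finset.mem_insert, ← h.y_iff j, eq_comm (a := Node.y j) (b := a₂),
      eq_comm (a := Node.y j) (b := b₂), ha₂, hb₂, splitOut_eq_y, splitOut_eq_y]
    have x1 : Node.y j ≠ a₁ := splitIn_ne_y.symm
    have x2 : Node.y j ≠ b₁ := splitIn_ne_y.symm
    have x3 : a = Node.y j → Node.y j ∈ S.nodes := fun h1 => h1 ▸ ha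
    have x4 : b = Node.y j → Node.y j ∈ S.nodes := fun h1 => h1 ▸ hb
    simp only [x1, x2, Node.y.injEq, false_or, reduceCtorEq, eq_comm (a := Node.y j) (b := a),
      eq_comm (a := Node.y j) (b := b), ne_eq]
    clear * - x3 x4
    tauto
  · intro j hj
    rw [Icc_succ_eq, Finset.mem_insert] at hj
    rcases hj with rfl | hj
    · exact m5
    have hjx := (h.x_iff j).2 hj
    have hl := h.label_x j hj
    by_cases hja : Node.x j = a
    · have : a₁ = Node.x j := splitIn_eq_x.2 hja.symm
      rw [← this, m1, hP, ← hja, hl]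
    by_cases hjb : Node.x j = b
    · have : b₁ = Node.x j := splitIn_eq_x.2 hjb.symm
      rw [← this, m3, hQ, ← hjb, hl]
    rw [m7 _ hjx hja hjb, hl, tailSide, if_neg]
    intro h1
    have h2 : ({j} : Finset ℕ) ⊆ P ∨ {j} ⊆ Q := by
      rw [← e.union, Finset.mem_union] at hj
      simpa using hj
    rcases hF.eq_or_eq_of_small_of_large e h2 h1 with h3 | h3
    · exact hja (h.inj _ hjx a ha (hl.trans h3))
    · exact hjb (h.inj _ hjx b hb (hl.trans h3))
  · intro j hj
    rw [Icc_succ_eq, Finset.mem_insert] at hj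
    rcases hj with rfl | hj
    · rw [m6, Icc_succ_eq, Finset.erase_insert (by simp)]
    have hjy := (h.y_iff j).2 hj
    have hl := h.label_y j hj
    have hjn : n + 1 ≠ j := by simp at hj; omega
    rw [Icc_succ_eq, Finset.erase_insert_of_ne hjn, ← hl]
    by_cases hja : Node.y j = a
    · have : a₂ = Node.y j := splitOut_eq_y.2 hja.symm
      rw [← this, m2, hP, this, hja]
    by_cases hjb : Node.y j = b
    · have : b₂ = Node.y j := splitOut_eq_y.2 hjb.symm
      rw [← this, m4, hQ, this, hjb]
    rw [m7 _ hjy hja hjb, tailSide, if_pos]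
    rw [hl, Finset.subset_erase, Finset.subset_erase]
    by_cases hjP : j ∈ P
    · exact Or.inr ⟨hF.subset _ e.right, Finset.disjoint_left.1 e.disj hjP⟩
    · exact Or.inl ⟨hF.subset _ e.left, hjP⟩
  · intro v hv w hw
    rw [hedge]
    constructor
    · rintro (⟨rfl, rfl⟩ | ⟨rfl, rfl⟩ | ⟨rfl, rfl | rfl⟩ | ⟨rfl | rfl, rfl⟩ | ⟨c, d, hcd, rfl, rfl⟩)
      · rw [m1, m2]
        exact ⟨_, gN, by simpa using cP, by rw [Finset.union_comm]; rfl⟩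
      · rw [m3, m4]
        exact ⟨_, gN, by simpa using cQ, by rw [Finset.union_comm]; rfl⟩
      · rw [m5, m2]
        exact ⟨_, gP, by simpa using cP, rfl⟩
      · rw [m5, m4]
        exact ⟨_, gQ, by simpa using cQ, rfl⟩
      · rw [m1, m6]
        exact ⟨_, gQ, e.disj, e.union⟩
      · rw [m3, m6]
        exact ⟨_, gP, e.symm.disj, e.symm.union⟩
      · obtain ⟨hc, hd, h1⟩ := h.edge_spec hcd
        rw [(mtail c hc).2, (mhead d hd).2]
        exact hF.isChild_graft e (h.maps c hc) (h.maps d hd) h1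
    · intro h1
      have i1 : m v = P → v = a₁ := fun h2 => inj _ hv _ k1 (by rw [h2, m1])
      have i3 : m v = Q → v = b₁ := fun h2 => inj _ hv _ k3 (by rw [h2, m3])
      have i5 : m v = {n + 1} → v = Node.x (n + 1) :=
        fun h2 => inj _ hv _ k5 (by rw [h2, m5])
      have i2 : m w = insert (n + 1) P → w = a₂ :=
        fun h2 => inj _ hw _ k2 (by rw [h2, m2])
      have i4 : m w = insert (n + 1) Q → w = b₂ :=
        fun h2 => inj _ hw _ k4 (by rw [h2, m4])
      have i6 : m w = Finset.Icc 1 n → w = Node.y (n + 1) :=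
        fun h2 => inj _ hw _ k6 (by rw [h2, m6])
      rcases hF.isChild_graft_cases e (maps v hv) (maps w hw) h1 with
        ⟨h2 | h2, h3⟩ | ⟨h2 | h2, h3⟩ | ⟨h2 | h2, h3⟩ | ⟨A, hA, B, hB, hAB, h3, h4⟩
      · exact Or.inl ⟨i1 h2, i2 h3⟩
      · exact Or.inr (Or.inr (Or.inl ⟨i5 h2, Or.inl (i2 h3)⟩))
      · exact Or.inr (Or.inl ⟨i3 h2, i4 h3⟩)
      · exact Or.inr (Or.inr (Or.inl ⟨i5 h2, Or.inr (i4 h3)⟩))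
      · exact Or.inr (Or.inr (Or.inr (Or.inl ⟨Or.inl (i1 h2), i6 h3⟩)))
      · exact Or.inr (Or.inr (Or.inr (Or.inl ⟨Or.inr (i3 h2), i6 h3⟩)))
      · obtain ⟨c, hc, rfl⟩ := h.surj A hA
        obtain ⟨d, hd, rfl⟩ := h.surj B hB
        refine Or.inr (Or.inr (Or.inr (Or.inr ⟨c, d, (h.edge c hc d hd).2 hAB, ?_, ?_⟩)))
        · exact inj _ hv _ (mtail c hc).1 (by rw [h3, (mtail c hc).2])
        · exact inj _ hw _ (mhead d hd).1 (by rw [h4, (mhead d hd).2])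

end Represents

/-! ### The optimal structures -/

theorem toU_eq_of_represents {n : ℕ} {F : Finset (Finset ℕ)} {l l' : Node → Finset ℕ}
    {G G' : LGraph} (h : Represents n F l G) (h' : Represents n F l' G') : G.toU = G'.toU :=
  Quotient.sound (s := sameSetoid) (h.same h')

theorem optimalSet_eq {n : ℕ} (hn : 3 ≤ n) :
    optimalSet n = (fun F => (realize n F).toU) '' (splitSystems n : Set (Finset (Finset ℕ))) := by
  ext c
  simp only [optimalSet, Set.mem_image, Finset.mem_coe, mem_splitSystems, Set.mem_ofPred_eq]
  constructor
  · rintro ⟨S, hS, rfl⟩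
    obtain ⟨hF, hR⟩ := hS.represents hn
    exact ⟨_, hF, toU_eq_of_represents (realize_represents hn hF.props) hR⟩
  · rintro ⟨F, hF, rfl⟩
    exact ⟨_, (realize_represents hn hF.props).isComplexityOptimal hF.props, rfl⟩

theorem reach_rename {G H : LGraph} {σ : Equiv.Perm ℕ}
    (h : H.edges = G.edges.image (Prod.map (Node.rename σ) (Node.rename σ))) {a b : Node}
    (hab : G.Reach a b) : H.Reach (Node.rename σ a) (Node.rename σ b) := by
  induction hab with
  | refl => exact Relation.ReflTransGen.refl
  | tail _ hbc ih =>
    refine ih.tail ?_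
    rw [h]
    exact Finset.mem_image_of_mem _ hbc

theorem inputSet_rename_subset {n : ℕ} {G H : LGraph} {σ : Equiv.Perm ℕ}
    (h1 : H.nodes = G.nodes.image (Node.rename σ))
    (h2 : H.edges = G.edges.image (Prod.map (Node.rename σ) (Node.rename σ))) (a : Node) :
    inputSet n G a ⊆ inputSet n H (Node.rename σ a) := by
  intro j hj
  rw [mem_inputSet, mem_nodes_E] at hj ⊢
  refine ⟨hj.1, ?_, reach_rename h2 hj.2.2⟩
  rw [h1]
  exact Finset.mem_image_of_mem _ hj.2.1

theorem Same.image_inputSet {n : ℕ} {G H : LGraph} (h : Same G H) :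
    G.nodes.image (inputSet n G) = H.nodes.image (inputSet n H) := by
  obtain ⟨σ, h1, h2⟩ := h
  have h3 : G.nodes = H.nodes.image (Node.rename σ.symm) := by
    rw [h1, Finset.image_image, rename_comp, Equiv.self_trans_symm, rename_refl, Finset.image_id]
  have h4 : G.edges = H.edges.image (Prod.map (Node.rename σ.symm) (Node.rename σ.symm)) := by
    rw [h2, Finset.image_image, Prod.map_comp_map, rename_comp, Equiv.self_trans_symm,
      rename_refl, Prod.map_id, Finset.image_id]
  have h5 : ∀ a, Node.rename σ.symm (Node.rename σ a) = a := by
    intro a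
    have := congrFun (rename_comp σ σ.symm) a
    simpa [rename_refl] using this
  have h6 : ∀ a, inputSet n H (Node.rename σ a) = inputSet n G a := by
    intro a
    refine Finset.Subset.antisymm ?_ (inputSet_rename_subset h1 h2 a)
    have := inputSet_rename_subset (n := n) h3 h4 (Node.rename σ a)
    rwa [h5] at this
  rw [h1, Finset.image_image]
  exact Finset.image_congr fun a _ => (h6 a).symm

theorem Represents.image_inputSet {n : ℕ} {F : Finset (Finset ℕ)} {l : Node → Finset ℕ}
    {G : LGraph} (h : Represents n F l G) (hF : SplitProps n F) :
    G.nodes.image (inputSet n G) = F := by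
  ext A
  rw [Finset.mem_image]
  constructor
  · rintro ⟨a, ha, rfl⟩
    rw [h.inputSet_eq hF ha]
    exact h.maps a ha
  · intro hA
    obtain ⟨a, ha, rfl⟩ := h.surj A hA
    exact ⟨a, ha, h.inputSet_eq hF ha⟩

theorem ncard_optimalSet {n : ℕ} (hn : 3 ≤ n) : (optimalSet n).ncard = (2 * n - 5)‼ := by
  rw [optimalSet_eq hn, Set.InjOn.ncard_image, Set.ncard_coe_finset, card_splitSystems (by omega)]
  intro F hF F' hF' h
  have p := (mem_splitSystems.1 (Finset.mem_coe.1 hF)).props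
  have p' := (mem_splitSystems.1 (Finset.mem_coe.1 hF')).props
  have h1 : Same (realize n F) (realize n F') := Quotient.exact (s := sameSetoid) h
  rw [← (realize_represents hn p).image_inputSet p, h1.image_inputSet,
    (realize_represents hn p').image_inputSet p']

theorem optimalSet_succ {n : ℕ} (hn : 3 ≤ n) :
    optimalSet (n + 1) = {c : UGraph | ∃ (S : LGraph) (a b : Node),
      S.IsComplexityOptimal n ∧ S.IsComplementPair n a b ∧ c = (g (n + 1) a b S).toU} := by
  ext c
  constructor
  · rintro ⟨T, hT, rfl⟩
    obtain ⟨hG, hR⟩ := IsComplexityOptimal.represents hT (by omega)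
    obtain ⟨F, P, Q, hF, e, hFG⟩ := hG.exists_graft (by omega)
    rw [hFG] at hR
    have h1 := realize_represents hn hF.props
    obtain ⟨a, ha, rfl⟩ := h1.surj P e.left
    obtain ⟨b, hb, rfl⟩ := h1.surj Q e.right
    exact ⟨realize n F, a, b, h1.isComplexityOptimal hF.props,
      (h1.isComplementPair_iff hF.props).2 ⟨ha, hb, e⟩,
      toU_eq_of_represents hR (h1.graft hF.props ha hb e)⟩
  · rintro ⟨S, a, b, hS, hab, rfl⟩
    obtain ⟨hF, hR⟩ := hS.represents hn
    obtain ⟨ha, hb, e⟩ := (hR.isComplementPair_iff hF.props).1 hab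
    exact ⟨_, (hR.graft hF.props ha hb e).isComplexityOptimal (hF.props.graft e), rfl⟩

theorem IsComplexityOptimal.outEdges_card {n : ℕ} {S : LGraph} (h : S.IsComplexityOptimal n)
    (hn : 3 ≤ n) {a : Node} (ha : a ∈ S.nodes) (hout : a ∉ S.outputNodes n) :
    (S.outEdges a).card = 2 := by
  obtain ⟨hF, hR⟩ := h.represents hn
  refine hR.outEdges_card_two hF.props ha fun h1 => ?_
  have h2 := (hR.outEdges_card_eq_zero_iff hF.props ha).1 (hR.outEdges_card_zero hF.props h1)
  rw [← hR.outputNodes_eq hF.props] at h2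
  exact hout h2

theorem IsComplexityOptimal.x_mem_E_iff {n : ℕ} {S : LGraph} (h : S.IsComplexityOptimal n)
    (hn : 3 ≤ n) {a : Node} (ha : a ∈ S.nodes) {j : ℕ} (hj : j ∈ Finset.Icc 1 n) :
    Node.x j ∈ (E a S).nodes ↔ Node.y j ∉ (L a S).nodes := by
  obtain ⟨hF, hR⟩ := h.represents hn
  rw [hR.x_mem_E hF.props ha hj, hR.y_mem_L hF.props ha hj, not_not]

end LGraph

end NodeComputation

open NodeComputation LGraph in
theorem mainTheorem6 (n : ℕ) (hn : 3 ≤ n) :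
    (∀ S : LGraph, S.IsComplexityOptimal n → ∀ a ∈ S.nodes, a ∉ S.outputNodes n →
      (S.outEdges a).card = 2) ∧
    (∀ S : LGraph, S.IsComplexityOptimal n → ∀ a ∈ S.nodes, ∀ j ∈ Finset.Icc 1 n,
      (Node.x j ∈ (E a S).nodes ↔ Node.y j ∉ (L a S).nodes)) ∧
    (∀ S : LGraph, S.IsComplexityOptimal n → ∀ a ∈ S.nodes,
      ∃! b, b ∈ S.nodes ∧ S.IsComplementPair n a b) ∧
    (4 ≤ n → optimalSet n = {c : UGraph | ∃ (S : LGraph) (a b : Node),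
      S.IsComplexityOptimal (n - 1) ∧ S.IsComplementPair (n - 1) a b ∧ c = (g n a b S).toU}) ∧
    (optimalSet n).ncard = (2 * n - 5)‼ := by
  refine ⟨fun S hS a ha hout => hS.outEdges_card hn ha hout,
    fun S hS a ha j hj => hS.x_mem_E_iff hn ha hj, fun S hS a ha => ?_, fun h4 => ?_,
    ncard_optimalSet hn⟩
  · obtain ⟨hF, hR⟩ := hS.represents hn
    exact hR.existsUnique_complement hF.props ha
  · obtain ⟨m, rfl⟩ : ∃ m, n = m + 1 := ⟨n - 1, by omega⟩
    exact optimalSet_succ (by omega)
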